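/- **Setting.** Let $(p_m)_{m\ge 0}$ be a chain of real Adler–Moser polynomials: $p_0=1$, $\deg p_m=m(m+1)/2$, and $p_m p_{m+1}''-2p_m'p_{m+1}'+p_{m+1}p_m''=0$ for all $m\ge 0$. Let $n\ge 1$, let $S$ be a real polynomial, and consider the stratified medium in the plane ($z=x+iy$) with porosity $\eta(x)=p_{n-1}(x)S(x)$ and permeability $\kappa(x)$ given by $\kappa\eta=\xi(x)^{-2}$, $\xi=p_n/p_{n-1}$. Let $F$ be a complex polynomial that is injective on the unit disc $\{|w|<1\}$, let $\Omega=F(\{|w|<1\})$ and $z_1=F(0)$, and assume that $\eta$ and $\kappa$ are (finite and) positive on $\Omega$. A *regular solution* in an open set $U$ is a smooth function $\phi:U\to\mathbb C$ with $\nabla\cdot(\kappa\eta\nabla\phi)=0$ in $U$ (on $\Omega$ this is $\xi^2\nabla\xi^{-2}\nabla\phi=0$). For a real number $Q$ and complex numbers $Q_1,\dots,Q_k$ put $$\hat Q[\phi]=Q\,\phi+\sum_{j=1}^k\Big(Q_j\frac{\partial^j\phi}{\partial z^j}+\overline{Q_j}\,\frac{\partial^j\phi}{\partial\bar z^j}\Big).$$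 **Theorem.** Let $k$ be given by $$k+1=\Big(\deg S+\frac{n(n+1)}2+1\Big)\deg F .$$ Then there are a real number $Q$ and complex numbers $Q_1,\dots,Q_k$ with $Q_k\neq 0$ such that $\Omega$ is formed by injection of the fluxes $Q,Q_1,\dots,Q_k$ through a multipole source of order $k$ at $z_1$ into the initially empty medium, and such that the generalized quadrature identity $$\int_\Omega \eta\,\phi\,dx\,dy=2\pi\,\hat Q[\phi](z_1)$$ holds for all regular solutions $\phi$ in $\Omega$ for which $\eta\phi$ is integrable on $\Omega$. Here *formed by injection* means the following. There are a time $T>0$, an increasing family of sets $D(t)$, $0\le t\le T$, whose area depends continuously on $t$, with $D(0)=\emptyset$, $D(T)=\Omega$ and, for $0<t\le T$, $D(t)$ a bounded simply connected open set containing $z_1$, and integrable source strengths $q:[0,T]\to\mathbb R$, $q_j:[0,T]\to\mathbb C$ with $\int_0^Tq\,dt=Q$, $\int_0^Tq_j\,dt=Q_j$ ($1\le j\le k$), such that for every $t\in(0,T)$ and every regular solution $\phi$ in an open neighbourhood of the closure of $D(t)$ $$\frac{d}{dt}\int_{D(t)}\eta\,\phi\,dx\,dy=2\pi\Big(q(t)\phi+\sum_{j=1}^k\Big(q_j(t)\frac{\partial^j\phi}{\partial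 z^j}+\overline{q_j(t)}\,\frac{\partial^j\phi}{\partial\bar z^j}\Big)\Big)(z_1),$$ which is the law of motion of the free-boundary flow $v=\kappa\nabla P$, $\nabla\cdot\eta v=0$, $P=0$ on the boundary, driven by the multipole source, with the pressure $P$ eliminated. -/

import Mathlib

open scoped ContDiff

/-! ### Adler–Moser polynomials -/

/-- `p` is a chain of Adler–Moser (Burchnall–Chaundy) polynomials: `p₀ = 1`, `deg pₙ = n(n+1)/2` and
`pₙ pₙ₊₁'' - 2 pₙ' pₙ₊₁' + pₙ₊₁ pₙ'' = 0`. The degree condition excludes the degenerate solution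
`pₙ₊₁ = c pₙ₋₁` of the recurrence; the integration constants, the shift and the scaling are free. -/
def IsAdlerMoser (p : ℕ → Polynomial ℝ) : Prop :=
  p 0 = 1 ∧
  (∀ n, (p n).natDegree = n * (n + 1) / 2) ∧
  ∀ n, p n * (p (n + 1)).derivative.derivative
      - 2 * ((p n).derivative * (p (n + 1)).derivative)
      + p (n + 1) * (p n).derivative.derivative = 0

/-! ### The stratified medium -/

/-- `ξ(x) = pₙ(x) / pₙ₋₁(x)`, for `n ≥ 1`. -/
noncomputable def xi (p : ℕ → Polynomial ℝ) (n : ℕ) (x : ℝ) : ℝ :=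
  (p n).eval x / (p (n - 1)).eval x

/-- The porosity `η = pₙ₋₁(x) S(x)`, as a function on the plane, `x = Re z`. -/
noncomputable def porosity (p : ℕ → Polynomial ℝ) (n : ℕ) (S : Polynomial ℝ) (z : ℂ) : ℝ :=
  (p (n - 1)).eval z.re * S.eval z.re

/-- The permeability `κ = ξ(x)⁻² / η`, as a function on the plane, `x = Re z`. -/
noncomputable def permeability (p : ℕ → Polynomial ℝ) (n : ℕ) (S : Polynomial ℝ) (z : ℂ) : ℝ :=
  (xi p n z.re ^ 2)⁻¹ / porosity p n S z

theorem permeability_mul_porosity (p : ℕ → Polynomial ℝ) (n : ℕ) (S : Polynomial ℝ) (z : ℂ)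
    (h : porosity p n S z ≠ 0) :
    permeability p n S z * porosity p n S z = (xi p n z.re ^ 2)⁻¹ := by
  unfold permeability
  exact div_mul_cancel₀ _ h

/-! ### Derivatives in the plane and the elliptic equation -/

/-- `∂φ/∂x`. -/
noncomputable def dX (φ : ℂ → ℂ) (z : ℂ) : ℂ := fderiv ℝ φ z 1

/-- `∂φ/∂y`. -/
noncomputable def dY (φ : ℂ → ℂ) (z : ℂ) : ℂ := fderiv ℝ φ z Complex.I

/-- `∂φ/∂z = (∂φ/∂x - i ∂φ/∂y) / 2`. -/
noncomputable def dZ (φ : ℂ → ℂ) (z : ℂ) : ℂ := (dX φ z - Complex.I * dY φ z) / 2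

/-- `∂φ/∂z̄ = (∂φ/∂x + i ∂φ/∂y) / 2`. -/
noncomputable def dZbar (φ : ℂ → ℂ) (z : ℂ) : ℂ := (dX φ z + Complex.I * dY φ z) / 2

/-- `∇ · (σ ∇φ)`. -/
noncomputable def divGrad (σ : ℂ → ℝ) (φ : ℂ → ℂ) (z : ℂ) : ℂ :=
  dX (fun w => (σ w : ℂ) * dX φ w) z + dY (fun w => (σ w : ℂ) * dY φ w) z

/-- `φ` is a regular (smooth, complex-valued) solution of `∇ κη ∇φ = 0` in the open set `U`. -/
def IsRegularSolution (κ η : ℂ → ℝ) (U : Set ℂ) (φ : ℂ → ℂ) : Prop :=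
  ContDiffOn ℝ ∞ φ U ∧ ∀ z ∈ U, divGrad (fun w => κ w * η w) φ z = 0

/-! ### Multipole sources, quadrature identities, injection -/

/-- `Q φ(z₁) + ∑_{j=1}^k (Q_j ∂ʲφ/∂zʲ + conj(Q_j) ∂ʲφ/∂z̄ʲ)(z₁)`. -/
noncomputable def multipole (z₁ : ℂ) (k : ℕ) (Q : ℝ) (Qm : ℕ → ℂ) (φ : ℂ → ℂ) : ℂ :=
  Q * φ z₁ + ∑ j ∈ Finset.Icc 1 k,
    (Qm j * dZ^[j] φ z₁ + (starRingEnd ℂ) (Qm j) * dZbar^[j] φ z₁)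

/-- The generalized quadrature identity `∫_Ω ηφ dx dy = 2π Q̂[φ](z₁)`, for all regular solutions `φ`
in `Ω` for which the integral converges. -/
def QuadratureIdentity (κ η : ℂ → ℝ) (Ω : Set ℂ) (z₁ : ℂ) (k : ℕ) (Q : ℝ) (Qm : ℕ → ℂ) : Prop :=
  ∀ φ : ℂ → ℂ, IsRegularSolution κ η Ω φ →
    MeasureTheory.IntegrableOn (fun z => (η z : ℂ) * φ z) Ω →
    ∫ z in Ω, (η z : ℂ) * φ z = 2 * Real.pi * multipole z₁ k Q Qm φ

/-- The fluid domain `Ω` is formed, in the initially empty medium `(κ, η)`, by injection of the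
fluxes `Q, Q₁, …, Q_k` through a multipole source at `z₁`: there are bounded simply connected
fluid domains `D t`, `0 < t ≤ T`, growing from nothing to `D T = Ω`, and source strengths
`q(t), q_j(t)` with time integrals `Q, Q_j`, such that the free-boundary flow law (with the pressure
eliminated) `d/dt ∫_{D t} ηφ dx dy = 2π (q φ + ∑_j (q_j ∂ʲφ/∂zʲ + conj(q_j) ∂ʲφ/∂z̄ʲ))(z₁)` holds at
every time `t` for all solutions `φ` regular in a neighbourhood of the closure of `D t`. -/
def FormedByInjection (κ η : ℂ → ℝ) (Ω : Set ℂ) (z₁ : ℂ) (k : ℕ) (Q : ℝ) (Qm : ℕ → ℂ) : Prop :=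
  ∃ (T : ℝ) (D : ℝ → Set ℂ) (q : ℝ → ℝ) (qm : ℕ → ℝ → ℂ),
    0 < T ∧ D 0 = ∅ ∧ D T = Ω ∧ MonotoneOn D (Set.Icc 0 T) ∧
    (∀ t ∈ Set.Ioc 0 T, z₁ ∈ D t ∧ IsOpen (D t) ∧ Bornology.IsBounded (D t) ∧
      IsSimplyConnected (D t)) ∧
    -- the volume of fluid grows continuously from `0`
    ContinuousOn (fun t => (MeasureTheory.volume (D t)).toReal) (Set.Icc 0 T) ∧
    (∀ t ∈ Set.Ioo 0 T, ∀ (U : Set ℂ) (φ : ℂ → ℂ), IsOpen U → closure (D t) ⊆ U →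
      IsRegularSolution κ η U φ →
      HasDerivAt (fun s => ∫ z in D s, (η z : ℂ) * φ z)
        (2 * Real.pi * multipole z₁ k (q t) (fun j => qm j t) φ) t) ∧
    IntervalIntegrable q MeasureTheory.volume 0 T ∧ ∫ t in (0 : ℝ)..T, q t = Q ∧
    ∀ j ∈ Finset.Icc 1 k,
      IntervalIntegrable (qm j) MeasureTheory.volume 0 T ∧ ∫ t in (0 : ℝ)..T, qm j t = Qm j

/-! Write `D` for the unit disc. Away from the zeros of `ξ` and its denominator, the equation `∇ ξ⁻²
∇φ = 0` reads `∂∂̄φ = (ξ'/2ξ)(∂φ + ∂̄φ)`. Iterated Darboux transformations along the Adler–Moser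
chain give it the explicit solutions `φ_f = p_{n-1}(x)⁻¹ ∑_{j≤n} b_j(x) f⁽ʲ⁾(z)`, with `f` any
polynomial, `b_j` polynomials, `b_n = p_n` and `deg b_j ≤ n(n+1)/2` for `j ≤ n`
(`IsComplexChain.exists_dressing`). That the `b_j` stay polynomial is the algebraic heart: each
transform must be divisible by the previous `p`, which is checked by comparing orders of vanishing
at every complex root, all root multiplicities being triangular numbers.

The denominator of `φ_f` is a factor of `η`. Pulled back by `F` with the Jacobian `|F'|²` and with
`x = (F + F̄)/2`, the function `ηφ_f` is therefore a polynomial in `w` and `w̄`. Its degree in `w̄`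
is at most `(deg S + n(n+1)/2) deg F + deg F - 1 = k`, so `(∂∂̄)^{k+1}` annihilates it. The same
holds for every regular solution without any approximation theorem: at a point, the equation
determines the mixed derivatives of a solution from the pure ones, and the pure derivatives of `φ_f
+ conj φ_g` can be prescribed to any finite order (`exists_testPair`,
`IsGermSolution.mixedDeriv_pullback_eq_zero_of_natDegree`).

Pizzetti's formula (`setIntegral_ball_of_polyharmonic`) then gives the integral of the pull-back
over the disc of radius `r < 1` as a combination of `r^{2i+2} (∂∂̄)^i` at `0`, `i ≤ k`. Each of
these is a functional of the pure derivatives of `φ` at `z₁` up to order `k`, hence a multipole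
(`exists_multipole`). So `∫_{F(rD)} ηφ = 2π ∑_i r^{2i+2} M_i[φ]` with fixed multipoles `M_i`
(`IsAdlerMoser.exists_fluxes`). Differentiating in `r` shows that the domains `F(rD)` follow the
flow law; letting `r → 1` gives the quadrature identity.

For `Q_k ≠ 0`, test with `f = (z - z₁)^{n+k}`: of the derivatives entering the multipoles only
`∂ᵏφ_f(z₁)` can survive, the terms `i < k` vanish, and the term `i = k` involves the coefficient of
`w̄ᵏ`, which is nonzero because the degree count is exact for `b_n = p_n`. -/

open Filter Topology

local notation "conj" => starRingEnd ℂ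

/-! ### Wirtinger calculus for germs of smooth functions -/

/-- `(∂/∂x + c ∂/∂y) / 2`: this is `∂/∂z` for `c = -i` and `∂/∂z̄` for `c = i`. -/
noncomputable def wirtinger (c : ℂ) (u : ℂ → ℂ) (z : ℂ) : ℂ := (dX u z + c * dY u z) / 2

theorem dZ_eq_wirtinger : dZ = wirtinger (-Complex.I) := by
  funext u z
  simp only [dZ, wirtinger]
  ring

theorem dZbar_eq_wirtinger : dZbar = wirtinger Complex.I := rfl

theorem ContDiffAt.eventually_differentiableAt {u : ℂ → ℂ} {z : ℂ} (hu : ContDiffAt ℝ ∞ u z) :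
    ∀ᶠ y in 𝓝 z, DifferentiableAt ℝ u y := by
  have h1 : ContDiffAt ℝ 1 u z := hu.of_le (by exact_mod_cast le_top)
  filter_upwards [h1.eventually (by decide)] with y hy
  exact hy.differentiableAt (by decide)

theorem ContDiffAt.fderiv_const_apply {u : ℂ → ℂ} {z : ℂ} (hu : ContDiffAt ℝ ∞ u z) (v : ℂ) :
    ContDiffAt ℝ ∞ (fun w => fderiv ℝ u w v) z :=
  (hu.fderiv_right (m := ∞) (by simp)).clm_apply contDiffAt_const

theorem ContDiffAt.wirtinger {u : ℂ → ℂ} {z : ℂ} (hu : ContDiffAt ℝ ∞ u z) (c : ℂ) :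
    ContDiffAt ℝ ∞ (wirtinger c u) z :=
  ((hu.fderiv_const_apply 1).add
    (contDiffAt_const.mul (hu.fderiv_const_apply Complex.I))).div_const 2

theorem ContDiffAt.iterate_wirtinger {u : ℂ → ℂ} {z : ℂ} (hu : ContDiffAt ℝ ∞ u z) (c : ℂ)
    (n : ℕ) : ContDiffAt ℝ ∞ ((_root_.wirtinger c)^[n] u) z := by
  induction n generalizing u with
  | zero => exact hu
  | succ n ih => exact ih (hu.wirtinger c)

theorem wirtinger_congr {u v : ℂ → ℂ} {z : ℂ} (h : u =ᶠ[𝓝 z] v) (c : ℂ) :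
    wirtinger c u =ᶠ[𝓝 z] wirtinger c v := by
  filter_upwards [h.fderiv (𝕜 := ℝ)] with y hy
  simp only [wirtinger, dX, dY, hy]

theorem iterate_wirtinger_congr {u v : ℂ → ℂ} {z : ℂ} (h : u =ᶠ[𝓝 z] v) (c : ℂ) (n : ℕ) :
    (wirtinger c)^[n] u =ᶠ[𝓝 z] (wirtinger c)^[n] v := by
  induction n generalizing u v with
  | zero => exact h
  | succ n ih => exact ih (wirtinger_congr h c)

theorem wirtinger_add {u v : ℂ → ℂ} {z : ℂ} (hu : DifferentiableAt ℝ u z)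
    (hv : DifferentiableAt ℝ v z) (c : ℂ) :
    wirtinger c (fun w => u w + v w) z = wirtinger c u z + wirtinger c v z := by
  simp only [wirtinger, dX, dY, fderiv_fun_add hu hv, _root_.add_apply]
  ring

theorem wirtinger_mul {u v : ℂ → ℂ} {z : ℂ} (hu : DifferentiableAt ℝ u z)
    (hv : DifferentiableAt ℝ v z) (c : ℂ) :
    wirtinger c (fun w => u w * v w) z = wirtinger c u z * v z + u z * wirtinger c v z := by
  simp only [wirtinger, dX, dY, fderiv_fun_mul hu hv, _root_.add_apply,
    _root_.smul_apply, smul_eq_mul]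
  ring

theorem wirtinger_const_mul {u : ℂ → ℂ} {z : ℂ} (hu : DifferentiableAt ℝ u z) (a c : ℂ) :
    wirtinger c (fun w => a * u w) z = a * wirtinger c u z := by
  simp only [wirtinger, dX, dY, fderiv_const_mul hu, _root_.smul_apply, smul_eq_mul]
  ring

theorem iterate_wirtinger_add {u v : ℂ → ℂ} {z : ℂ} (hu : ContDiffAt ℝ ∞ u z)
    (hv : ContDiffAt ℝ ∞ v z) (c : ℂ) (n : ℕ) :
    (wirtinger c)^[n] (fun w => u w + v w) =ᶠ[𝓝 z]
      fun w => (wirtinger c)^[n] u w + (wirtinger c)^[n] v w := by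
  induction n generalizing u v with
  | zero => rfl
  | succ n ih =>
    have : wirtinger c (fun w => u w + v w) =ᶠ[𝓝 z]
        fun w => wirtinger c u w + wirtinger c v w := by
      filter_upwards [hu.eventually_differentiableAt, hv.eventually_differentiableAt] with y h1 h2
      exact wirtinger_add h1 h2 c
    exact (iterate_wirtinger_congr this c n).trans (ih (hu.wirtinger c) (hv.wirtinger c))

theorem iterate_wirtinger_const_mul {u : ℂ → ℂ} {z : ℂ} (hu : ContDiffAt ℝ ∞ u z)
    (a c : ℂ) (n : ℕ) :
    (wirtinger c)^[n] (fun w => a * u w) =ᶠ[𝓝 z] fun w => a * (wirtinger c)^[n] u w := by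
  induction n generalizing u with
  | zero => rfl
  | succ n ih =>
    have : wirtinger c (fun w => a * u w) =ᶠ[𝓝 z] fun w => a * wirtinger c u w := by
      filter_upwards [hu.eventually_differentiableAt] with y h1
      exact wirtinger_const_mul h1 a c
    exact (iterate_wirtinger_congr this c n).trans (ih (hu.wirtinger c))

theorem wirtinger_comm {u : ℂ → ℂ} {z : ℂ} (hu : ContDiffAt ℝ 2 u z) (c d : ℂ) :
    wirtinger c (wirtinger d u) z = wirtinger d (wirtinger c u) z := by
  have hsymm : IsSymmSndFDerivAt ℝ u z := hu.isSymmSndFDerivAt (by simp)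
  have hf : ContDiffAt ℝ 1 (fderiv ℝ u) z := hu.fderiv_right (by norm_num)
  have hd : DifferentiableAt ℝ (fderiv ℝ u) z := hf.differentiableAt (by simp)
  have key : ∀ v w : ℂ, fderiv ℝ (fun y => fderiv ℝ u y v) z w = fderiv ℝ (fderiv ℝ u) z w v := by
    intro v w
    rw [fderiv_clm_apply hd (differentiableAt_const v)]
    simp
  have hdx : ∀ v, DifferentiableAt ℝ (fun y => fderiv ℝ u y v) z :=
    fun v => (hf.clm_apply contDiffAt_const).differentiableAt (by simp)
  have exp : ∀ e w : ℂ, fderiv ℝ (wirtinger e u) z w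
      = (fderiv ℝ (fderiv ℝ u) z w 1 + e * fderiv ℝ (fderiv ℝ u) z w Complex.I) / 2 := by
    intro e w
    have h : HasFDerivAt (wirtinger e u) ((2 : ℂ)⁻¹ • (fderiv ℝ (fun y => fderiv ℝ u y 1) z +
        e • fderiv ℝ (fun y => fderiv ℝ u y Complex.I) z)) z := by
      have := ((hdx 1).hasFDerivAt.add ((hdx Complex.I).hasFDerivAt.const_mul e)).const_mul
        ((2 : ℂ)⁻¹)
      refine this.congr_of_eventuallyEq (Eventually.of_forall fun y => ?_)
      simp only [wirtinger, dX, dY, Pi.add_apply]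
      ring
    rw [h.fderiv]
    simp only [_root_.smul_apply, _root_.add_apply, smul_eq_mul, key]
    ring
  have e1 : wirtinger c (wirtinger d u) z = (fderiv ℝ (wirtinger d u) z 1
      + c * fderiv ℝ (wirtinger d u) z Complex.I) / 2 := rfl
  have e2 : wirtinger d (wirtinger c u) z = (fderiv ℝ (wirtinger c u) z 1
      + d * fderiv ℝ (wirtinger c u) z Complex.I) / 2 := rfl
  rw [e1, e2, exp, exp, exp, exp, hsymm.eq 1 Complex.I]
  ring

theorem wirtinger_comm_eventually {u : ℂ → ℂ} {z : ℂ} (hu : ContDiffAt ℝ ∞ u z) (c d : ℂ) :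
    wirtinger c (wirtinger d u) =ᶠ[𝓝 z] wirtinger d (wirtinger c u) := by
  have h2 : ContDiffAt ℝ 2 u z := hu.of_le (WithTop.coe_le_coe.2 (le_top : (2 : ℕ∞) ≤ ⊤))
  filter_upwards [h2.eventually (by simp)] with y hy
  exact wirtinger_comm hy c d

theorem wirtinger_iterate_comm {u : ℂ → ℂ} {z : ℂ} (hu : ContDiffAt ℝ ∞ u z) (c d : ℂ) (n : ℕ) :
    wirtinger c ((wirtinger d)^[n] u) =ᶠ[𝓝 z] (wirtinger d)^[n] (wirtinger c u) := by
  induction n generalizing u with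
  | zero => rfl
  | succ n ih =>
    exact (ih (hu.wirtinger d)).trans
      (iterate_wirtinger_congr (wirtinger_comm_eventually hu c d) d n)

/-! ### Mixed Wirtinger derivatives and vanishing jets. -/

/-- The mixed derivative `∂ᵃ⁺ᵇ u / ∂zᵃ ∂z̄ᵇ`. -/
noncomputable def mixedDeriv (a b : ℕ) (u : ℂ → ℂ) : ℂ → ℂ := dZ^[a] (dZbar^[b] u)

theorem ContDiffAt.dZ {u : ℂ → ℂ} {z : ℂ} (hu : ContDiffAt ℝ ∞ u z) :
    ContDiffAt ℝ ∞ (dZ u) z := dZ_eq_wirtinger ▸ hu.wirtinger _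

theorem ContDiffAt.dZbar {u : ℂ → ℂ} {z : ℂ} (hu : ContDiffAt ℝ ∞ u z) :
    ContDiffAt ℝ ∞ (dZbar u) z := hu.wirtinger _

theorem dZ_congr {u v : ℂ → ℂ} {z : ℂ} (h : u =ᶠ[𝓝 z] v) : dZ u =ᶠ[𝓝 z] dZ v :=
  dZ_eq_wirtinger ▸ wirtinger_congr h _

theorem dZbar_congr {u v : ℂ → ℂ} {z : ℂ} (h : u =ᶠ[𝓝 z] v) : dZbar u =ᶠ[𝓝 z] dZbar v :=
  wirtinger_congr h _

theorem mixedDeriv_congr {u v : ℂ → ℂ} {z : ℂ} (h : u =ᶠ[𝓝 z] v) (a b : ℕ) :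
    mixedDeriv a b u =ᶠ[𝓝 z] mixedDeriv a b v := by
  unfold mixedDeriv
  rw [dZ_eq_wirtinger, dZbar_eq_wirtinger]
  exact iterate_wirtinger_congr (iterate_wirtinger_congr h _ b) _ a

theorem mixedDeriv_add {u v : ℂ → ℂ} {z : ℂ} (hu : ContDiffAt ℝ ∞ u z) (hv : ContDiffAt ℝ ∞ v z)
    (a b : ℕ) : mixedDeriv a b (fun w => u w + v w) =ᶠ[𝓝 z]
      fun w => mixedDeriv a b u w + mixedDeriv a b v w := by
  unfold mixedDeriv
  rw [dZ_eq_wirtinger, dZbar_eq_wirtinger]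
  exact (iterate_wirtinger_congr (iterate_wirtinger_add hu hv _ b) _ a).trans
    (iterate_wirtinger_add (hu.iterate_wirtinger _ b) (hv.iterate_wirtinger _ b) _ a)

theorem mixedDeriv_const_mul {u : ℂ → ℂ} {z : ℂ} (hu : ContDiffAt ℝ ∞ u z) (k : ℂ)
    (a b : ℕ) : mixedDeriv a b (fun w => k * u w) =ᶠ[𝓝 z] fun w => k * mixedDeriv a b u w := by
  unfold mixedDeriv
  rw [dZ_eq_wirtinger, dZbar_eq_wirtinger]
  exact (iterate_wirtinger_congr (iterate_wirtinger_const_mul hu k _ b) _ a).trans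
    (iterate_wirtinger_const_mul (hu.iterate_wirtinger _ b) k _ a)

theorem mixedDeriv_sum {ι : Type*} (s : Finset ι) {u : ι → ℂ → ℂ} {z : ℂ}
    (hu : ∀ i ∈ s, ContDiffAt ℝ ∞ (u i) z) (a b : ℕ) :
    mixedDeriv a b (fun w => ∑ i ∈ s, u i w) =ᶠ[𝓝 z] fun w => ∑ i ∈ s, mixedDeriv a b (u i) w := by
  classical
  induction s using Finset.induction_on with
  | empty =>
    simpa using mixedDeriv_const_mul (u := fun _ => (0 : ℂ)) (z := z) contDiffAt_const 0 a b
  | insert i s hi ih =>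
    simp only [Finset.sum_insert hi]
    have hs : ∀ j ∈ s, ContDiffAt ℝ ∞ (u j) z := fun j hj => hu j (Finset.mem_insert_of_mem hj)
    refine (mixedDeriv_add (hu i (Finset.mem_insert_self i s)) (ContDiffAt.sum hs) a b).trans ?_
    filter_upwards [ih hs] with w hw
    rw [hw]

theorem mixedDeriv_add_apply {u v : ℂ → ℂ} {z : ℂ} (hu : ContDiffAt ℝ ∞ u z)
    (hv : ContDiffAt ℝ ∞ v z) (a b : ℕ) :
    mixedDeriv a b (fun w => u w + v w) z = mixedDeriv a b u z + mixedDeriv a b v z :=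
  (mixedDeriv_add hu hv a b).self_of_nhds

theorem mixedDeriv_const_mul_apply {u : ℂ → ℂ} {z : ℂ} (hu : ContDiffAt ℝ ∞ u z) (k : ℂ)
    (a b : ℕ) : mixedDeriv a b (fun w => k * u w) z = k * mixedDeriv a b u z :=
  (mixedDeriv_const_mul hu k a b).self_of_nhds

theorem mixedDeriv_sum_apply {ι : Type*} (s : Finset ι) {u : ι → ℂ → ℂ} {z : ℂ}
    (hu : ∀ i ∈ s, ContDiffAt ℝ ∞ (u i) z) (a b : ℕ) :
    mixedDeriv a b (fun w => ∑ i ∈ s, u i w) z = ∑ i ∈ s, mixedDeriv a b (u i) z :=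
  (mixedDeriv_sum s hu a b).self_of_nhds

theorem mixedDeriv_dZbar (a b : ℕ) (u : ℂ → ℂ) :
    mixedDeriv a (b + 1) u = mixedDeriv a b (dZbar u) := rfl

theorem mixedDeriv_dZ {u : ℂ → ℂ} {z : ℂ} (hu : ContDiffAt ℝ ∞ u z) (a b : ℕ) :
    mixedDeriv (a + 1) b u =ᶠ[𝓝 z] mixedDeriv a b (dZ u) := by
  unfold mixedDeriv
  rw [dZ_eq_wirtinger, dZbar_eq_wirtinger, Function.iterate_succ_apply]
  exact iterate_wirtinger_congr (wirtinger_iterate_comm hu _ _ b) _ a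

/-- Links the iterated Laplacian of Pizzetti's formula (up to powers of 4) to the separated form in
which holomorphic and antiholomorphic degrees can be counted. -/
theorem iterate_dZ_dZbar_eq {u : ℂ → ℂ} {z : ℂ} (hu : ContDiffAt ℝ ∞ u z) (n : ℕ) :
    (fun v => dZ (dZbar v))^[n] u =ᶠ[𝓝 z] mixedDeriv n n u := by
  induction n generalizing u with
  | zero => rfl
  | succ n ih =>
    rw [Function.iterate_succ_apply]
    refine (ih hu.dZbar.dZ).trans ?_
    exact (mixedDeriv_dZ hu.dZbar n n).symm

theorem dZ_mul_eventually {u v : ℂ → ℂ} {z : ℂ} (hu : ContDiffAt ℝ ∞ u z)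
    (hv : ContDiffAt ℝ ∞ v z) :
    dZ (fun w => u w * v w) =ᶠ[𝓝 z] fun w => dZ u w * v w + u w * dZ v w := by
  rw [dZ_eq_wirtinger]
  filter_upwards [hu.eventually_differentiableAt, hv.eventually_differentiableAt] with y h1 h2
  exact wirtinger_mul h1 h2 _

theorem dZbar_mul_eventually {u v : ℂ → ℂ} {z : ℂ} (hu : ContDiffAt ℝ ∞ u z)
    (hv : ContDiffAt ℝ ∞ v z) :
    dZbar (fun w => u w * v w) =ᶠ[𝓝 z] fun w => dZbar u w * v w + u w * dZbar v w := by
  filter_upwards [hu.eventually_differentiableAt, hv.eventually_differentiableAt] with y h1 h2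
  exact wirtinger_mul h1 h2 _

/-- All mixed derivatives of order at most `a` in `z` and at most `b` in `z̄` vanish at `z₀`. -/
def JetVanish (a b : ℕ) (u : ℂ → ℂ) (z₀ : ℂ) : Prop :=
  ∀ i ≤ a, ∀ j ≤ b, mixedDeriv i j u z₀ = 0

theorem JetVanish.mono {a b a' b' : ℕ} {u : ℂ → ℂ} {z₀ : ℂ} (h : JetVanish a b u z₀)
    (ha : a' ≤ a) (hb : b' ≤ b) : JetVanish a' b' u z₀ :=
  fun i hi j hj => h i (hi.trans ha) j (hj.trans hb)

theorem JetVanish.dZbar {a b : ℕ} {u : ℂ → ℂ} {z₀ : ℂ} (h : JetVanish a (b + 1) u z₀) :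
    JetVanish a b (dZbar u) z₀ :=
  fun i hi j hj => h i hi (j + 1) (by omega)

theorem JetVanish.dZ {a b : ℕ} {u : ℂ → ℂ} {z₀ : ℂ} (hu : ContDiffAt ℝ ∞ u z₀)
    (h : JetVanish (a + 1) b u z₀) : JetVanish a b (dZ u) z₀ :=
  fun i hi j hj => by
    rw [← (mixedDeriv_dZ hu i j).self_of_nhds]
    exact h (i + 1) (by omega) j hj

/-- By Leibniz, every term contains a derivative of `u` inside the box of orders at most `(a, b)`.
-/
theorem JetVanish.mixedDeriv_mul {a b : ℕ} {α u : ℂ → ℂ} {z₀ : ℂ} (hα : ContDiffAt ℝ ∞ α z₀)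
    (hu : ContDiffAt ℝ ∞ u z₀) (h : JetVanish a b u z₀) :
    mixedDeriv a b (fun w => α w * u w) z₀ = 0 := by
  induction b generalizing α u with
  | zero =>
    induction a generalizing α u with
    | zero =>
      have := h 0 le_rfl 0 le_rfl
      simp only [mixedDeriv, Function.iterate_zero, id_eq] at this ⊢
      rw [this, mul_zero]
    | succ a ih =>
      rw [(mixedDeriv_dZ (hα.mul hu) a 0).self_of_nhds,
        (mixedDeriv_congr (dZ_mul_eventually hα hu) a 0).self_of_nhds,
        mixedDeriv_add_apply (hα.dZ.mul hu) (hα.mul hu.dZ) a 0,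
        ih hα.dZ hu (h.mono (by omega) le_rfl), ih hα hu.dZ (h.dZ hu), add_zero]
  | succ b ih =>
    rw [mixedDeriv_dZbar, (mixedDeriv_congr (dZbar_mul_eventually hα hu) a b).self_of_nhds,
      mixedDeriv_add_apply (hα.dZbar.mul hu) (hα.mul hu.dZbar) a b,
      ih hα.dZbar hu (h.mono le_rfl (by omega)), ih hα hu.dZbar h.dZbar, add_zero]

theorem JetVanish.mul {a b : ℕ} {α u : ℂ → ℂ} {z₀ : ℂ} (hα : ContDiffAt ℝ ∞ α z₀)
    (hu : ContDiffAt ℝ ∞ u z₀) (h : JetVanish a b u z₀) :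
    JetVanish a b (fun w => α w * u w) z₀ :=
  fun _ hi _ hj => JetVanish.mixedDeriv_mul hα hu (h.mono hi hj)

/-- If all `z`-derivatives of `u` of order less than `n` vanish at `z₀`, then the `n`-th
`z`-derivative of `α u` there is `α(z₀)` times that of `u`. -/
theorem mixedDeriv_mul_of_vanish {n : ℕ} {α u : ℂ → ℂ} {z₀ : ℂ} (hα : ContDiffAt ℝ ∞ α z₀)
    (hu : ContDiffAt ℝ ∞ u z₀) (h : ∀ i < n, mixedDeriv i 0 u z₀ = 0) :
    mixedDeriv n 0 (fun w => α w * u w) z₀ = α z₀ * mixedDeriv n 0 u z₀ := by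
  induction n generalizing u with
  | zero => rfl
  | succ n ih =>
    have hv : JetVanish n 0 u z₀ := fun i hi j hj => by
      obtain rfl : j = 0 := by omega
      exact h i (by omega)
    rw [(mixedDeriv_dZ (hα.mul hu) n 0).self_of_nhds,
      (mixedDeriv_congr (dZ_mul_eventually hα hu) n 0).self_of_nhds,
      mixedDeriv_add_apply (hα.dZ.mul hu) (hα.mul hu.dZ) n 0,
      JetVanish.mixedDeriv_mul hα.dZ hu hv, zero_add,
      ih hu.dZ fun i hi => by
        rw [← (mixedDeriv_dZ hu i 0).self_of_nhds]; exact h (i + 1) (by omega),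
      (mixedDeriv_dZ hu n 0).self_of_nhds]

/-- `u` is a smooth solution of `∂²u/∂z∂z̄ = α ∂u/∂z + β ∂u/∂z̄` near `z₀`. -/
def IsGermSolution (α β : ℂ → ℂ) (z₀ : ℂ) (u : ℂ → ℂ) : Prop :=
  ContDiffAt ℝ ∞ u z₀ ∧ dZ (dZbar u) =ᶠ[𝓝 z₀] fun z => α z * dZ u z + β z * dZbar u z

/-- The mixed derivatives of a solution are controlled by the pure ones. -/
theorem IsGermSolution.jetVanish {α β : ℂ → ℂ} {z₀ : ℂ} {u : ℂ → ℂ}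
    (hu : IsGermSolution α β z₀ u) (hα : ContDiffAt ℝ ∞ α z₀) (hβ : ContDiffAt ℝ ∞ β z₀) {n : ℕ}
    (hz : ∀ j ≤ n, mixedDeriv j 0 u z₀ = 0) (hzb : ∀ j ≤ n, mixedDeriv 0 j u z₀ = 0) :
    JetVanish n n u z₀ := by
  obtain ⟨hs, he⟩ := hu
  -- Induction on the total order: one application of the equation trades `∂∂̄` for first-order
  -- terms, so a derivative with both indices positive reduces to derivatives of `u` of smaller
  -- total order inside the same box.
  suffices H : ∀ m a b : ℕ, a + b = m → a ≤ n → b ≤ n → mixedDeriv a b u z₀ = 0 from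
    fun i hi j hj => H _ i j rfl hi hj
  intro m
  induction m using Nat.strong_induction_on with
  | _ m ih =>
    intro a b hab ha hb
    obtain _ | a := a
    · exact hzb b hb
    obtain _ | b := b
    · exact hz _ ha
    have h1 : JetVanish a b (dZ u) z₀ := fun i hi j hj => by
      rw [← (mixedDeriv_dZ hs i j).self_of_nhds]
      exact ih (i + 1 + j) (by omega) _ _ rfl (by omega) (by omega)
    have h2 : JetVanish a b (dZbar u) z₀ := fun i hi j hj =>
      ih (i + (j + 1)) (by omega) _ _ rfl (by omega) (by omega)
    rw [mixedDeriv_dZbar, (mixedDeriv_dZ hs.dZbar a b).self_of_nhds,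
      (mixedDeriv_congr he a b).self_of_nhds,
      mixedDeriv_add_apply (hα.mul hs.dZ) (hβ.mul hs.dZbar) a b,
      h1.mixedDeriv_mul hα hs.dZ, h2.mixedDeriv_mul hβ hs.dZbar, add_zero]

/-! ### Holomorphic functions, conjugates, functions of `x` alone, composition with a polynomial. -/

theorem fderiv_apply_eq_dZ_dZbar (u : ℂ → ℂ) (z v : ℂ) :
    fderiv ℝ u z v = v * dZ u z + conj v * dZbar u z := by
  have hv : v = (v.re : ℝ) • (1 : ℂ) + (v.im : ℝ) • Complex.I := by
    simp [Complex.re_add_im]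
  have hc : conj v = (v.re : ℂ) - v.im * Complex.I := by
    apply Complex.ext <;> simp
  have h : fderiv ℝ u z v = v.re * dX u z + v.im * dY u z := by
    conv_lhs => rw [hv]
    rw [map_add, map_smul, map_smul]
    simp [dX, dY]
  rw [h, hc]
  simp only [dZ, dZbar]
  linear_combination (-(dX u z - Complex.I * dY u z) / 2) * (Complex.re_add_im v).symm +
    ((v.im : ℂ) * dY u z) * Complex.I_mul_I

theorem HasDerivAt.dZ_eq {u : ℂ → ℂ} {u' z : ℂ} (h : HasDerivAt u u' z) : dZ u z = u' := by
  have h1 := (h.hasFDerivAt.restrictScalars ℝ).fderiv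
  simp only [dZ, dX, dY, h1]
  simp
  linear_combination (-u' / 2) * Complex.I_mul_I

theorem HasDerivAt.dZbar_eq {u : ℂ → ℂ} {u' z : ℂ} (h : HasDerivAt u u' z) : dZbar u z = 0 := by
  have h1 := (h.hasFDerivAt.restrictScalars ℝ).fderiv
  simp only [dZbar, dX, dY, h1]
  simp
  linear_combination u' * Complex.I_mul_I

theorem HasDerivAt.hasFDerivAt_re {g : ℝ → ℂ} {g' : ℂ} {z : ℂ} (h : HasDerivAt g g' z.re) :
    HasFDerivAt (fun w : ℂ => g w.re) ((Complex.reCLM.smulRight g' : ℂ →L[ℝ] ℂ)) z := by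
  refine (h.hasFDerivAt.comp z Complex.reCLM.hasFDerivAt).congr_fderiv ?_
  ext v
  simp

theorem HasDerivAt.dZ_re {g : ℝ → ℂ} {g' : ℂ} {z : ℂ} (h : HasDerivAt g g' z.re) :
    dZ (fun w => g w.re) z = g' / 2 := by
  simp [dZ, dX, dY, h.hasFDerivAt_re.fderiv]

theorem HasDerivAt.dZbar_re {g : ℝ → ℂ} {g' : ℂ} {z : ℂ} (h : HasDerivAt g g' z.re) :
    dZbar (fun w => g w.re) z = g' / 2 := by
  simp [dZbar, dX, dY, h.hasFDerivAt_re.fderiv]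

theorem dZ_polynomial_re (c : Polynomial ℂ) :
    dZ (fun w => c.eval (w.re : ℂ)) = fun w => c.derivative.eval (w.re : ℂ) / 2 :=
  funext fun w => HasDerivAt.dZ_re (g := fun x : ℝ => c.eval (x : ℂ))
    (c.hasDerivAt (w.re : ℂ)).comp_ofReal

theorem dZbar_polynomial_re (c : Polynomial ℂ) :
    dZbar (fun w => c.eval (w.re : ℂ)) = fun w => c.derivative.eval (w.re : ℂ) / 2 :=
  funext fun w => HasDerivAt.dZbar_re (g := fun x : ℝ => c.eval (x : ℂ))
    (c.hasDerivAt (w.re : ℂ)).comp_ofReal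

theorem fderiv_conj_comp (u : ℂ → ℂ) (z v : ℂ) :
    fderiv ℝ (fun w => conj (u w)) z v = conj (fderiv ℝ u z v) := by
  have : fderiv ℝ (Complex.conjCLE ∘ u) z = _ := Complex.conjCLE.comp_fderiv
  have h2 : (fun w => conj (u w)) = Complex.conjCLE ∘ u := by ext; simp
  rw [h2, this]
  simp

theorem dZ_conj (u : ℂ → ℂ) : dZ (fun w => conj (u w)) = fun w => conj (dZbar u w) := by
  funext z
  simp only [dZ, dZbar, dX, dY, fderiv_conj_comp]
  simp [sub_eq_add_neg, map_ofNat]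

theorem dZbar_conj (u : ℂ → ℂ) : dZbar (fun w => conj (u w)) = fun w => conj (dZ u w) := by
  funext z
  simp only [dZ, dZbar, dX, dY, fderiv_conj_comp]
  simp [map_ofNat]

theorem iterate_dZ_conj (u : ℂ → ℂ) (n : ℕ) :
    dZ^[n] (fun w => conj (u w)) = fun w => conj (dZbar^[n] u w) := by
  induction n generalizing u with
  | zero => rfl
  | succ n ih => simp only [Function.iterate_succ_apply, dZ_conj, ih]

theorem dZ_polynomial (P : Polynomial ℂ) :
    dZ (fun w => P.eval w) = fun w => P.derivative.eval w :=
  funext fun w => (P.hasDerivAt w).dZ_eq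

theorem dZbar_polynomial (P : Polynomial ℂ) : dZbar (fun w => P.eval w) = fun _ => 0 :=
  funext fun w => (P.hasDerivAt w).dZbar_eq

theorem contDiffAt_polynomial (P : Polynomial ℂ) (z : ℂ) :
    ContDiffAt ℝ ∞ (fun w => P.eval w) z := by
  have : ContDiff ℂ ∞ (fun w => Polynomial.aeval w P) := P.contDiff_aeval _
  simp only [Polynomial.coe_aeval_eq_eval] at this
  exact (this.restrict_scalars ℝ).contDiffAt

theorem contDiffAt_polynomial_re (c : Polynomial ℂ) (z : ℂ) :
    ContDiffAt ℝ ∞ (fun w => c.eval (w.re : ℂ)) z :=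
  ContDiffAt.comp z (contDiffAt_polynomial c _)
    (Complex.ofRealCLM.comp Complex.reCLM).contDiff.contDiffAt

theorem contDiffAt_conj {u : ℂ → ℂ} {z : ℂ} (hu : ContDiffAt ℝ ∞ u z) :
    ContDiffAt ℝ ∞ (fun w => conj (u w)) z :=
  Complex.conjCLE.contDiff.contDiffAt.comp z hu

theorem dZ_polynomial_mul_conj (P R : Polynomial ℂ) :
    dZ (fun w => P.eval w * conj (R.eval w)) =
      fun w => P.derivative.eval w * conj (R.eval w) := by
  funext z
  have h1 := (contDiffAt_polynomial P z).differentiableAt (by simp)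
  have h2 := (contDiffAt_conj (contDiffAt_polynomial R z)).differentiableAt (by simp)
  have h3 := wirtinger_mul h1 h2 (-Complex.I)
  rw [← dZ_eq_wirtinger, dZ_polynomial, dZ_conj, dZbar_polynomial] at h3
  simpa using h3

theorem dZbar_polynomial_mul_conj (P R : Polynomial ℂ) :
    dZbar (fun w => P.eval w * conj (R.eval w)) =
      fun w => P.eval w * conj (R.derivative.eval w) := by
  funext z
  have h1 := (contDiffAt_polynomial P z).differentiableAt (by simp)
  have h2 := (contDiffAt_conj (contDiffAt_polynomial R z)).differentiableAt (by simp)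
  have h3 := wirtinger_mul h1 h2 Complex.I
  rw [← dZbar_eq_wirtinger, dZbar_polynomial, dZbar_conj, dZ_polynomial] at h3
  simpa using h3

/-- `w` and `w̄` behave as independent variables; a degree bound on `R` thus turns into
polyharmonicity. -/
theorem mixedDeriv_polynomial_mul_conj (P R : Polynomial ℂ) (a b : ℕ) :
    mixedDeriv a b (fun w => P.eval w * conj (R.eval w)) =
      fun w => (Polynomial.derivative^[a] P).eval w *
        conj ((Polynomial.derivative^[b] R).eval w) := by
  unfold mixedDeriv
  have h1 : ∀ R : Polynomial ℂ, dZbar^[b] (fun w => P.eval w * conj (R.eval w)) =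
      fun w => P.eval w * conj ((Polynomial.derivative^[b] R).eval w) := by
    induction b with
    | zero => exact fun R => rfl
    | succ b ih =>
      intro R
      rw [Function.iterate_succ_apply, dZbar_polynomial_mul_conj, ih, Function.iterate_succ_apply]
  rw [h1]
  generalize Polynomial.derivative^[b] R = R'
  clear h1
  induction a generalizing P with
  | zero => rfl
  | succ a ih => rw [Function.iterate_succ_apply, dZ_polynomial_mul_conj, ih,
      Function.iterate_succ_apply]

theorem mixedDeriv_polynomial (P : Polynomial ℂ) (a : ℕ) :
    mixedDeriv a 0 (fun w => P.eval w) = fun w => (Polynomial.derivative^[a] P).eval w := by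
  simpa using mixedDeriv_polynomial_mul_conj P 1 a 0

theorem mixedDeriv_polynomial_succ (P : Polynomial ℂ) (a b : ℕ) :
    mixedDeriv a (b + 1) (fun w => P.eval w) = fun _ => 0 := by
  simpa using mixedDeriv_polynomial_mul_conj P 1 a (b + 1)

theorem mixedDeriv_conj_apply {u : ℂ → ℂ} {z : ℂ} (hu : ContDiffAt ℝ ∞ u z) (a b : ℕ) :
    mixedDeriv a b (fun w => conj (u w)) z = conj (mixedDeriv b a u z) := by
  induction b generalizing u with
  | zero =>
    simp only [mixedDeriv, Function.iterate_zero, id_eq, iterate_dZ_conj]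
  | succ b ih =>
    rw [mixedDeriv_dZbar, dZbar_conj, ih hu.dZ, (mixedDeriv_dZ hu b a).self_of_nhds]

theorem wirtinger_comp_polynomial {u : ℂ → ℂ} (F : Polynomial ℂ) {w : ℂ}
    (hu : DifferentiableAt ℝ u (F.eval w)) :
    dZ (fun y => u (F.eval y)) w = F.derivative.eval w * dZ u (F.eval w) ∧
    dZbar (fun y => u (F.eval y)) w = conj (F.derivative.eval w) * dZbar u (F.eval w) := by
  have hF := ((F.hasDerivAt w).hasFDerivAt.restrictScalars ℝ)
  have h := (hu.hasFDerivAt.comp w hF).fderiv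
  have e : ∀ v : ℂ, fderiv ℝ (fun y => u (F.eval y)) w v = v * F.derivative.eval w *
      dZ u (F.eval w) + conj (v * F.derivative.eval w) * dZbar u (F.eval w) := by
    intro v
    rw [← fderiv_apply_eq_dZ_dZbar]
    change fderiv ℝ (u ∘ fun y => F.eval y) w v = _
    rw [h]
    simp
  have e1 : dZ (fun y => u (F.eval y)) w = (fderiv ℝ (fun y => u (F.eval y)) w 1 -
    Complex.I * fderiv ℝ (fun y => u (F.eval y)) w Complex.I) / 2 := rfl
  have e2 : dZbar (fun y => u (F.eval y)) w = (fderiv ℝ (fun y => u (F.eval y)) w 1 +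
    Complex.I * fderiv ℝ (fun y => u (F.eval y)) w Complex.I) / 2 := rfl
  rw [e1, e2, e, e]
  simp only [map_mul, Complex.conj_I, map_one]
  generalize dZ u (F.eval w) = A
  generalize dZbar u (F.eval w) = B
  constructor
  · linear_combination ((conj (F.derivative.eval w) * B - F.derivative.eval w * A) / 2) *
      Complex.I_mul_I
  · linear_combination ((F.derivative.eval w * A - conj (F.derivative.eval w) * B) / 2) *
      Complex.I_mul_I

theorem ContDiffAt.comp_polynomial {u : ℂ → ℂ} {F : Polynomial ℂ} {w : ℂ}
    (hu : ContDiffAt ℝ ∞ u (F.eval w)) : ContDiffAt ℝ ∞ (fun y => u (F.eval y)) w :=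
  ContDiffAt.comp w hu (contDiffAt_polynomial F w)

theorem dZ_comp_polynomial_eventually {u : ℂ → ℂ} {F : Polynomial ℂ} {w : ℂ}
    (hu : ContDiffAt ℝ ∞ u (F.eval w)) : dZ (fun y => u (F.eval y)) =ᶠ[𝓝 w]
      fun y => F.derivative.eval y * dZ u (F.eval y) := by
  filter_upwards [F.continuous.continuousAt.eventually hu.eventually_differentiableAt] with y hy
  exact (wirtinger_comp_polynomial F hy).1

theorem dZbar_comp_polynomial_eventually {u : ℂ → ℂ} {F : Polynomial ℂ} {w : ℂ}
    (hu : ContDiffAt ℝ ∞ u (F.eval w)) : dZbar (fun y => u (F.eval y)) =ᶠ[𝓝 w]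
      fun y => conj (F.derivative.eval y) * dZbar u (F.eval y) := by
  filter_upwards [F.continuous.continuousAt.eventually hu.eventually_differentiableAt] with y hy
  exact (wirtinger_comp_polynomial F hy).2

/-- A holomorphic change of variable does not mix `∂` and `∂̄`: the chain rule only multiplies by
`F'` or its conjugate, so the box of vanishing orders is preserved. -/
theorem JetVanish.comp_polynomial {a b : ℕ} {u : ℂ → ℂ} {F : Polynomial ℂ} {w : ℂ}
    (hu : ContDiffAt ℝ ∞ u (F.eval w)) (h : JetVanish a b u (F.eval w)) :
    JetVanish a b (fun y => u (F.eval y)) w := by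
  induction b generalizing u with
  | zero =>
    induction a generalizing u with
    | zero =>
      intro i hi j hj
      obtain rfl : i = 0 := by omega
      obtain rfl : j = 0 := by omega
      exact h 0 le_rfl 0 le_rfl
    | succ a ih =>
      intro i hi j hj
      obtain rfl : j = 0 := by omega
      obtain _ | i := i
      · exact ih hu (h.mono (by omega) le_rfl) 0 (by omega) 0 le_rfl
      · rw [(mixedDeriv_dZ hu.comp_polynomial i 0).self_of_nhds,
          (mixedDeriv_congr (dZ_comp_polynomial_eventually hu) i 0).self_of_nhds]
        exact JetVanish.mixedDeriv_mul (contDiffAt_polynomial _ _) hu.dZ.comp_polynomial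
          ((ih hu.dZ (h.dZ hu)).mono (by omega) le_rfl)
  | succ b ih =>
    intro i hi j hj
    obtain _ | j := j
    · exact ih hu (h.mono le_rfl (by omega)) i hi 0 (by omega)
    · rw [mixedDeriv_dZbar,
        (mixedDeriv_congr (dZbar_comp_polynomial_eventually hu) i j).self_of_nhds]
      exact JetVanish.mixedDeriv_mul (contDiffAt_conj (contDiffAt_polynomial _ _))
        hu.dZbar.comp_polynomial ((ih hu.dZbar h.dZbar).mono (by omega) (by omega))

/-! ### Dressing operators of the Adler–Moser chain -/

section Dressing

open Polynomial

/-- The bilinear (Hirota) operator `p N'' - 2 p' N' + N p''`. -/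
noncomputable def hirota (p N : ℂ[X]) : ℂ[X] :=
  p * derivative (derivative N) - 2 * (derivative p * derivative N) + N * derivative (derivative p)

/-- The sequence `0, b₀, b₁, …`. -/
noncomputable def shift (b : ℕ → ℂ[X]) : ℕ → ℂ[X]
  | 0 => 0
  | j + 1 => b j

/-- `∑ⱼ bⱼ(x) f⁽ʲ⁾(z) / p(x)` solves `Δψ = -2 (log p)'' ψ` for all holomorphic `f`. -/
def IsDressing (p : ℂ[X]) (b : ℕ → ℂ[X]) : Prop :=
  ∀ j, hirota p (b j) + 2 * (p * derivative (shift b j) - derivative p * shift b j) = 0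

/-- The Darboux transform (times `p`) of the dressing `b` of `p` by means of `q / p`. -/
noncomputable def darboux (q : ℂ[X]) (b : ℕ → ℂ[X]) (j : ℕ) : ℂ[X] :=
  q * (derivative (b j) + shift b j) - derivative q * b j

theorem hirota_comm (p q : ℂ[X]) : hirota p q = hirota q p := by
  simp only [hirota]
  ring

/-- With `N = ∑ b_j f⁽ʲ⁾` and `W = q N_x - q' N`, this is the first-order system back from `W` to
`N`: applying the adjoint Darboux factor gives `N` with `f` replaced by `f''`, which is the double
shift. The second-order terms cancel between the equations of `b_j` and of `q`. -/
theorem IsDressing.darboux_eq {p q : ℂ[X]} {b : ℕ → ℂ[X]} (hb : IsDressing p b)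
    (hq : hirota p q = 0) (j : ℕ) :
    p * derivative (darboux q b j) - 2 * derivative p * darboux q b j
      + p * shift (darboux q b) j = p * q * shift (shift b) j := by
  have h := hb j
  simp only [hirota] at h hq
  obtain _ | j := j
  · simp only [darboux, shift, derivative_sub, derivative_mul, derivative_add, derivative_zero]
      at h ⊢
    linear_combination q * h - b 0 * hq
  · simp only [darboux, shift, derivative_sub, derivative_mul, derivative_add] at h ⊢
    linear_combination q * h - b (j + 1) * hq

/-- The new function `y/q` is the Darboux transform of `N/p` by `(log (q/p))'`. Once `W` is
divisible by `p`, the back transformation and its derivative combine to the bilinear equation for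
`q`. -/
theorem IsDressing.of_mul {p q : ℂ[X]} {b y : ℕ → ℂ[X]} (hp : p ≠ 0) (hb : IsDressing p b)
    (hq : hirota p q = 0) (hy : ∀ j, p * y j = darboux q b j) : IsDressing q y := by
  have hsy : ∀ j, p * shift y j = shift (darboux q b) j := by
    rintro (_ | j)
    · simp [shift]
    · exact hy j
  have hW : ∀ j, derivative p * y j + p * derivative (y j) = derivative (darboux q b j) := by
    intro j
    rw [← hy, derivative_mul]
  have e2 : ∀ j, p * (derivative (y j) + shift y j) =
      derivative p * y j + q * shift (shift b) j := by
    intro j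
    apply mul_left_cancel₀ hp
    have h := hb.darboux_eq hq j
    rw [← hW, ← hy, ← hsy] at h
    linear_combination h
  have e2s : ∀ j, p * (derivative (shift y j) + shift (shift y) j) =
      derivative p * shift y j + q * shift (shift (shift b)) j := by
    rintro (_ | j)
    · simp [shift]
    · exact e2 j
  have hys : ∀ j, p * shift (shift y) j = q * (derivative (shift (shift b) j) +
      shift (shift (shift b)) j) - derivative q * shift (shift b) j := by
    rintro (_ | _ | j)
    · simp [shift]
    · simp [shift]
    · exact hy j
  intro j
  apply mul_left_cancel₀ hp
  have h1 := e2 j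
  have h2 := congrArg derivative h1
  have h3 := e2s j
  have h4 := hys j
  simp only [derivative_mul, derivative_add] at h2
  simp only [hirota] at hq ⊢
  linear_combination q * h2 + q * h3 - 2 * derivative q * h1 - q * h4 + y j * hq

/-! ### Local exponents at the roots and divisibility of the Darboux transform. -/

variable {a : ℂ}

theorem X_sub_C_mul_derivative_pow (a : ℂ) (m : ℕ) :
    (X - C a) * derivative ((X - C a) ^ m) = (m : ℂ[X]) * (X - C a) ^ m := by
  obtain _ | m := m
  · simp
  · rw [derivative_X_sub_C_pow]
    simp
    ring

/-- The indicial polynomial of the bilinear operator: `k(k-1) - 2mk + m(m-1) = (k-m)² - (k+m)`. The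
factor `(X - a)²` avoids negative exponents. -/
theorem sq_mul_hirota_pow_mul (a : ℂ) (m k : ℕ) (P R : ℂ[X]) :
    ∃ K : ℂ[X], (X - C a) ^ 2 * hirota ((X - C a) ^ m * P) ((X - C a) ^ k * R) =
      (X - C a) ^ (m + k) * ((((k : ℂ[X]) - (m : ℂ[X])) ^ 2 - ((k : ℂ[X]) + (m : ℂ[X]))) * (P * R) + (X - C a) * K) := by
  have hm := X_sub_C_mul_derivative_pow a m
  have hk := X_sub_C_mul_derivative_pow a k
  have hm2 := congrArg derivative hm
  have hk2 := congrArg derivative hk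
  rw [pow_add]
  generalize (X - C a) ^ m = A at *
  generalize (X - C a) ^ k = B at *
  have ht : derivative (X - C a) = 1 := derivative_X_sub_C a
  simp only [derivative_mul, ht, derivative_natCast] at hm2 hk2
  generalize X - C a = t at *
  refine ⟨2 * k * P * derivative R + t * P * derivative (derivative R)
    - 2 * (m * P * derivative R + k * derivative P * R + t * derivative P * derivative R)
    + 2 * m * R * derivative P + t * R * derivative (derivative P), ?_⟩
  have hA : t * t * derivative (derivative A) = m * (m - 1) * A := by
    linear_combination t * hm2 + (m - 1) * hm
  have hB : t * t * derivative (derivative B) = k * (k - 1) * B := by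
    linear_combination t * hk2 + (k - 1) * hk
  simp only [hirota, derivative_mul, derivative_add]
  linear_combination A * P * R * hB + A * P * 2 * t * derivative R * hk
    - 2 * (t * derivative A * P + t * A * derivative P) * R * hk
    - 2 * (P * (k * B * R + t * B * derivative R)) * hm
    + B * R * P * hA + B * R * 2 * t * derivative P * hm

/-- The indicial polynomial `k - 2m` of `W ↦ p W' - 2 p' W`. -/
theorem mul_sub_pow_mul (a : ℂ) (m k : ℕ) (P R : ℂ[X]) :
    ∃ K : ℂ[X], (X - C a) * (((X - C a) ^ m * P) * derivative ((X - C a) ^ k * R) -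
        2 * derivative ((X - C a) ^ m * P) * ((X - C a) ^ k * R)) =
      (X - C a) ^ (m + k) * (((k : ℂ[X]) - 2 * (m : ℂ[X])) * (P * R) + (X - C a) * K) := by
  have hm := X_sub_C_mul_derivative_pow a m
  have hk := X_sub_C_mul_derivative_pow a k
  rw [pow_add]
  generalize (X - C a) ^ m = A at *
  generalize (X - C a) ^ k = B at *
  generalize X - C a = t at *
  refine ⟨P * derivative R - 2 * derivative P * R, ?_⟩
  simp only [derivative_mul]
  linear_combination A * P * R * hk - 2 * P * B * R * hm

theorem eval_eq_zero_of_pow_succ_dvd {n : ℕ} {c K : ℂ[X]}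
    (h : (X - C a) ^ (n + 1) ∣ (X - C a) ^ n * (c + (X - C a) * K)) : c.eval a = 0 := by
  rw [pow_succ] at h
  have h1 := (mul_dvd_mul_iff_left (pow_ne_zero n (X_sub_C_ne_zero a))).1 h
  have h2 := dvd_iff_isRoot.1 h1
  simpa [IsRoot] using h2

/-- The possible orders of vanishing in the bilinear equation. -/
theorem sq_sub_eq_of_dvd_hirota {p N : ℂ[X]} (hp : p ≠ 0) (hN : N ≠ 0)
    (h : (X - C a) ^ (p.rootMultiplicity a + N.rootMultiplicity a + 1) ∣
      (X - C a) ^ 2 * hirota p N) :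
    ((N.rootMultiplicity a : ℤ) - p.rootMultiplicity a) ^ 2 =
      N.rootMultiplicity a + p.rootMultiplicity a := by
  obtain ⟨P, hP, hPa⟩ := p.exists_eq_pow_rootMultiplicity_mul_and_not_dvd hp a
  obtain ⟨R, hR, hRa⟩ := N.exists_eq_pow_rootMultiplicity_mul_and_not_dvd hN a
  generalize p.rootMultiplicity a = m at *
  generalize N.rootMultiplicity a = k at *
  rw [dvd_iff_isRoot, IsRoot] at hPa hRa
  obtain ⟨K, hK⟩ := sq_mul_hirota_pow_mul a m k P R
  rw [hP, hR, hK] at h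
  have := eval_eq_zero_of_pow_succ_dvd h
  simp only [eval_mul, eval_sub, eval_pow, eval_add, eval_natCast, mul_eq_zero, hPa, hRa,
    or_false] at this
  have h2 : (((k : ℤ) - m) ^ 2 - (k + m) : ℤ) = 0 := by exact_mod_cast this
  linarith

/-- All root multiplicities of `p` are triangular numbers. -/
def HasTriangularRoots (p : ℂ[X]) : Prop :=
  ∀ a, ∃ l : ℕ, 2 * p.rootMultiplicity a = l * (l + 1)

/-- For `m = l(l+1)/2` the indicial equation factors as `(k - m + l)(k - m - l - 1) = 0`, so the
multiplicity moves to a neighbouring triangular number. -/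
theorem HasTriangularRoots.eq_or_eq {p q : ℂ[X]} (hp : p ≠ 0) (hq : q ≠ 0)
    (h : hirota p q = 0) {l : ℕ} (hl : 2 * p.rootMultiplicity a = l * (l + 1)) :
    2 * q.rootMultiplicity a = (l + 1) * (l + 2) ∨
      2 * q.rootMultiplicity a + l = l * l := by
  have := sq_sub_eq_of_dvd_hirota (a := a) hp hq (by rw [h]; simp)
  generalize p.rootMultiplicity a = m at *
  generalize q.rootMultiplicity a = k at *
  zify at hl ⊢
  have h2 : ((k : ℤ) - m + l) * (k - m - l - 1) = 0 := by linear_combination this + hl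
  rcases mul_eq_zero.1 h2 with h3 | h3
  · right; linear_combination 2 * h3 + hl
  · left; linear_combination 2 * h3 + hl

theorem HasTriangularRoots.of_hirota {p q : ℂ[X]} (hp : p ≠ 0) (hq : q ≠ 0)
    (h : hirota p q = 0) (ht : HasTriangularRoots p) : HasTriangularRoots q := by
  intro a
  obtain ⟨l, hl⟩ := ht a
  rcases HasTriangularRoots.eq_or_eq hp hq h hl with h1 | h1
  · exact ⟨l + 1, by rw [h1]⟩
  · obtain _ | l := l
    · exact ⟨0, by simpa using h1⟩
    · exact ⟨l, by nlinarith⟩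

/-- If `r = m - l` is the smaller exponent at `a` and `b_{j-1}` vanishes to order `r`, then an order
of `b_j` below `r` would have to be an exponent, but the exponents are `m - l` and `m + l + 1`. -/
theorem IsDressing.pow_dvd {p : ℂ[X]} {b : ℕ → ℂ[X]} (hp : p ≠ 0) (hb : IsDressing p b) {l r : ℕ}
    (hl : 2 * p.rootMultiplicity a = l * (l + 1)) (hr : r + l = p.rootMultiplicity a) (j : ℕ) :
    (X - C a) ^ r ∣ b j := by
  suffices H : ∀ j, (X - C a) ^ r ∣ shift b j from H (j + 1)
  intro j
  induction j with
  | zero => simp [shift]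
  | succ j ih =>
    change _ ∣ b j
    by_contra hnd
    have hb0 : b j ≠ 0 := fun h0 => hnd (h0 ▸ dvd_zero _)
    have hlt : (b j).rootMultiplicity a < r := by
      by_contra! hle
      exact hnd ((pow_dvd_pow _ hle).trans (pow_rootMultiplicity_dvd _ _))
    have hdvd : (X - C a) ^ (p.rootMultiplicity a + r + 1) ∣ (X - C a) ^ 2 * hirota p (b j) := by
      obtain ⟨c, hc⟩ := ih
      obtain ⟨P, hP⟩ := p.pow_rootMultiplicity_dvd a
      have h1 := hb j
      generalize hm : p.rootMultiplicity a = m at *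
      have h2 : (X - C a) ^ 2 * hirota p (b j) =
          (X - C a) ^ 2 * (2 * (derivative p * shift b j - p * derivative (shift b j))) := by
        linear_combination (X - C a) ^ 2 * h1
      have em := X_sub_C_mul_derivative_pow a m
      have er := X_sub_C_mul_derivative_pow a r
      rw [h2, hc, hP, pow_succ, pow_add]
      generalize (X - C a) ^ m = A at *
      generalize (X - C a) ^ r = B at *
      have ht : derivative (X - C a) = 1 := derivative_X_sub_C a
      generalize X - C a = t at *
      refine ⟨2 * (m * P * c + t * derivative P * c - P * (r * c + t * derivative c)), ?_⟩
      simp only [derivative_mul]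
      linear_combination 2 * t * P * B * c * em - 2 * t * P * A * c * er
    have h3 := sq_sub_eq_of_dvd_hirota hp hb0 ((pow_dvd_pow _ (by omega)).trans hdvd)
    generalize p.rootMultiplicity a = m at *
    generalize (b j).rootMultiplicity a = k at *
    zify at hl hr hlt
    have h4 : ((k : ℤ) - m + l) * (k - m - l - 1) = 0 := by linear_combination h3 + hl
    rcases mul_eq_zero.1 h4 with h5 | h5 <;> omega

/-- Induct on `j`. If `W_j` vanished at `a` to order `k < m`, the other terms of `darboux_eq` would
be of higher order than the leading part of `p W_j' - 2 p' W_j`, forcing `k = 2m`, which is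
impossible. -/
theorem IsDressing.rootMultiplicity_darboux {p q : ℂ[X]} {b : ℕ → ℂ[X]} (hp : p ≠ 0) (hq : q ≠ 0)
    (ht : HasTriangularRoots p) (hb : IsDressing p b) (h : hirota p q = 0) (a : ℂ) (j : ℕ) :
    (X - C a) ^ p.rootMultiplicity a ∣ darboux q b j := by
  suffices H : ∀ j, (X - C a) ^ p.rootMultiplicity a ∣ shift (darboux q b) j from H (j + 1)
  intro j
  obtain ⟨l, hl⟩ := ht a
  have hlm : l ≤ p.rootMultiplicity a := by
    rcases Nat.eq_zero_or_pos l with h0 | h0 <;> nlinarith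
  obtain ⟨r, hr⟩ : ∃ r, r + l = p.rootMultiplicity a := ⟨_, Nat.sub_add_cancel hlm⟩
  have hbr : ∀ j, (X - C a) ^ r ∣ shift b j := by
    rintro (_ | j)
    · simp [shift]
    · exact hb.pow_dvd hp hl hr j
  have hbr : ∀ j, (X - C a) ^ r ∣ shift (shift b) j := by
    rintro (_ | j)
    · simp [shift]
    · exact hbr j
  have hqm := HasTriangularRoots.eq_or_eq hp hq h hl
  induction j with
  | zero => simp [shift]
  | succ j ih =>
    change _ ∣ darboux q b j
    by_contra hnd
    have hW0 : darboux q b j ≠ 0 := fun h0 => hnd (h0 ▸ dvd_zero _)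
    have hlt : (darboux q b j).rootMultiplicity a < p.rootMultiplicity a := by
      by_contra! hle
      exact hnd ((pow_dvd_pow _ hle).trans (pow_rootMultiplicity_dvd _ _))
    have he := hb.darboux_eq h j
    -- The source term `p q b_{j-2}` is of high enough order. If the multiplicity of `q` drops to
    -- `l(l-1)/2`, the needed inequality `m - 1 ≤ l(l-1)` is `(l-1)(l-2) ≥ 0`; if it rises, it
    -- already exceeds `m`.
    have hle : (darboux q b j).rootMultiplicity a ≤ q.rootMultiplicity a + r := by
      generalize p.rootMultiplicity a = m at *
      generalize q.rootMultiplicity a = k at *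
      rcases hqm with h1 | h1
      · nlinarith
      · by_contra! h2
        have : k + 2 ≤ l := by omega
        nlinarith
    have hdvd : (X - C a) ^ (p.rootMultiplicity a + (darboux q b j).rootMultiplicity a + 1) ∣
        (X - C a) * (p * derivative (darboux q b j) - 2 * derivative p * darboux q b j) := by
      have e : p * derivative (darboux q b j) - 2 * derivative p * darboux q b j =
          p * (q * shift (shift b) j - shift (darboux q b) j) := by linear_combination he
      rw [e, pow_succ', pow_add]
      refine mul_dvd_mul_left _ (mul_dvd_mul (pow_rootMultiplicity_dvd _ _) (dvd_sub ?_ ?_))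
      · refine (pow_dvd_pow _ hle).trans ?_
        rw [pow_add]
        exact mul_dvd_mul (pow_rootMultiplicity_dvd _ _) (hbr j)
      · exact (pow_dvd_pow _ hlt.le).trans ih
    obtain ⟨P, hP, hPa⟩ := p.exists_eq_pow_rootMultiplicity_mul_and_not_dvd hp a
    obtain ⟨R, hR, hRa⟩ := (darboux q b j).exists_eq_pow_rootMultiplicity_mul_and_not_dvd hW0 a
    generalize (darboux q b j).rootMultiplicity a = k at *
    generalize darboux q b j = W at *
    generalize p.rootMultiplicity a = m at *
    rw [dvd_iff_isRoot, IsRoot] at hPa hRa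
    obtain ⟨K, hK⟩ := mul_sub_pow_mul a m k P R
    rw [hP, hR, hK] at hdvd
    have h3 := eval_eq_zero_of_pow_succ_dvd hdvd
    simp only [eval_mul, eval_sub, eval_ofNat, eval_natCast, mul_eq_zero, hPa, hRa,
      or_false] at h3
    have h4 : ((k : ℤ) - 2 * m : ℤ) = 0 := by exact_mod_cast h3
    omega

theorem dvd_of_forall_pow_rootMultiplicity_dvd {p W : ℂ[X]} (hp : p ≠ 0)
    (h : ∀ a, (X - C a) ^ p.rootMultiplicity a ∣ W) : p ∣ W := by
  by_cases hW : W = 0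
  · simp [hW]
  rw [(IsAlgClosed.splits p).dvd_iff_roots_le_roots hp hW, Multiset.le_iff_count]
  intro a
  rw [count_roots, count_roots]
  exact (le_rootMultiplicity_iff hW).2 (h a)

end Dressing

/-! ### Induction along the chain. -/

section Dressing

open Polynomial

theorem triangle_succ (n : ℕ) : (n + 1) * (n + 1 + 1) / 2 = n * (n + 1) / 2 + (n + 1) := by
  have : (n + 1) * (n + 1 + 1) = n * (n + 1) + 2 * (n + 1) := by ring
  omega

/-- A complex Adler–Moser chain. -/
structure IsComplexChain (P : ℕ → ℂ[X]) : Prop where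
  zero : P 0 = 1
  natDegree : ∀ n, (P n).natDegree = n * (n + 1) / 2
  hirota : ∀ n, hirota (P n) (P (n + 1)) = 0

theorem IsComplexChain.ne_zero {P : ℕ → ℂ[X]} (h : IsComplexChain P) (n : ℕ) : P n ≠ 0 := by
  obtain _ | n := n
  · rw [h.zero]
    exact one_ne_zero
  · intro h0
    have := h.natDegree (n + 1)
    rw [h0, triangle_succ, natDegree_zero] at this
    omega

theorem IsComplexChain.hasTriangularRoots {P : ℕ → ℂ[X]} (h : IsComplexChain P) (n : ℕ) :
    HasTriangularRoots (P n) := by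
  induction n with
  | zero =>
    intro a
    exact ⟨0, by rw [h.zero, ← C_1, rootMultiplicity_C]⟩
  | succ n ih => exact ih.of_hirota (h.ne_zero n) (h.ne_zero _) (h.hirota n)

/-- The `n`-th dressing operator of a chain: it has polynomial coefficients of controlled degree. -/
theorem IsComplexChain.exists_dressing {P : ℕ → ℂ[X]} (h : IsComplexChain P) (n : ℕ) :
    ∃ b : ℕ → ℂ[X], IsDressing (P n) b ∧ b n = P n ∧ (∀ j, n < j → b j = 0) ∧
      ∀ j, (b j).natDegree + n ≤ n * (n + 1) / 2 + j := by
  induction n with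
  | zero =>
    refine ⟨fun j => if j = 0 then 1 else 0, ?_, by simp [h.zero], ?_, ?_⟩
    · rintro (_ | _ | j) <;> simp [_root_.hirota, shift, h.zero]
    · intro j hj
      simp [hj.ne']
    · intro j
      by_cases hj : j = 0 <;> simp [hj]
  | succ n ih =>
    obtain ⟨b, hb, hbn, hb0, hbd⟩ := ih
    have hp := h.ne_zero n
    have hdvd : ∀ j, ∃ y, darboux (P (n + 1)) b j = P n * y := fun j =>
      dvd_of_forall_pow_rootMultiplicity_dvd hp fun a =>
        hb.rootMultiplicity_darboux hp (h.ne_zero _) (h.hasTriangularRoots n) (h.hirota n) a j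
    choose y hy using hdvd
    refine ⟨y, hb.of_mul hp (h.hirota n) fun j => (hy j).symm, ?_, ?_, ?_⟩
    · apply mul_left_cancel₀ hp
      rw [← hy, darboux, hb0 (n + 1) (by omega), shift, hbn]
      simp
      ring
    · intro j hj
      obtain _ | j := j
      · omega
      apply mul_left_cancel₀ hp
      rw [← hy, darboux, hb0 (j + 1) (by omega), shift, hb0 j (by omega)]
      simp
    · intro j
      have hN := triangle_succ n
      by_cases hy0 : y j = 0
      · rw [hy0, natDegree_zero]
        omega
      have hd := h.natDegree n
      have hd' := h.natDegree (n + 1)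
      -- Each term of `W` loses a degree through a derivative or, in the shifted term, through the
      -- bound for `b_{j-1}`. Dividing by `P n` then yields the degree bound for the next level.
      have h1 : (darboux (P (n + 1)) b j).natDegree ≤
          (n + 1) * (n + 1 + 1) / 2 + (n * (n + 1) / 2 + j) - (n + 1) := by
        have hbj := hbd j
        refine (natDegree_sub_le _ _).trans (max_le ?_ ?_)
        · rw [mul_add]
          refine (natDegree_add_le _ _).trans (max_le ?_ ?_)
          · by_cases hz : (b j).natDegree = 0
            · rw [derivative_of_natDegree_zero hz]
              simp
            · have := natDegree_derivative_lt hz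
              refine natDegree_mul_le.trans ?_
              omega
          · obtain _ | j := j
            · simp [shift]
            · have := hbd j
              refine natDegree_mul_le.trans ?_
              simp only [shift]
              omega
        · have := natDegree_derivative_le (P (n + 1))
          refine natDegree_mul_le.trans ?_
          omega
      rw [hy, natDegree_mul hp hy0] at h1
      omega

end Dressing

/-! ### Explicit solutions -/

section Explicit

open Polynomial

/-- `∑_{j ≤ n} cⱼ(x) f⁽ʲ⁾(z)`. -/
noncomputable def jetSum (n : ℕ) (c : ℕ → ℂ[X]) (f : ℂ[X]) (z : ℂ) : ℂ :=
  ∑ j ∈ Finset.range (n + 1), (c j).eval (z.re : ℂ) * (derivative^[j] f).eval z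

theorem contDiffAt_jetSum (n : ℕ) (c : ℕ → ℂ[X]) (f : ℂ[X]) (z : ℂ) :
    ContDiffAt ℝ ∞ (jetSum n c f) z :=
  ContDiffAt.sum fun _ _ => (contDiffAt_polynomial_re _ z).mul (contDiffAt_polynomial _ z)

theorem wirtinger_fun_sum {ι : Type*} (s : Finset ι) {u : ι → ℂ → ℂ} {z : ℂ}
    (hu : ∀ i ∈ s, DifferentiableAt ℝ (u i) z) (c : ℂ) :
    wirtinger c (fun w => ∑ i ∈ s, u i w) z = ∑ i ∈ s, wirtinger c (u i) z := by
  simp only [wirtinger, dX, dY, fderiv_fun_sum hu, _root_.sum_apply,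
    ← Finset.sum_div, Finset.sum_add_distrib, Finset.mul_sum]

theorem dZ_jetSum (n : ℕ) (c : ℕ → ℂ[X]) (f : ℂ[X]) :
    dZ (jetSum n c f) = fun z => jetSum n (fun j => derivative (c j)) f z / 2 +
      jetSum n c (derivative f) z := by
  funext z
  have hd : ∀ j, DifferentiableAt ℝ (fun z : ℂ => (c j).eval (z.re : ℂ)) z := fun j =>
    (contDiffAt_polynomial_re _ z).differentiableAt (by simp)
  have hf : ∀ j, DifferentiableAt ℝ (fun z : ℂ => (derivative^[j] f).eval z) z := fun j =>
    (contDiffAt_polynomial _ z).differentiableAt (by simp)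
  have h1 := wirtinger_fun_sum (Finset.range (n + 1)) (z := z)
    (u := fun j z => (c j).eval (z.re : ℂ) * (derivative^[j] f).eval z)
    (fun j _ => (hd j).mul (hf j)) (-Complex.I)
  rw [← dZ_eq_wirtinger] at h1
  unfold jetSum
  rw [h1, Finset.sum_div, ← Finset.sum_add_distrib]
  refine Finset.sum_congr rfl fun j _ => ?_
  have h2 := wirtinger_mul (hd j) (hf j) (-Complex.I)
  rw [← dZ_eq_wirtinger, dZ_polynomial_re, dZ_polynomial] at h2
  rw [h2, ← Function.iterate_succ_apply derivative, ← Function.iterate_succ_apply' derivative]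
  ring

theorem dZbar_jetSum (n : ℕ) (c : ℕ → ℂ[X]) (f : ℂ[X]) :
    dZbar (jetSum n c f) = fun z => jetSum n (fun j => derivative (c j)) f z / 2 := by
  funext z
  have hd : ∀ j, DifferentiableAt ℝ (fun z : ℂ => (c j).eval (z.re : ℂ)) z := fun j =>
    (contDiffAt_polynomial_re _ z).differentiableAt (by simp)
  have hf : ∀ j, DifferentiableAt ℝ (fun z : ℂ => (derivative^[j] f).eval z) z := fun j =>
    (contDiffAt_polynomial _ z).differentiableAt (by simp)
  have h1 := wirtinger_fun_sum (Finset.range (n + 1)) (z := z)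
    (u := fun j z => (c j).eval (z.re : ℂ) * (derivative^[j] f).eval z)
    (fun j _ => (hd j).mul (hf j)) Complex.I
  rw [← dZbar_eq_wirtinger] at h1
  unfold jetSum
  rw [h1, Finset.sum_div]
  refine Finset.sum_congr rfl fun j _ => ?_
  have h2 := wirtinger_mul (hd j) (hf j) Complex.I
  rw [← dZbar_eq_wirtinger, dZbar_polynomial_re, dZbar_polynomial] at h2
  rw [h2]
  ring

/-- Collects the dressing equations into the bilinear equation `p N_xx-type terms - 2 p' N_x + p'' N
= 0` for `N = ∑ b_j f⁽ʲ⁾`; since `f` is harmonic, the Laplacian of `N` is `∑ (b_j'' f⁽ʲ⁾ + 2 b_j'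
f⁽ʲ⁺¹⁾)`. -/
theorem IsDressing.jetSum_eq_zero {p : ℂ[X]} {b : ℕ → ℂ[X]} (hb : IsDressing p b) {n : ℕ}
    (hn : b (n + 1) = 0) (f : ℂ[X]) (z : ℂ) :
    p.eval (z.re : ℂ) * (jetSum n (fun j => derivative (derivative (b j))) f z +
        2 * jetSum n (fun j => derivative (b j)) (derivative f) z)
      - 2 * p.derivative.eval (z.re : ℂ) * (jetSum n (fun j => derivative (b j)) f z +
        jetSum n b (derivative f) z)
      + p.derivative.derivative.eval (z.re : ℂ) * jetSum n b f z = 0 := by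
  -- The index runs one past `n` because the shifted coefficient at `n + 1` is still `b n`.
  have h1 : ∑ j ∈ Finset.range (n + 2), (hirota p (b j) +
      2 * (p * derivative (shift b j) - derivative p * shift b j)).eval (z.re : ℂ) *
        (derivative^[j] f).eval z = 0 := by
    simp [show ∀ j, _ = _ from hb]
  simp only [eval_add, add_mul, Finset.sum_add_distrib] at h1
  rw [Finset.sum_range_succ, Finset.sum_range_succ' (fun j => (2 * (p * derivative (shift b j) -
    derivative p * shift b j)).eval (z.re : ℂ) * (derivative^[j] f).eval z), hn] at h1
  simp only [hirota, shift, derivative_zero, mul_zero, zero_mul, sub_zero, eval_zero, add_zero,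
    Function.iterate_succ_apply] at h1
  rw [← h1]
  simp only [jetSum, Finset.mul_sum, ← Finset.sum_add_distrib, ← Finset.sum_sub_distrib]
  refine Finset.sum_congr rfl fun j _ => ?_
  simp only [eval_add, eval_sub, eval_mul, eval_ofNat]
  ring

/-- The coefficient `ξ' / (2 ξ)`, `ξ = p / q`, as a function of `x = Re z`. -/
noncomputable def logDerivHalf (p q : ℂ[X]) (z : ℂ) : ℂ :=
  (p.derivative.eval (z.re : ℂ) / p.eval (z.re : ℂ) -
    q.derivative.eval (z.re : ℂ) / q.eval (z.re : ℂ)) / 2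

theorem contDiffAt_logDerivHalf {p q : ℂ[X]} {z : ℂ} (hp : p.eval (z.re : ℂ) ≠ 0)
    (hq : q.eval (z.re : ℂ) ≠ 0) : ContDiffAt ℝ ∞ (logDerivHalf p q) z :=
  (((contDiffAt_polynomial_re _ z).mul ((contDiffAt_polynomial_re p z).inv hp)).sub
    ((contDiffAt_polynomial_re _ z).mul ((contDiffAt_polynomial_re q z).inv hq))).div_const 2

/-- `∑_{j ≤ n} bⱼ(x) f⁽ʲ⁾(z) / q(x)`. -/
noncomputable def testSolution (q : ℂ[X]) (n : ℕ) (b : ℕ → ℂ[X]) (f : ℂ[X]) (z : ℂ) : ℂ :=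
  (q.eval (z.re : ℂ))⁻¹ * jetSum n b f z

theorem continuous_polynomial_re (q : ℂ[X]) : Continuous fun z : ℂ => q.eval (z.re : ℂ) :=
  q.continuous.comp (Complex.continuous_ofReal.comp Complex.continuous_re)

theorem contDiffAt_testSolution {q : ℂ[X]} (n : ℕ) (b : ℕ → ℂ[X]) (f : ℂ[X]) {z : ℂ}
    (hq : q.eval (z.re : ℂ) ≠ 0) : ContDiffAt ℝ ∞ (testSolution q n b f) z :=
  ((contDiffAt_polynomial_re _ z).inv hq).mul (contDiffAt_jetSum _ _ _ _)

/-- Substituting `N = qφ` in the bilinear equation of `N` produces `φ` times the bilinear expression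
of `p` and `q`, which is zero, and leaves `pq Δφ = 2 (p'q - pq') φ_x`. -/
theorem IsDressing.isGermSolution {p q : ℂ[X]} {b : ℕ → ℂ[X]} (hb : IsDressing p b)
    (hpq : hirota p q = 0) {n : ℕ} (hn : b (n + 1) = 0) (f : ℂ[X]) {z₀ : ℂ}
    (hp : p.eval (z₀.re : ℂ) ≠ 0) (hq : q.eval (z₀.re : ℂ) ≠ 0) :
    IsGermSolution (logDerivHalf p q) (logDerivHalf p q) z₀ (testSolution q n b f) := by
  refine ⟨contDiffAt_testSolution n b f hq, ?_⟩
  have ep := (continuous_polynomial_re p).continuousAt.eventually_ne hp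
  have eq := (continuous_polynomial_re q).continuousAt.eventually_ne hq
  filter_upwards [ep, eq] with z hpz hqz
  set φ := testSolution q n b f with hφ
  have hs : ContDiffAt ℝ ∞ φ z := contDiffAt_testSolution n b f hqz
  have hqs := contDiffAt_polynomial_re q z
  have hN : jetSum n b f =ᶠ[𝓝 z] fun w => q.eval (w.re : ℂ) * φ w := by
    filter_upwards [(continuous_polynomial_re q).continuousAt.eventually_ne hqz] with w hw
    rw [hφ, testSolution, mul_inv_cancel_left₀ hw]
  have e1 := (dZ_congr hN).trans (dZ_mul_eventually hqs hs)
  have e2 := (dZbar_congr hN).trans (dZbar_mul_eventually hqs hs)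
  have e3 := (dZ_congr e2).self_of_nhds
  rw [dZ_polynomial_re] at e1
  rw [dZbar_polynomial_re] at e3 e2
  have hq' : ContDiffAt ℝ ∞ (fun w : ℂ => q.derivative.eval (w.re : ℂ) / 2) z :=
    (contDiffAt_polynomial_re _ z).div_const 2
  have e4 := wirtinger_add ((hq'.mul hs).differentiableAt (by simp))
    ((hqs.mul hs.dZbar).differentiableAt (by simp)) (-Complex.I)
  have e5 := (dZ_mul_eventually hq' hs).self_of_nhds
  have e6 := (dZ_mul_eventually hqs hs.dZbar).self_of_nhds
  rw [← dZ_eq_wirtinger] at e4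
  have e7 : dZ (fun w : ℂ => q.derivative.eval (w.re : ℂ) / 2) z =
      q.derivative.derivative.eval (z.re : ℂ) / 4 := by
    have := (((q.derivative.hasDerivAt (z.re : ℂ)).comp_ofReal).div_const 2).dZ_re
    rw [this]
    ring
  rw [e4, e5, e6] at e3
  beta_reduce at e3
  rw [e7, dZ_polynomial_re, dZbar_jetSum] at e3
  have e8 : dZ (fun z => jetSum n (fun j => derivative (b j)) f z / 2) z =
      (jetSum n (fun j => derivative (derivative (b j))) f z / 2 +
        jetSum n (fun j => derivative (b j)) (derivative f) z) / 2 := by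
    have h1 : (fun z => jetSum n (fun j => derivative (b j)) f z / 2) =
      fun z => (2 : ℂ)⁻¹ * jetSum n (fun j => derivative (b j)) f z := by funext; ring
    rw [h1, dZ_eq_wirtinger, wirtinger_const_mul
      ((contDiffAt_jetSum _ _ _ _).differentiableAt (by simp)), ← dZ_eq_wirtinger, dZ_jetSum]
    ring
  rw [e8] at e3
  have e1 := e1.self_of_nhds
  have e2 := e2.self_of_nhds
  have e0 := hN.self_of_nhds
  rw [dZ_jetSum] at e1
  rw [dZbar_jetSum] at e2
  have hstar := hb.jetSum_eq_zero hn f z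
  have hh := congrArg (eval (z.re : ℂ)) hpq
  simp only [hirota, eval_add, eval_sub, eval_mul, eval_ofNat, eval_zero] at hh
  simp only [logDerivHalf]
  beta_reduce at e0 e1 e2 e3
  generalize jetSum n (fun j => derivative (derivative (b j))) f z = N1 at *
  generalize jetSum n (fun j => derivative (b j)) f z = N2 at *
  generalize jetSum n (fun j => derivative (b j)) (derivative f) z = N3 at *
  generalize jetSum n b (derivative f) z = N4 at *
  generalize jetSum n b f z = N5 at *
  generalize dZ (dZbar φ) z = A at *
  generalize dZ φ z = B at *
  generalize dZbar φ z = D at *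
  generalize φ z = E at *
  generalize p.derivative.derivative.eval (z.re : ℂ) = p2 at *
  generalize p.derivative.eval (z.re : ℂ) = p1 at *
  generalize p.eval (z.re : ℂ) = p0 at *
  generalize q.derivative.derivative.eval (z.re : ℂ) = q2 at *
  generalize q.derivative.eval (z.re : ℂ) = q1 at *
  generalize q.eval (z.re : ℂ) = q0 at *
  have key : p0 * q0 * A = (p1 * q0 - q1 * p0) / 2 * (B + D) := by
    linear_combination (1 / 4) * hstar - p0 * e3 + (p1 / 2) * (e1 + e2) - (p2 / 4) * e0
      - (E / 4) * hh
  field_simp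
  linear_combination 2 * key

end Explicit

/-! ### Jets of the explicit solutions. -/

section Explicit

open Polynomial

theorem JetVanish.sum {ι : Type*} {s : Finset ι} {u : ι → ℂ → ℂ} {z : ℂ} {a b : ℕ}
    (hu : ∀ i ∈ s, ContDiffAt ℝ ∞ (u i) z) (h : ∀ i ∈ s, JetVanish a b (u i) z) :
    JetVanish a b (fun w => ∑ i ∈ s, u i w) z := fun i hi j hj => by
  rw [mixedDeriv_sum_apply s hu]
  exact Finset.sum_eq_zero fun l hl => h l hl i hi j hj

theorem testSolution_eq_sum (q : ℂ[X]) (n : ℕ) (b : ℕ → ℂ[X]) (f : ℂ[X]) :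
    testSolution q n b f = fun z => ∑ j ∈ Finset.range (n + 1),
      ((q.eval (z.re : ℂ))⁻¹ * (b j).eval (z.re : ℂ)) * (derivative^[j] f).eval z := by
  funext z
  simp only [testSolution, jetSum, Finset.mul_sum, mul_assoc]

theorem eval_iterate_derivative_X_sub_C_pow (z₀ : ℂ) {m i : ℕ} (h : i < m) :
    (derivative^[i] ((X - C z₀) ^ m)).eval z₀ = 0 := by
  rw [iterate_derivative_X_sub_pow]
  simp [Nat.sub_ne_zero_of_lt h]

theorem eval_iterate_derivative_X_sub_C_pow_self (z₀ : ℂ) (m : ℕ) :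
    (derivative^[m] ((X - C z₀) ^ m)).eval z₀ = m.factorial := by
  rw [iterate_derivative_X_sub_pow]
  simp [Nat.descFactorial_self]

theorem jetVanish_polynomial {f : ℂ[X]} {z₀ : ℂ} {a : ℕ}
    (h : ∀ i ≤ a, (derivative^[i] f).eval z₀ = 0) (b : ℕ) :
    JetVanish a b (fun z => f.eval z) z₀ := by
  intro i hi j _
  obtain _ | j := j
  · rw [mixedDeriv_polynomial]
    exact h i hi
  · rw [mixedDeriv_polynomial_succ]

section

variable {q : ℂ[X]} {z₀ : ℂ} (hq : q.eval (z₀.re : ℂ) ≠ 0) (n : ℕ) (b : ℕ → ℂ[X])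

include hq

theorem contDiffAt_inv_mul_polynomial_re (j : ℕ) :
    ContDiffAt ℝ ∞ (fun z : ℂ => (q.eval (z.re : ℂ))⁻¹ * (b j).eval (z.re : ℂ)) z₀ :=
  ((contDiffAt_polynomial_re q z₀).inv hq).mul (contDiffAt_polynomial_re _ z₀)

/-- All derivatives of `(z - z₀)^{n+m+1}` that occur, up to the `n`-th, still vanish to order at
least `m + 1`, and `∂̄` acts only on the smooth coefficients. -/
theorem jetVanish_testSolution (m l : ℕ) :
    JetVanish m l (testSolution q n b ((X - C z₀) ^ (n + (m + 1)))) z₀ := by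
  rw [testSolution_eq_sum]
  refine JetVanish.sum (fun j _ => (contDiffAt_inv_mul_polynomial_re hq b j).mul
    (contDiffAt_polynomial _ z₀)) fun j hj => ?_
  refine (jetVanish_polynomial (fun i hi => ?_) l).mul (contDiffAt_inv_mul_polynomial_re hq b j)
    (contDiffAt_polynomial _ z₀)
  rw [← Function.iterate_add_apply]
  have := Finset.mem_range.1 hj
  exact eval_iterate_derivative_X_sub_C_pow z₀ (by omega)

/-- Only the term `j = n` vanishes to order exactly `m`; the lower terms vanish to higher order.
This makes the jet map triangular with nonzero diagonal when `b n` does not vanish. -/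
theorem mixedDeriv_testSolution (m : ℕ) :
    mixedDeriv m 0 (testSolution q n b ((X - C z₀) ^ (n + m))) z₀ =
      (q.eval (z₀.re : ℂ))⁻¹ * (b n).eval (z₀.re : ℂ) * (n + m).factorial := by
  rw [testSolution_eq_sum, mixedDeriv_sum_apply _ fun j _ =>
    (contDiffAt_inv_mul_polynomial_re hq b j).mul (contDiffAt_polynomial _ z₀)]
  have hv : ∀ j ≤ n, mixedDeriv m 0 (fun z => ((q.eval (z.re : ℂ))⁻¹ * (b j).eval (z.re : ℂ)) *
      (derivative^[j] ((X - C z₀) ^ (n + m))).eval z) z₀ = (q.eval (z₀.re : ℂ))⁻¹ *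
        (b j).eval (z₀.re : ℂ) * (derivative^[m + j] ((X - C z₀) ^ (n + m))).eval z₀ := by
    intro j hj
    rw [mixedDeriv_mul_of_vanish (contDiffAt_inv_mul_polynomial_re hq b j)
      (contDiffAt_polynomial _ z₀), mixedDeriv_polynomial, ← Function.iterate_add_apply]
    intro i hi
    rw [mixedDeriv_polynomial, ← Function.iterate_add_apply]
    exact eval_iterate_derivative_X_sub_C_pow z₀ (by omega)
  rw [Finset.sum_range_succ, Finset.sum_eq_zero, zero_add, hv n le_rfl, add_comm m n,
    eval_iterate_derivative_X_sub_C_pow_self]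
  intro j hj
  have := Finset.mem_range.1 hj
  rw [hv j this.le, eval_iterate_derivative_X_sub_C_pow z₀ (by omega), mul_zero]

end

theorem testSolution_add (q : ℂ[X]) (n : ℕ) (b : ℕ → ℂ[X]) (f g : ℂ[X]) (c : ℂ) :
    testSolution q n b (f + C c * g) =
      fun z => testSolution q n b f z + c * testSolution q n b g z := by
  funext z
  simp only [testSolution, jetSum, iterate_map_add, iterate_derivative_C_mul, eval_add,
    eval_mul, eval_C, mul_add, Finset.sum_add_distrib, Finset.mul_sum]
  congr 1
  exact Finset.sum_congr rfl fun j _ => by ring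

/-- The solution `φ_f + conj φ_g`. -/
noncomputable def testPair (q : ℂ[X]) (n : ℕ) (b : ℕ → ℂ[X]) (f g : ℂ[X]) (z : ℂ) : ℂ :=
  testSolution q n b f z + conj (testSolution q n b g z)

section

variable {q : ℂ[X]} {z₀ : ℂ} (hq : q.eval (z₀.re : ℂ) ≠ 0) (n : ℕ) (b : ℕ → ℂ[X])

include hq

theorem mixedDeriv_testPair (f g : ℂ[X]) (i j : ℕ) :
    mixedDeriv i j (testPair q n b f g) z₀ = mixedDeriv i j (testSolution q n b f) z₀ +
      conj (mixedDeriv j i (testSolution q n b g) z₀) := by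
  rw [← mixedDeriv_conj_apply (contDiffAt_testSolution n b g hq)]
  exact mixedDeriv_add_apply (contDiffAt_testSolution n b f hq)
    (contDiffAt_conj (contDiffAt_testSolution n b g hq)) i j

theorem mixedDeriv_testSolution_add (f g : ℂ[X]) (c : ℂ) (i j : ℕ) :
    mixedDeriv i j (testSolution q n b (f + C c * g)) z₀ =
      mixedDeriv i j (testSolution q n b f) z₀ +
        c * mixedDeriv i j (testSolution q n b g) z₀ := by
  have hg := contDiffAt_testSolution n b g hq
  rw [testSolution_add, mixedDeriv_add_apply (contDiffAt_testSolution n b f hq)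
    (contDiffAt_const.mul hg), mixedDeriv_const_mul_apply hg]

/-- The pure derivatives of the explicit solutions at a point can be prescribed. -/
theorem exists_testPair (hbn : (b n).eval (z₀.re : ℂ) ≠ 0) (t t' : ℕ → ℂ) (K : ℕ) :
    ∃ f g : ℂ[X], ∀ j ≤ K, mixedDeriv j 0 (testPair q n b f g) z₀ = t j ∧
      (j ≠ 0 → mixedDeriv 0 j (testPair q n b f g) z₀ = t' j) := by
  have htop : ∀ m : ℕ, (q.eval (z₀.re : ℂ))⁻¹ * (b n).eval (z₀.re : ℂ) * (n + m).factorial ≠ 0 :=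
    fun m => mul_ne_zero (mul_ne_zero (inv_ne_zero hq) hbn)
      (Nat.cast_ne_zero.2 (Nat.factorial_ne_zero _))
  induction K with
  | zero =>
    -- At order zero the two families of pure derivatives coincide, so only `t 0` is matched.
    refine ⟨0 + C (t 0 / ((q.eval (z₀.re : ℂ))⁻¹ * (b n).eval (z₀.re : ℂ) * (n + 0).factorial)) *
      (X - C z₀) ^ (n + 0), 0, fun j hj => ?_⟩
    obtain rfl : j = 0 := by omega
    refine ⟨?_, fun h => absurd rfl h⟩
    have h0 : testSolution q n b 0 z₀ = 0 := by
      simp [testSolution, jetSum]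
    have h0' : mixedDeriv 0 0 (testSolution q n b 0) z₀ = 0 := h0
    rw [mixedDeriv_testPair hq, mixedDeriv_testSolution_add hq, mixedDeriv_testSolution hq, h0',
      map_zero, add_zero, zero_add, div_mul_cancel₀ _ (htop 0)]
  | succ K ih =>
    obtain ⟨f, g, hfg⟩ := ih
    have hv := jetVanish_testSolution (q := q) (z₀ := z₀) hq n b K
    set E : ℂ[X] := (X - C z₀) ^ (n + (K + 1)) with hE
    set τ := (q.eval (z₀.re : ℂ))⁻¹ * (b n).eval (z₀.re : ℂ) * (n + (K + 1)).factorial with hτ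
    have hτ0 : τ ≠ 0 := htop (K + 1)
    obtain ⟨A, hA⟩ : ∃ A, A = mixedDeriv (K + 1) 0 (testPair q n b f g) z₀ := ⟨_, rfl⟩
    obtain ⟨B, hB⟩ : ∃ B, B = mixedDeriv 0 (K + 1) (testPair q n b f g) z₀ := ⟨_, rfl⟩
    -- Adding a multiple of the next power to `f` corrects `∂^{K+1}` alone, and to `g` (after
    -- conjugation) `∂̄^{K+1}` alone; lower pure derivatives are unchanged.
    refine ⟨f + C ((t (K + 1) - A) / τ) * E, g + C (conj (t' (K + 1) - B) / τ) * E,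
      fun j hj => ?_⟩
    have e0 : ∀ i, mixedDeriv 0 i (testSolution q n b E) z₀ = 0 := fun i =>
      hv i 0 (Nat.zero_le _) i le_rfl
    have eτ : mixedDeriv (K + 1) 0 (testSolution q n b E) z₀ = τ :=
      mixedDeriv_testSolution hq n b (K + 1)
    rw [mixedDeriv_testPair hq, mixedDeriv_testPair hq, mixedDeriv_testSolution_add hq,
      mixedDeriv_testSolution_add hq, mixedDeriv_testSolution_add hq,
      mixedDeriv_testSolution_add hq, e0 j]
    rcases Nat.lt_or_ge K j with hjK | hjK
    · obtain rfl : j = K + 1 := by omega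
      rw [mixedDeriv_testPair hq] at hA hB
      rw [eτ, div_mul_cancel₀ _ hτ0, div_mul_cancel₀ _ hτ0, hA, hB]
      simp only [map_add, map_sub, mul_zero, add_zero, Complex.conj_conj]
      exact ⟨by ring, fun _ => by ring⟩
    · rw [hv 0 j hjK 0 le_rfl, ← (hfg j hjK).1]
      refine ⟨?_, fun h => ?_⟩
      · rw [mixedDeriv_testPair hq]
        simp
      · rw [← (hfg j hjK).2 h, mixedDeriv_testPair hq]
        simp

end

/-! ### The weighted pull-back to the disc -/

/-- `c(Re F(w)) |F'(w)|² u(F(w))`. -/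
noncomputable def pullback (c F : ℂ[X]) (u : ℂ → ℂ) (w : ℂ) : ℂ :=
  c.eval ((F.eval w).re : ℂ) * (F.derivative.eval w * conj (F.derivative.eval w)) * u (F.eval w)

theorem conj_eval_map (P : ℂ[X]) (w : ℂ) : conj ((P.map conj).eval w) = P.eval (conj w) := by
  rw [eval_map, hom_eval₂]
  have : (conj).comp conj = RingHom.id ℂ := by ext; simp
  rw [this, eval₂_id]

/-- The antiholomorphic Taylor coefficients of `c(Re F) conj F'` along `F - ζ`. -/
noncomputable def antiCoeff (c F : ℂ[X]) (ζ : ℂ) (e : ℕ) : ℂ[X] :=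
  ((hasseDeriv e c).map conj).comp (C (1 / 2) * (C (conj ζ) + F)) * derivative F

/-- The degree in `w̄` of the pull-back: `c(Re F)` contributes at most `deg c · deg F` and the
conjugate of `F'` at most `deg F - 1`. -/
theorem natDegree_antiCoeff_add_one_le (c F : ℂ[X]) (ζ : ℂ) (e : ℕ) (hF : 1 ≤ F.natDegree) :
    (antiCoeff c F ζ e).natDegree + 1 ≤ (c.natDegree + 1) * F.natDegree := by
  have h1 : ((hasseDeriv e c).map conj).natDegree ≤ c.natDegree :=
    (natDegree_map_le).trans ((natDegree_hasseDeriv_le c e).trans (Nat.sub_le _ _))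
  have h2 : (C (1 / 2) * (C (conj ζ) + F)).natDegree ≤ F.natDegree := by
    refine (natDegree_C_mul_le _ _).trans ?_
    rw [natDegree_C_add]
  have h3 := natDegree_derivative_le F
  have h4 : (antiCoeff c F ζ e).natDegree ≤ c.natDegree * F.natDegree + (F.natDegree - 1) := by
    refine natDegree_mul_le.trans (add_le_add ?_ h3)
    exact natDegree_comp_le.trans (Nat.mul_le_mul h1 h2)
  rw [add_mul, one_mul]
  omega

/-- Taylor expansion of `c` at `(ζ + F̄)/2`, using `Re F = (F - ζ)/2 + (ζ + F̄)/2`. The free point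
`ζ` lets the holomorphic factors vanish at a chosen place. -/
theorem eval_re_mul_eq_sum (c F : ℂ[X]) (ζ w : ℂ) :
    c.eval ((F.eval w).re : ℂ) * conj (F.derivative.eval w) =
      ∑ e ∈ Finset.range (c.natDegree + 1),
        (((C (1 / 2) * (F - C ζ)) ^ e).eval w) * conj ((antiCoeff c F ζ e).eval w) := by
  have hx : ((F.eval w).re : ℂ) = (F.eval w - ζ) / 2 + (ζ + conj (F.eval w)) / 2 := by
    rw [Complex.re_eq_add_conj]
    ring
  have h1 : ∀ e, conj ((antiCoeff c F ζ e).eval w) =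
      (hasseDeriv e c).eval ((ζ + conj (F.eval w)) / 2) * conj (F.derivative.eval w) := by
    intro e
    rw [antiCoeff, eval_mul, eval_comp, map_mul, conj_eval_map]
    congr 2
    simp [map_ofNat]
    ring
  rw [hx, ← taylor_eval, eval_eq_sum_range, natDegree_taylor, Finset.sum_mul]
  refine Finset.sum_congr rfl fun e _ => ?_
  rw [h1, taylor_coeff]
  simp only [eval_pow, eval_mul, eval_C, eval_sub]
  ring

/-- The holomorphic factors in the pull-back of an explicit solution. -/
noncomputable def holoCoeff (f F : ℂ[X]) (ζ : ℂ) (j e : ℕ) : ℂ[X] :=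
  (derivative^[j] f).comp F * derivative F * (C (1 / 2) * (F - C ζ)) ^ e

theorem pullback_testSolution_eq_sum (s q : ℂ[X]) (n : ℕ) (b : ℕ → ℂ[X]) (f F : ℂ[X]) (ζ : ℂ)
    {w : ℂ} (hq : q.eval ((F.eval w).re : ℂ) ≠ 0) :
    pullback (s * q) F (testSolution q n b f) w =
      ∑ j ∈ Finset.range (n + 1), ∑ e ∈ Finset.range ((s * b j).natDegree + 1),
        (holoCoeff f F ζ j e).eval w * conj ((antiCoeff (s * b j) F ζ e).eval w) := by
  have h1 : pullback (s * q) F (testSolution q n b f) w = ∑ j ∈ Finset.range (n + 1),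
      ((derivative^[j] f).eval (F.eval w) * F.derivative.eval w) *
        ((s * b j).eval ((F.eval w).re : ℂ) * conj (F.derivative.eval w)) := by
    simp only [pullback, testSolution, jetSum, eval_mul, Finset.mul_sum]
    refine Finset.sum_congr rfl fun j _ => ?_
    field_simp
  rw [h1]
  refine Finset.sum_congr rfl fun j _ => ?_
  rw [eval_re_mul_eq_sum _ _ ζ, Finset.mul_sum]
  refine Finset.sum_congr rfl fun e _ => ?_
  simp only [holoCoeff, eval_mul, eval_comp]
  ring

theorem mixedDeriv_pullback_testSolution (s q : ℂ[X]) (n : ℕ) (b : ℕ → ℂ[X]) (f F : ℂ[X]) (ζ : ℂ)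
    {w : ℂ} (hq : q.eval ((F.eval w).re : ℂ) ≠ 0) (l m : ℕ) :
    mixedDeriv l m (pullback (s * q) F (testSolution q n b f)) w =
      ∑ j ∈ Finset.range (n + 1), ∑ e ∈ Finset.range ((s * b j).natDegree + 1),
        (derivative^[l] (holoCoeff f F ζ j e)).eval w *
          conj ((derivative^[m] (antiCoeff (s * b j) F ζ e)).eval w) := by
  have he : pullback (s * q) F (testSolution q n b f) =ᶠ[𝓝 w] fun w =>
      ∑ j ∈ Finset.range (n + 1), ∑ e ∈ Finset.range ((s * b j).natDegree + 1),
        (holoCoeff f F ζ j e).eval w * conj ((antiCoeff (s * b j) F ζ e).eval w) := by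
    have hc : Continuous fun w : ℂ => q.eval ((F.eval w).re : ℂ) :=
      (continuous_polynomial_re q).comp F.continuous
    filter_upwards [hc.continuousAt.eventually_ne hq] with y hy
    exact pullback_testSolution_eq_sum s q n b f F ζ hy
  have hs : ∀ P R : ℂ[X], ContDiffAt ℝ ∞ (fun w => P.eval w * conj (R.eval w)) w := fun P R =>
    (contDiffAt_polynomial P w).mul (contDiffAt_conj (contDiffAt_polynomial R w))
  rw [(mixedDeriv_congr he l m).self_of_nhds, mixedDeriv_sum_apply _ fun j _ =>
    ContDiffAt.sum fun e _ => hs _ _]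
  refine Finset.sum_congr rfl fun j _ => ?_
  rw [mixedDeriv_sum_apply _ fun e _ => hs _ _]
  refine Finset.sum_congr rfl fun e _ => ?_
  rw [mixedDeriv_polynomial_mul_conj]

end Explicit

/-! ### Functionals on germs of solutions, and polyharmonicity of the pull-back. -/

section Germs

open Polynomial

theorem IsGermSolution.add {α β : ℂ → ℂ} {z : ℂ} {u v : ℂ → ℂ} (hu : IsGermSolution α β z u)
    (hv : IsGermSolution α β z v) : IsGermSolution α β z (fun w => u w + v w) := by
  refine ⟨hu.1.add hv.1, ?_⟩
  have h1 := mixedDeriv_add hu.1 hv.1 1 1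
  have h2 := mixedDeriv_add hu.1 hv.1 1 0
  have h3 := mixedDeriv_add hu.1 hv.1 0 1
  simp only [mixedDeriv, Function.iterate_one, Function.iterate_zero, id_eq] at h1 h2 h3
  filter_upwards [h1, h2, h3, hu.2, hv.2] with w h1 h2 h3 h4 h5
  rw [h1, h2, h3, h4, h5]
  ring

theorem IsGermSolution.const_mul {α β : ℂ → ℂ} {z : ℂ} {u : ℂ → ℂ} (hu : IsGermSolution α β z u)
    (c : ℂ) : IsGermSolution α β z (fun w => c * u w) := by
  refine ⟨contDiffAt_const.mul hu.1, ?_⟩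
  have h1 := mixedDeriv_const_mul hu.1 c 1 1
  have h2 := mixedDeriv_const_mul hu.1 c 1 0
  have h3 := mixedDeriv_const_mul hu.1 c 0 1
  simp only [mixedDeriv, Function.iterate_one, Function.iterate_zero, id_eq] at h1 h2 h3
  filter_upwards [h1, h2, h3, hu.2] with w h1 h2 h3 h4
  rw [h1, h2, h3, h4]
  ring

theorem IsGermSolution.conj {α : ℂ → ℂ} {z : ℂ} {u : ℂ → ℂ} (hu : IsGermSolution α α z u)
    (hα : ∀ w, conj (α w) = α w) : IsGermSolution α α z (fun w => conj (u w)) := by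
  refine ⟨contDiffAt_conj hu.1, ?_⟩
  have h1 : dZ (dZbar u) =ᶠ[𝓝 z] dZbar (dZ u) := by
    rw [dZ_eq_wirtinger]
    exact wirtinger_comm_eventually hu.1 _ _
  rw [dZbar_conj, dZ_conj, dZ_conj]
  filter_upwards [h1, hu.2] with w h1 h2
  rw [← h1, h2]
  simp only [map_add, map_mul, hα]
  ring

/-- The germs of solutions form a vector space. -/
def germSolutions (α β : ℂ → ℂ) (z : ℂ) : Submodule ℂ (ℂ → ℂ) where
  carrier := {u | IsGermSolution α β z u}
  add_mem' hu hv := hu.add hv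
  zero_mem' := by
    have h0 : ∀ c : ℂ, wirtinger c (0 : ℂ → ℂ) = 0 := fun c => by
      funext w
      have : fderiv ℝ (0 : ℂ → ℂ) w = 0 := fderiv_const_apply 0
      simp [wirtinger, dX, dY, this]
    refine ⟨contDiffAt_const, Eventually.of_forall fun w => ?_⟩
    simp [dZ_eq_wirtinger, dZbar_eq_wirtinger, h0]
  smul_mem' c _ hu := hu.const_mul c

/-- A derivative at a point as a functional on germs of solutions. -/
noncomputable def derivFunctional (α β : ℂ → ℂ) (z : ℂ) (i j : ℕ) :
    germSolutions α β z →ₗ[ℂ] ℂ where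
  toFun u := mixedDeriv i j u.1 z
  map_add' u v := mixedDeriv_add_apply u.2.1 v.2.1 i j
  map_smul' c u := mixedDeriv_const_mul_apply u.2.1 c i j

theorem contDiffAt_pullback_weight (c F : ℂ[X]) (w : ℂ) :
    ContDiffAt ℝ ∞ (fun w => c.eval ((F.eval w).re : ℂ) *
      (F.derivative.eval w * conj (F.derivative.eval w))) w :=
  (ContDiffAt.comp_polynomial (contDiffAt_polynomial_re c _)).mul
    ((contDiffAt_polynomial _ w).mul (contDiffAt_conj (contDiffAt_polynomial _ w)))

theorem contDiffAt_pullback {c F : ℂ[X]} {u : ℂ → ℂ} {w : ℂ}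
    (hu : ContDiffAt ℝ ∞ u (F.eval w)) : ContDiffAt ℝ ∞ (pullback c F u) w :=
  (contDiffAt_pullback_weight c F w).mul hu.comp_polynomial

/-- A derivative of the pull-back as a functional on germs of solutions. -/
noncomputable def pullbackFunctional (α β : ℂ → ℂ) (c F : ℂ[X]) (w : ℂ) (i j : ℕ) :
    germSolutions α β (F.eval w) →ₗ[ℂ] ℂ where
  toFun u := mixedDeriv i j (pullback c F u.1) w
  map_add' u v := by
    rw [← mixedDeriv_add_apply (contDiffAt_pullback u.2.1) (contDiffAt_pullback v.2.1)]
    congr 1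
    funext y
    simp only [pullback, Submodule.coe_add, Pi.add_apply]
    ring
  map_smul' k u := by
    rw [RingHom.id_apply, smul_eq_mul, ← mixedDeriv_const_mul_apply (contDiffAt_pullback u.2.1)]
    congr 1
    funext y
    simp only [pullback, Submodule.coe_smul, Pi.smul_apply, smul_eq_mul]
    ring

theorem IsGermSolution.mixedDeriv_pullback_eq_zero {α β : ℂ → ℂ} {c F : ℂ[X]} {w : ℂ} {u : ℂ → ℂ}
    (hu : IsGermSolution α β (F.eval w) u) (hα : ContDiffAt ℝ ∞ α (F.eval w))
    (hβ : ContDiffAt ℝ ∞ β (F.eval w)) {m : ℕ}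
    (hz : ∀ j ≤ m, mixedDeriv j 0 u (F.eval w) = 0)
    (hzb : ∀ j ≤ m, mixedDeriv 0 j u (F.eval w) = 0) :
    mixedDeriv m m (pullback c F u) w = 0 :=
  ((hu.jetVanish hα hβ hz hzb).comp_polynomial hu.1).mixedDeriv_mul
    (contDiffAt_pullback_weight c F w) hu.1.comp_polynomial

theorem pullback_conj {c F : ℂ[X]} (hc : ∀ x : ℝ, conj (c.eval (x : ℂ)) = c.eval (x : ℂ))
    (u : ℂ → ℂ) : pullback c F (fun z => conj (u z)) = fun w => conj (pullback c F u w) := by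
  funext w
  simp only [pullback, map_mul, hc, Complex.conj_conj]
  ring

/-- Derivatives of the pull-back of solutions are multipole functionals. -/
theorem exists_multipole {α : ℂ → ℂ} {c F : ℂ[X]} {w : ℂ} (hα : ContDiffAt ℝ ∞ α (F.eval w))
    (hαr : ∀ z, conj (α z) = α z) (hc : ∀ x : ℝ, conj (c.eval (x : ℂ)) = c.eval (x : ℂ))
    {m k : ℕ} (hmk : m ≤ k) :
    ∃ (Q : ℝ) (Qm : ℕ → ℂ), ∀ u, IsGermSolution α α (F.eval w) u →
      mixedDeriv m m (pullback c F u) w = multipole (F.eval w) k Q Qm u := by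
  let L : Fin (k + 1) ⊕ Fin (k + 1) → germSolutions α α (F.eval w) →ₗ[ℂ] ℂ :=
    Sum.elim (fun j => derivFunctional α α _ j 0) (fun j => derivFunctional α α _ 0 j)
  -- A functional that vanishes on the common kernel of finitely many functionals lies in their
  -- span. The common kernel here consists of solutions whose pure derivatives up to order `k`
  -- vanish, hence whose jets vanish up to order `(m, m)`.
  have hspan : pullbackFunctional α α c F w m m ∈ Submodule.span ℂ (Set.range L) := by
    apply mem_span_of_iInf_ker_le_ker
    intro u hu
    simp only [Submodule.mem_iInf, LinearMap.mem_ker] at hu ⊢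
    refine IsGermSolution.mixedDeriv_pullback_eq_zero u.2 hα hα (fun j hj => ?_) fun j hj => ?_
    · exact hu (Sum.inl ⟨j, by omega⟩)
    · exact hu (Sum.inr ⟨j, by omega⟩)
  obtain ⟨a, ha⟩ := (Submodule.mem_span_range_iff_exists_fun ℂ).1 hspan
  set A : ℕ → ℂ := fun j => if h : j < k + 1 then a (Sum.inl ⟨j, h⟩) else 0 with hA
  set B : ℕ → ℂ := fun j => if h : j < k + 1 then a (Sum.inr ⟨j, h⟩) else 0 with hB
  have hrep : ∀ u, IsGermSolution α α (F.eval w) u → mixedDeriv m m (pullback c F u) w =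
      ∑ j ∈ Finset.range (k + 1), (A j * mixedDeriv j 0 u (F.eval w) +
        B j * mixedDeriv 0 j u (F.eval w)) := by
    intro u hu
    have h1 := LinearMap.congr_fun ha ⟨u, hu⟩
    rw [Fintype.sum_sum_type] at h1
    simp only [LinearMap.add_apply, LinearMap.sum_apply, LinearMap.smul_apply, smul_eq_mul] at h1
    rw [Finset.sum_range, Finset.sum_add_distrib]
    simp only [hA, hB, Fin.is_lt, dite_true, Fin.eta]
    exact h1.symm
  -- The equation and the weight are real, so the functional commutes with conjugation. Averaging
  -- its representation with the conjugated one makes the coefficients of `∂ʲ` and `∂̄ʲ` conjugate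
  -- and the coefficient of `φ` real.
  refine ⟨(A 0 + B 0).re, fun j => (A j + conj (B j)) / 2, fun u hu => ?_⟩
  have h1 := hrep u hu
  have h2 := congrArg conj (hrep _ (hu.conj hαr))
  rw [pullback_conj hc, mixedDeriv_conj_apply (contDiffAt_pullback hu.1), Complex.conj_conj,
    map_sum] at h2
  simp only [mixedDeriv_conj_apply hu.1, map_add, map_mul, Complex.conj_conj] at h2
  have h3 : mixedDeriv m m (pullback c F u) w = ∑ j ∈ Finset.range (k + 1),
      ((A j + conj (B j)) / 2 * mixedDeriv j 0 u (F.eval w) +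
        conj ((A j + conj (B j)) / 2) * mixedDeriv 0 j u (F.eval w)) := by
    rw [← add_halves (mixedDeriv m m (pullback c F u) w)]
    nth_rewrite 1 [h1]
    rw [h2, Finset.sum_div, Finset.sum_div, ← Finset.sum_add_distrib]
    refine Finset.sum_congr rfl fun j _ => ?_
    simp only [map_div₀, map_add, Complex.conj_conj, map_ofNat]
    ring
  have h4 : ∀ f : ℕ → ℂ, ∑ j ∈ Finset.Icc 1 k, f j = ∑ j ∈ Finset.range k, f (j + 1) := by
    intro f
    rw [Finset.range_eq_Ico, Finset.sum_Ico_add' f 0 k 1]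
    rfl
  rw [h3, Finset.sum_range_succ', add_comm, multipole, h4]
  congr 1
  have h5 : ((A 0 + B 0).re : ℂ) = (A 0 + conj (B 0)) / 2 + conj ((A 0 + conj (B 0)) / 2) := by
    rw [Complex.re_eq_add_conj]
    simp only [map_div₀, map_add, Complex.conj_conj, map_ofNat]
    ring
  rw [h5, add_mul]
  rfl

theorem testPair_isGermSolution {p q : ℂ[X]} {b : ℕ → ℂ[X]} (hb : IsDressing p b)
    (hpq : hirota p q = 0) {n : ℕ} (hn : b (n + 1) = 0) (f g : ℂ[X]) {z₀ : ℂ}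
    (hp : p.eval (z₀.re : ℂ) ≠ 0) (hq : q.eval (z₀.re : ℂ) ≠ 0)
    (hα : ∀ z, conj (logDerivHalf p q z) = logDerivHalf p q z) :
    IsGermSolution (logDerivHalf p q) (logDerivHalf p q) z₀ (testPair q n b f g) :=
  (hb.isGermSolution hpq hn f hp hq).add ((hb.isGermSolution hpq hn g hp hq).conj hα)

/-- The pull-back of a solution is polyharmonic. -/
theorem IsGermSolution.mixedDeriv_pullback_eq_zero_of_natDegree {p q s F : ℂ[X]} {b : ℕ → ℂ[X]}
    (hb : IsDressing p b) (hpq : hirota p q = 0) {n : ℕ} (hn : b (n + 1) = 0) (hbn : b n = p)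
    {w : ℂ} (hp : p.eval ((F.eval w).re : ℂ) ≠ 0) (hq : q.eval ((F.eval w).re : ℂ) ≠ 0)
    (hα : ∀ z, conj (logDerivHalf p q z) = logDerivHalf p q z)
    (hs : ∀ x : ℝ, conj ((s * q).eval (x : ℂ)) = (s * q).eval (x : ℂ)) (hF : 1 ≤ F.natDegree)
    {K : ℕ} (hK : ∀ j ≤ n, ((s * b j).natDegree + 1) * F.natDegree ≤ K) {u : ℂ → ℂ}
    (hu : IsGermSolution (logDerivHalf p q) (logDerivHalf p q) (F.eval w) u) :
    mixedDeriv K K (pullback (s * q) F u) w = 0 := by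
  have hsm := contDiffAt_logDerivHalf hp hq
  -- For explicit solutions any expansion point serves; the degree in `w̄` is below `K`. The
  -- expansion point is therefore taken to be `0`.
  have htest : ∀ f, mixedDeriv K K (pullback (s * q) F (testSolution q n b f)) w = 0 := by
    intro f
    rw [mixedDeriv_pullback_testSolution s q n b f F 0 hq]
    refine Finset.sum_eq_zero fun j hj => Finset.sum_eq_zero fun e _ => ?_
    have h1 := natDegree_antiCoeff_add_one_le (s * b j) F 0 e hF
    have h2 := hK j (Nat.lt_succ_iff.1 (Finset.mem_range.1 hj))
    rw [iterate_derivative_eq_zero (p := antiCoeff (s * b j) F 0 e) (by omega)]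
    simp
  obtain ⟨f, g, hfg⟩ := exists_testPair (z₀ := F.eval w) hq n b (by rw [hbn]; exact hp)
    (fun j => mixedDeriv j 0 u (F.eval w)) (fun j => mixedDeriv 0 j u (F.eval w)) K
  have ht := testPair_isGermSolution hb hpq hn f g hp hq hα
  have hd := hu.add (ht.const_mul (-1))
  have hz : ∀ i j, mixedDeriv i j (fun z => u z + -1 * testPair q n b f g z) (F.eval w) =
      mixedDeriv i j u (F.eval w) - mixedDeriv i j (testPair q n b f g) (F.eval w) := by
    intro i j
    rw [mixedDeriv_add_apply hu.1 (contDiffAt_const.mul ht.1), mixedDeriv_const_mul_apply ht.1]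
    ring
  -- The difference from the matching explicit solution has vanishing jet at `F w`, so the claim
  -- transfers from `htest` at this one point.
  have h1 := hd.mixedDeriv_pullback_eq_zero (c := s * q) (m := K) hsm hsm
    (fun j hj => by rw [hz, (hfg j hj).1, sub_self]) (fun j hj => by
      rw [hz]
      obtain _ | j := j
      · exact sub_eq_zero.2 (hfg 0 hj).1.symm
      · rw [(hfg _ hj).2 (Nat.succ_ne_zero j), sub_self])
  have hsol := hb.isGermSolution hpq hn
  have hg := contDiffAt_testSolution (z := F.eval w) n b g hq
  have hf := contDiffAt_testSolution (z := F.eval w) n b f hq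
  have h2 : pullback (s * q) F (fun z => u z + -1 * testPair q n b f g z) = fun w =>
      pullback (s * q) F u w + -1 * (pullback (s * q) F (testSolution q n b f) w +
        conj (pullback (s * q) F (testSolution q n b g) w)) := by
    funext y
    have h3 := congrFun (pullback_conj (F := F) hs (testSolution q n b g)) y
    rw [← h3]
    simp only [pullback, testPair]
    ring
  have hpf := contDiffAt_pullback (c := s * q) hf
  have hpg := contDiffAt_conj (contDiffAt_pullback (c := s * q) hg)
  rw [h2, mixedDeriv_add_apply (contDiffAt_pullback hu.1)
    (contDiffAt_const.mul (hpf.add hpg)), mixedDeriv_const_mul_apply (hpf.add hpg),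
    mixedDeriv_add_apply hpf hpg, mixedDeriv_conj_apply (contDiffAt_pullback hg),
    htest, htest] at h1
  simpa using h1

/-! ### The test solution that detects the highest multipole. -/

theorem eval_iterate_derivative_eq_coeff_taylor (P : ℂ[X]) (w : ℂ) (i : ℕ) :
    (derivative^[i] P).eval w = i.factorial * (taylor w P).coeff i := by
  rw [taylor_coeff, ← factorial_smul_hasseDeriv]
  simp

theorem eval_iterate_derivative_pow_mul (R : ℂ[X]) (w : ℂ) (m i : ℕ) :
    (derivative^[i] ((X - C w) ^ m * R)).eval w =
      if m ≤ i then i.factorial * (taylor w R).coeff (i - m) else 0 := by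
  rw [eval_iterate_derivative_eq_coeff_taylor, taylor_mul, taylor_pow]
  have : taylor w (X - C w) = X := by simp
  rw [this, coeff_X_pow_mul']
  split_ifs <;> simp

/-- With `F - F(w) = (X - w) G` and `G(w) = F'(w)`, both `f⁽ʲ⁾ ∘ F` and the powers of `F - F(w)`
contribute zeros at `w`; the total order is minimal exactly for `j = n`, `e = 0`. -/
theorem exists_holoCoeff_eq (n k j e : ℕ) (hj : j ≤ n) (F : ℂ[X]) (w : ℂ) :
    ∃ R : ℂ[X], holoCoeff ((X - C (F.eval w)) ^ (n + k)) F (F.eval w) j e =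
        (X - C w) ^ (n + k - j + e) * R ∧
      (j = n → e = 0 → R.eval w = (n + k).descFactorial n * F.derivative.eval w ^ (k + 1)) := by
  obtain ⟨G, hG⟩ := X_sub_C_dvd_sub_C_eval (p := F) (a := w)
  have hG1 : G.eval w = F.derivative.eval w := by
    have := congrArg (fun P => (derivative P).eval w) hG
    simp at this
    exact this.symm
  have h1 : (derivative^[j] ((X - C (F.eval w)) ^ (n + k))).comp F =
      ((n + k).descFactorial j : ℂ[X]) * ((X - C w) * G) ^ (n + k - j) := by
    rw [iterate_derivative_X_sub_pow, ← hG]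
    simp
  refine ⟨((n + k).descFactorial j : ℂ[X]) * G ^ (n + k - j) * derivative F * (C (1 / 2) * G) ^ e, ?_, ?_⟩
  · rw [holoCoeff, h1, hG]
    simp only [mul_pow, pow_add]
    ring
  · rintro rfl rfl
    simp [hG1]
    ring

theorem mixedDeriv_pullback_testSolution_of_lt (s q : ℂ[X]) (n : ℕ) (b : ℕ → ℂ[X]) (F : ℂ[X])
    {w : ℂ} (hq : q.eval ((F.eval w).re : ℂ) ≠ 0) {i k : ℕ} (hik : i < k) :
    mixedDeriv i i (pullback (s * q) F (testSolution q n b ((X - C (F.eval w)) ^ (n + k)))) w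
      = 0 := by
  rw [mixedDeriv_pullback_testSolution s q n b _ F (F.eval w) hq]
  refine Finset.sum_eq_zero fun j hj => Finset.sum_eq_zero fun e _ => ?_
  have hj := Finset.mem_range.1 hj
  obtain ⟨R, hR, -⟩ := exists_holoCoeff_eq n k j e (by omega) F w
  rw [hR, eval_iterate_derivative_pow_mul, if_neg (by omega), zero_mul]

/-- Only `j = n`, `e = 0` has a holomorphic factor of order as low as `k` at `w`. Its
antiholomorphic factor has degree exactly `k`, so the `k`-th derivative is a nonzero multiple of the
leading coefficient. -/
theorem mixedDeriv_pullback_testSolution_ne_zero (s q : ℂ[X]) (n : ℕ) (b : ℕ → ℂ[X]) (F : ℂ[X])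
    {w : ℂ} (hq : q.eval ((F.eval w).re : ℂ) ≠ 0) {k : ℕ} (hb : s * b n ≠ 0)
    (hk : k + 1 = ((s * b n).natDegree + 1) * F.natDegree) (hF : F.derivative.eval w ≠ 0) :
    mixedDeriv k k (pullback (s * q) F (testSolution q n b ((X - C (F.eval w)) ^ (n + k)))) w
      ≠ 0 := by
  rw [mixedDeriv_pullback_testSolution s q n b _ F (F.eval w) hq]
  have hz : ∀ j e, j ≤ n → ¬ (j = n ∧ e = 0) → (derivative^[k] (holoCoeff
      ((X - C (F.eval w)) ^ (n + k)) F (F.eval w) j e)).eval w = 0 := by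
    intro j e hj hne
    obtain ⟨R, hR, -⟩ := exists_holoCoeff_eq n k j e hj F w
    rw [hR, eval_iterate_derivative_pow_mul, if_neg (by omega)]
  rw [Finset.sum_eq_single n, Finset.sum_eq_single 0]
  · obtain ⟨R, hR, hR2⟩ := exists_holoCoeff_eq n k n 0 le_rfl F w
    rw [hR, eval_iterate_derivative_pow_mul, if_pos (by omega),
      show k - (n + k - n + 0) = 0 by omega, taylor_coeff_zero, hR2 rfl rfl]
    have hfac : ∀ m : ℕ, (m.factorial : ℂ) ≠ 0 := fun m =>
      Nat.cast_ne_zero.2 (Nat.factorial_ne_zero m)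
    refine mul_ne_zero (mul_ne_zero (hfac _) (mul_ne_zero ?_ (pow_ne_zero _ hF))) ?_
    · rw [Nat.cast_ne_zero]
      exact fun h => absurd (Nat.descFactorial_eq_zero_iff_lt.1 h) (by omega)
    · rw [(map_ne_zero_iff (starRingEnd ℂ) (RingHom.injective _)),
        eval_iterate_derivative_eq_coeff_taylor]
      refine mul_ne_zero (hfac _) ?_
      have hFd : F.natDegree ≠ 0 := by
        intro h0
        rw [h0, mul_zero] at hk
        omega
      set c := s * b n with hc
      have hmap : (c.map conj).natDegree = c.natDegree := natDegree_map_eq_of_injective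
        (RingHom.injective _) _
      have hmap0 : c.map conj ≠ 0 := (Polynomial.map_ne_zero_iff (RingHom.injective _)).2 hb
      have hlin : (C (1 / 2 : ℂ) * (C (conj (F.eval w)) + F)).natDegree = F.natDegree := by
        rw [natDegree_C_mul (by norm_num), natDegree_C_add]
      have hd0 : derivative F ≠ 0 := fun h0 => hF (by rw [h0, eval_zero])
      have hcomp0 : (c.map conj).comp (C (1 / 2 : ℂ) * (C (conj (F.eval w)) + F)) ≠ 0 := by
        intro h0
        rcases comp_eq_zero_iff.1 h0 with h1 | h1
        · exact hmap0 h1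
        · have := congrArg natDegree h1.2
          rw [hlin, natDegree_C] at this
          exact hFd this
      have hdeg : (antiCoeff c F (F.eval w) 0).natDegree = k := by
        rw [antiCoeff, hasseDeriv_zero', natDegree_mul hcomp0 hd0, natDegree_comp, hmap, hlin,
          natDegree_derivative]
        rw [add_mul, one_mul] at hk
        omega
      have hne : antiCoeff c F (F.eval w) 0 ≠ 0 := by
        rw [antiCoeff, hasseDeriv_zero']
        exact mul_ne_zero hcomp0 hd0
      rw [← hdeg, coeff_taylor_natDegree]
      exact leadingCoeff_ne_zero.2 hne
  · intro e _ he
    rw [hz n e le_rfl (by tauto), zero_mul]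
  · intro h
    exact absurd (Finset.mem_range.2 (Nat.succ_pos _)) h
  · intro j hj hjn
    have := Finset.mem_range.1 hj
    exact Finset.sum_eq_zero fun e _ => by rw [hz j e (by omega) (by tauto), zero_mul]
  · intro h
    exact absurd (Finset.mem_range.2 (Nat.lt_succ_self _)) h

end Germs

/-! ### The mean value formula for polyharmonic functions on discs -/

section Pizzetti

open MeasureTheory Set

/-- The integral of `G` over the circle of radius `ρ`, in the angular variable. -/
noncomputable def angularIntegral (G : ℂ → ℂ) (ρ : ℝ) : ℂ :=
  ∫ θ in (-Real.pi)..Real.pi, G (circleMap 0 ρ θ)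

/-- `z ∂/∂z + z̄ ∂/∂z̄`, the derivative in the direction of the radius. -/
noncomputable def radialDeriv (G : ℂ → ℂ) (w : ℂ) : ℂ := w * dZ G w + conj w * dZbar G w

/-- `z ∂/∂z - z̄ ∂/∂z̄`, up to a factor the angular derivative. -/
noncomputable def angularDeriv (G : ℂ → ℂ) (w : ℂ) : ℂ := w * dZ G w + -conj w * dZbar G w

theorem ContDiffAt.radialDeriv {G : ℂ → ℂ} {w : ℂ} (h : ContDiffAt ℝ ∞ G w) :
    ContDiffAt ℝ ∞ (radialDeriv G) w :=
  (contDiffAt_fun_id.mul h.dZ).add ((contDiffAt_conj contDiffAt_fun_id).mul h.dZbar)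

theorem ContDiffAt.angularDeriv {G : ℂ → ℂ} {w : ℂ} (h : ContDiffAt ℝ ∞ G w) :
    ContDiffAt ℝ ∞ (angularDeriv G) w :=
  (contDiffAt_fun_id.mul h.dZ).add
    ((contDiffAt_conj contDiffAt_fun_id).neg.mul h.dZbar)

theorem dZ_id (w : ℂ) : dZ (fun w : ℂ => w) w = 1 := (hasDerivAt_id w).dZ_eq

theorem dZbar_id (w : ℂ) : dZbar (fun w : ℂ => w) w = 0 := (hasDerivAt_id w).dZbar_eq

/-- The polar form `(r∂_r)² = -∂_θ² + r²Δ` of the Laplacian. -/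
theorem radialDeriv_radialDeriv {G : ℂ → ℂ} {w : ℂ} (h : ContDiffAt ℝ ∞ G w) :
    radialDeriv (radialDeriv G) w = angularDeriv (angularDeriv G) w +
      4 * (w * conj w) * dZ (dZbar G) w := by
  have hi : DifferentiableAt ℝ (fun w : ℂ => w) w := differentiableAt_fun_id
  have hc : DifferentiableAt ℝ (fun w : ℂ => conj w) w :=
    (contDiffAt_conj contDiffAt_fun_id).differentiableAt (by simp)
  have hz := h.dZ.differentiableAt (by simp)
  have hb := h.dZbar.differentiableAt (by simp)
  have hcomm : dZbar (dZ G) w = dZ (dZbar G) w := by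
    rw [dZ_eq_wirtinger]
    exact (wirtinger_comm_eventually h _ _).self_of_nhds
  have hneg : ∀ c, wirtinger c (fun w => -conj w) w = -wirtinger c (fun w => conj w) w := by
    intro c
    have := wirtinger_const_mul hc (-1) c
    simpa using this
  have r : ∀ c, wirtinger c (radialDeriv G) w =
      wirtinger c (fun w => w) w * dZ G w + w * wirtinger c (dZ G) w +
        (wirtinger c (fun w => conj w) w * dZbar G w + conj w * wirtinger c (dZbar G) w) := by
    intro c
    have := wirtinger_add (hi.fun_mul hz) (hc.fun_mul hb) c
    rw [wirtinger_mul hi hz, wirtinger_mul hc hb] at this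
    exact this
  have a : ∀ c, wirtinger c (angularDeriv G) w =
      wirtinger c (fun w => w) w * dZ G w + w * wirtinger c (dZ G) w +
        (-wirtinger c (fun w => conj w) w * dZbar G w + -conj w * wirtinger c (dZbar G) w) := by
    intro c
    have := wirtinger_add (hi.fun_mul hz) (hc.fun_neg.fun_mul hb) c
    rw [wirtinger_mul hi hz, wirtinger_mul hc.fun_neg hb, hneg] at this
    exact this
  have r1 := r (-Complex.I)
  have r2 := r Complex.I
  have a1 := a (-Complex.I)
  have a2 := a Complex.I
  rw [← dZ_eq_wirtinger, dZ_id, congr_fun (dZ_conj _) w, dZbar_id] at r1 a1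
  rw [← dZbar_eq_wirtinger, dZbar_id, congr_fun (dZbar_conj _) w, dZ_id, hcomm] at r2 a2
  rw [radialDeriv.eq_def (radialDeriv G), angularDeriv.eq_def (angularDeriv G), r1, r2, a1, a2]
  simp only [map_zero, map_one]
  ring

variable {s : ℝ} {G : ℂ → ℂ}

theorem circleMap_zero_mem_ball {ρ : ℝ} (h : |ρ| < s) (θ : ℝ) :
    circleMap 0 ρ θ ∈ Metric.ball (0 : ℂ) s := by
  simpa using h

theorem continuous_comp_circleMap {ρ : ℝ} (hG : ContinuousOn G (Metric.ball 0 s)) (h : |ρ| < s) :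
    Continuous fun θ => G (circleMap 0 ρ θ) :=
  hG.comp_continuous (continuous_circleMap 0 ρ) (circleMap_zero_mem_ball h)

theorem continuousOn_ball_of_contDiffAt (hG : ∀ w ∈ Metric.ball (0 : ℂ) s, ContDiffAt ℝ ∞ G w) :
    ContinuousOn G (Metric.ball 0 s) :=
  fun w hw => (hG w hw).continuousAt.continuousWithinAt

theorem hasDerivAt_angularIntegral (hG : ∀ w ∈ Metric.ball (0 : ℂ) s, ContDiffAt ℝ ∞ G w) {ρ : ℝ}
    (h : |ρ| < s) :
    HasDerivAt (angularIntegral G) (∫ θ in (-Real.pi)..Real.pi,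
      fderiv ℝ G (circleMap 0 ρ θ) (circleMap 0 1 θ)) ρ := by
  obtain ⟨r, hr, hrs⟩ := exists_between h
  have hder : ∀ θ : ℝ, ∀ x : ℝ, |x| < s → HasDerivAt (fun x : ℝ => G (circleMap 0 x θ))
      (fderiv ℝ G (circleMap 0 x θ) (circleMap 0 1 θ)) x := by
    intro θ x hx
    have h1 : HasDerivAt (fun x : ℝ => circleMap 0 x θ) (circleMap 0 1 θ) x := by
      simp only [circleMap_zero]
      simpa using (Complex.ofRealCLM.hasDerivAt (x := x)).mul_const (Complex.exp (θ * Complex.I))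
    exact ((hG _ (circleMap_zero_mem_ball hx θ)).differentiableAt
      (by simp)).hasFDerivAt.comp_hasDerivAt x h1
  have hf : ∀ w ∈ Metric.ball (0 : ℂ) s, ContinuousAt (fderiv ℝ G) w := fun w hw =>
    ((hG w hw).fderiv_right (m := ∞) (by simp)).continuousAt
  have hfc : ContinuousOn (fderiv ℝ G) (Metric.ball 0 s) := fun w hw =>
    (hf w hw).continuousWithinAt
  obtain ⟨C, hC⟩ := (isCompact_closedBall (0 : ℂ) r).exists_bound_of_continuousOn
    (hfc.mono (Metric.closedBall_subset_ball hrs))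
  have hnhds : Metric.ball (0 : ℝ) r ∈ 𝓝 ρ := Metric.isOpen_ball.mem_nhds (by simpa using hr)
  have hnhds' : ∀ᶠ x in 𝓝 ρ, |x| < s := by
    filter_upwards [hnhds] with x hx
    have : |x| < r := by simpa using hx
    linarith
  have hcont : ∀ x : ℝ, |x| < s → Continuous fun θ => fderiv ℝ G (circleMap 0 x θ)
      (circleMap 0 1 θ) := fun x hx =>
    (hfc.comp_continuous (continuous_circleMap 0 x) (circleMap_zero_mem_ball hx)).clm_apply
      (continuous_circleMap 0 1)
  refine (intervalIntegral.hasDerivAt_integral_of_dominated_loc_of_deriv_le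
    (F := fun x θ => G (circleMap 0 x θ))
    (F' := fun x θ => fderiv ℝ G (circleMap 0 x θ) (circleMap 0 1 θ))
    (bound := fun _ => C) hnhds ?_ ?_ ?_ ?_ ?_ ?_).2
  · filter_upwards [hnhds'] with x hx
    exact (continuous_comp_circleMap (continuousOn_ball_of_contDiffAt hG) hx).aestronglyMeasurable
  · exact (continuous_comp_circleMap (continuousOn_ball_of_contDiffAt hG) h).intervalIntegrable _ _
  · exact (hcont ρ h).aestronglyMeasurable
  · refine Eventually.of_forall fun θ _ x hx => ?_
    have hx' : |x| < r := by simpa using hx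
    have h1 := ContinuousLinearMap.le_opNorm (fderiv ℝ G (circleMap 0 x θ)) (circleMap 0 1 θ)
    rw [norm_circleMap_zero, abs_one, mul_one] at h1
    exact h1.trans (hC _ (by simpa using hx'.le))
  · exact intervalIntegrable_const
  · refine Eventually.of_forall fun θ _ x hx => hder θ x ?_
    have hx' : |x| < r := by simpa using hx
    linarith

theorem mul_deriv_angularIntegral (hG : ∀ w ∈ Metric.ball (0 : ℂ) s, ContDiffAt ℝ ∞ G w) {ρ : ℝ}
    (h : |ρ| < s) :
    ∃ D, HasDerivAt (angularIntegral G) D ρ ∧ ρ * D = angularIntegral (radialDeriv G) ρ := by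
  refine ⟨_, hasDerivAt_angularIntegral hG h, ?_⟩
  rw [← intervalIntegral.integral_const_mul]
  refine intervalIntegral.integral_congr fun θ _ => ?_
  have h1 : circleMap 0 ρ θ = ρ • circleMap 0 1 θ := by simp [circleMap_zero]
  change (ρ : ℂ) * _ = radialDeriv G (circleMap 0 ρ θ)
  rw [radialDeriv, ← fderiv_apply_eq_dZ_dZbar]
  conv_rhs => enter [2]; rw [h1]
  rw [map_smul, Complex.real_smul]

theorem angularIntegral_angularDeriv (hG : ∀ w ∈ Metric.ball (0 : ℂ) s, ContDiffAt ℝ ∞ G w) {ρ : ℝ}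
    (h : |ρ| < s) : angularIntegral (angularDeriv G) ρ = 0 := by
  have hder : ∀ θ : ℝ, HasDerivAt (fun θ => G (circleMap 0 ρ θ))
      (Complex.I * angularDeriv G (circleMap 0 ρ θ)) θ := by
    intro θ
    have h1 := ((hG _ (circleMap_zero_mem_ball h θ)).differentiableAt
      (by simp)).hasFDerivAt.comp_hasDerivAt θ (hasDerivAt_circleMap 0 ρ θ)
    refine h1.congr_deriv ?_
    rw [fderiv_apply_eq_dZ_dZbar, angularDeriv, map_mul, Complex.conj_I]
    ring
  have hc : Continuous fun θ => Complex.I * angularDeriv G (circleMap 0 ρ θ) :=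
    continuous_const.mul (continuous_comp_circleMap
      (continuousOn_ball_of_contDiffAt fun w hw => (hG w hw).angularDeriv) h)
  have h2 := intervalIntegral.integral_eq_sub_of_hasDerivAt (fun θ _ => hder θ)
    (hc.intervalIntegrable (-Real.pi) Real.pi)
  rw [intervalIntegral.integral_const_mul] at h2
  have h3 : circleMap 0 ρ Real.pi = circleMap 0 ρ (-Real.pi) := by
    simp [circleMap_zero, Complex.exp_neg]
  rw [h3, sub_self] at h2
  exact (mul_eq_zero.1 h2).resolve_left Complex.I_ne_zero

/-- The angular part integrates to zero by periodicity, so the circular mean satisfies `(ρ d/dρ)²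
I(G) = 4ρ² I(∂∂̄G)`, the recursion behind Pizzetti's formula. -/
theorem angularIntegral_radialDeriv_radialDeriv
    (hG : ∀ w ∈ Metric.ball (0 : ℂ) s, ContDiffAt ℝ ∞ G w) {ρ : ℝ} (h : |ρ| < s) :
    angularIntegral (radialDeriv (radialDeriv G)) ρ =
      4 * (ρ : ℂ) ^ 2 * angularIntegral (fun w => dZ (dZbar G) w) ρ := by
  have hA := fun w hw => (hG w hw).angularDeriv
  have h1 : ∀ θ, radialDeriv (radialDeriv G) (circleMap 0 ρ θ) =
      angularDeriv (angularDeriv G) (circleMap 0 ρ θ) +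
        4 * (ρ : ℂ) ^ 2 * dZ (dZbar G) (circleMap 0 ρ θ) := by
    intro θ
    rw [radialDeriv_radialDeriv (hG _ (circleMap_zero_mem_ball h θ)), Complex.mul_conj,
      Complex.normSq_eq_norm_sq, norm_circleMap_zero]
    simp
  unfold angularIntegral
  simp only [h1]
  rw [intervalIntegral.integral_add, intervalIntegral.integral_const_mul]
  · have := angularIntegral_angularDeriv hA h
    unfold angularIntegral at this
    rw [this, zero_add]
  · exact (continuous_comp_circleMap (continuousOn_ball_of_contDiffAt
      fun w hw => (hA w hw).angularDeriv) h).intervalIntegrable _ _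
  · exact (continuous_const.mul (continuous_comp_circleMap (continuousOn_ball_of_contDiffAt
      fun w hw => (hG w hw).dZbar.dZ) h)).intervalIntegrable _ _

theorem eq_of_hasDerivAt_eq {f g f' : ℝ → ℂ} {a b : ℝ} (hab : a ≤ b) (h0 : f a = g a)
    (hf : ContinuousOn f (Icc a b)) (hg : ContinuousOn g (Icc a b))
    (hf' : ∀ x ∈ Ioo a b, HasDerivAt f (f' x) x) (hg' : ∀ x ∈ Ioo a b, HasDerivAt g (f' x) x) :
    f b = g b := by
  have h1 := intervalIntegral.integral_eq_sub_of_hasDerivAt_of_le hab (hf.sub hg)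
    (f' := fun _ => 0) (fun x hx => by simpa using (hf' x hx).sub (hg' x hx)) (by simp)
  simp only [intervalIntegral.integral_zero, Pi.sub_apply, h0, sub_self, sub_zero] at h1
  exact sub_eq_zero.1 h1.symm

/-- **Pizzetti's formula** for circles. -/
theorem angularIntegral_eq_of_polyharmonic (m : ℕ) :
    ∀ {G : ℂ → ℂ}, (∀ w ∈ Metric.ball (0 : ℂ) s, ContDiffAt ℝ ∞ G w) →
      (∀ w ∈ Metric.ball (0 : ℂ) s, (fun v => dZ (dZbar v))^[m] G w = 0) →
      ∀ ρ : ℝ, 0 ≤ ρ → ρ < s → angularIntegral G ρ = 2 * Real.pi * ∑ i ∈ Finset.range m,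
        (ρ : ℂ) ^ (2 * i) / (i.factorial : ℂ) ^ 2 * (fun v => dZ (dZbar v))^[i] G 0 := by
  induction m with
  | zero =>
    intro G hG h0 ρ hρ hρs
    have : ∀ θ, G (circleMap 0 ρ θ) = 0 := fun θ =>
      h0 _ (circleMap_zero_mem_ball (by rwa [abs_of_nonneg hρ]) θ)
    simp [angularIntegral, this]
  | succ m ih =>
    intro G hG h0 ρ hρ hρs
    have ih' := ih (G := fun w => dZ (dZbar G) w) (fun w hw => (hG w hw).dZbar.dZ) h0
    have hab : ∀ {x : ℝ}, 0 ≤ x → x < s → |x| < s := fun h1 h2 => by rwa [abs_of_nonneg h1]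
    have hR := fun w hw => (hG w hw).radialDeriv
    have hcont : ∀ {H : ℂ → ℂ}, (∀ w ∈ Metric.ball (0 : ℂ) s, ContDiffAt ℝ ∞ H w) →
        ∀ x < s, ContinuousOn (angularIntegral H) (Icc 0 x) := fun hH x hx y hy =>
      (hasDerivAt_angularIntegral hH
        (hab hy.1 (hy.2.trans_lt hx))).continuousAt.continuousWithinAt
    set E : ℕ → ℂ := fun i => (fun v => dZ (dZbar v))^[i] G 0 with hE
    have hfac : ∀ i : ℕ, (i.factorial : ℂ) ≠ 0 := fun i =>
      Nat.cast_ne_zero.2 (Nat.factorial_ne_zero i)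
    have hone : ∀ i : ℕ, (i : ℂ) + 1 ≠ 0 := fun i => by exact_mod_cast Nat.succ_ne_zero i
    have hpow : ∀ (n : ℕ) (x : ℝ), HasDerivAt (fun x : ℝ => (x : ℂ) ^ (n + 1))
        ((n + 1 : ℂ) * (x : ℂ) ^ n) x := fun n x => by
      simpa using (hasDerivAt_pow (n + 1) (x : ℂ)).comp_ofReal
    -- First integration of the recursion: the derivative of `I(radialDeriv G)` is `4x I(∂∂̄G)`,
    -- known by induction, and its value at `0` is zero.
    have hB : ∀ x : ℝ, 0 ≤ x → x < s → angularIntegral (radialDeriv G) x =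
        ∑ i ∈ Finset.range m, (x : ℂ) ^ (2 * i + 1 + 1) *
          (4 * Real.pi / ((i + 1) * (i.factorial : ℂ) ^ 2) * E (i + 1)) := by
      intro x hx hxs
      refine eq_of_hasDerivAt_eq (a := 0) (g := fun x : ℝ => ∑ i ∈ Finset.range m,
        (x : ℂ) ^ (2 * i + 1 + 1) * (4 * Real.pi / ((i + 1) * (i.factorial : ℂ) ^ 2) * E (i + 1)))
        (f' := fun x => 4 * x * angularIntegral (fun w => dZ (dZbar G) w) x) hx ?_
        (hcont hR x hxs) (Continuous.continuousOn (by fun_prop)) ?_ ?_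
      · simp [angularIntegral, radialDeriv]
      · intro y hy
        have hy' := hab hy.1.le (hy.2.trans hxs)
        obtain ⟨D, hD, hD2⟩ := mul_deriv_angularIntegral hR hy'
        refine hD.congr_deriv ?_
        rw [angularIntegral_radialDeriv_radialDeriv hG hy'] at hD2
        have hy0 : (y : ℂ) ≠ 0 := Complex.ofReal_ne_zero.2 hy.1.ne'
        apply mul_left_cancel₀ hy0
        rw [hD2]
        ring
      · intro y hy
        rw [ih' y hy.1.le (hy.2.trans hxs), Finset.mul_sum, Finset.mul_sum]
        refine HasDerivAt.fun_sum fun i _ => ?_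
        refine ((hpow (2 * i + 1) y).mul_const _).congr_deriv ?_
        have h1 := hfac i
        have h2 := hone i
        simp only [hE, Function.iterate_succ_apply]
        push_cast
        field_simp
        ring
    -- Second integration, starting from the value `2π G(0)`; `hB` supplies the derivative after
    -- division by the radius.
    refine eq_of_hasDerivAt_eq (a := 0) (g := fun ρ : ℝ => 2 * Real.pi *
      ∑ i ∈ Finset.range (m + 1), (ρ : ℂ) ^ (2 * i) / (i.factorial : ℂ) ^ 2 * E i)
      (f' := fun x => ∑ i ∈ Finset.range m, (x : ℂ) ^ (2 * i + 1) *
          (4 * Real.pi / ((i + 1) * (i.factorial : ℂ) ^ 2) * E (i + 1)))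
      hρ ?_ (hcont hG ρ hρs) (Continuous.continuousOn (by fun_prop)) ?_ ?_
    · rw [Finset.sum_range_succ']
      simp [angularIntegral, hE]
      left
      ring
    · intro y hy
      have hys := hy.2.trans hρs
      obtain ⟨D, hD, hD2⟩ := mul_deriv_angularIntegral hG (hab hy.1.le hys)
      refine hD.congr_deriv ?_
      have hy0 : (y : ℂ) ≠ 0 := Complex.ofReal_ne_zero.2 hy.1.ne'
      apply mul_left_cancel₀ hy0
      rw [hD2, hB y hy.1.le hys, Finset.mul_sum]
      refine Finset.sum_congr rfl fun i _ => ?_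
      ring
    · intro y hy
      simp only [Finset.sum_range_succ', mul_add (2 * (Real.pi : ℂ)), Finset.mul_sum, mul_zero, pow_zero]
      refine (HasDerivAt.add_const _ (HasDerivAt.fun_sum (A' := fun i => (y : ℂ) ^ (2 * i + 1) *
          (4 * Real.pi / ((i + 1) * (i.factorial : ℂ) ^ 2) * E (i + 1))) fun i _ => ?_))
      have h3 := ((hpow (2 * i + 1) y).mul_const
        (2 * Real.pi / ((i + 1).factorial : ℂ) ^ 2 * E (i + 1)))
      have h4 : (fun x : ℝ => 2 * (Real.pi : ℂ) * ((x : ℂ) ^ (2 * (i + 1)) /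
          ((i + 1).factorial : ℂ) ^ 2 * E (i + 1))) = fun x : ℝ => (x : ℂ) ^ (2 * i + 1 + 1) *
            (2 * Real.pi / ((i + 1).factorial : ℂ) ^ 2 * E (i + 1)) := by
        funext x
        rw [show 2 * (i + 1) = 2 * i + 1 + 1 by ring]
        ring
      rw [h4]
      refine h3.congr_deriv ?_
      have h1 := hfac i
      have h2 := hone i
      rw [Nat.factorial_succ]
      push_cast
      field_simp
      ring

/-- **Pizzetti's formula** for discs. -/
theorem setIntegral_ball_of_polyharmonic (m : ℕ)
    (hG : ∀ w ∈ Metric.ball (0 : ℂ) s, ContDiffAt ℝ ∞ G w)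
    (h0 : ∀ w ∈ Metric.ball (0 : ℂ) s, (fun v => dZ (dZbar v))^[m] G w = 0)
    {r : ℝ} (hr : 0 ≤ r) (hrs : r < s) :
    ∫ w in Metric.ball (0 : ℂ) r, G w = 2 * Real.pi * ∑ i ∈ Finset.range m,
      (r : ℂ) ^ (2 * i + 2) / (2 * (i + 1) * (i.factorial : ℂ) ^ 2) *
        (fun v => dZ (dZbar v))^[i] G 0 := by
  have hGc := continuousOn_ball_of_contDiffAt hG
  have hpolar : ∫ w in Metric.ball (0 : ℂ) r, G w =
      ∫ x in Ioo 0 r ×ˢ Ioo (-Real.pi) Real.pi, (x.1 : ℂ) * G (circleMap 0 x.1 x.2) := by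
    rw [← integral_indicator Metric.isOpen_ball.measurableSet, ← Complex.integral_comp_polarCoord_symm,
      ← integral_indicator (measurableSet_Ioo.prod measurableSet_Ioo),
      ← integral_indicator (by exact measurableSet_Ioi.prod measurableSet_Ioo)]
    congr 1
    funext x
    have hx : Complex.polarCoord.symm x = circleMap 0 x.1 x.2 := by
      rw [Complex.polarCoord_symm_apply, circleMap_zero, Complex.exp_mul_I, Complex.ofReal_cos,
        Complex.ofReal_sin]
    simp only [indicator, mem_prod, mem_Ioo, hx, Complex.real_smul, Metric.mem_ball, dist_zero_right,
      norm_circleMap_zero]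
    by_cases h1 : 0 < x.1
    · simp only [h1, true_and, abs_of_pos h1]
      split_ifs <;> simp_all
    · simp [h1]
  have hint : IntegrableOn (fun x : ℝ × ℝ => (x.1 : ℂ) * G (circleMap 0 x.1 x.2))
      (Ioo 0 r ×ˢ Ioo (-Real.pi) Real.pi) := by
    have hc : ContinuousOn (fun x : ℝ × ℝ => (x.1 : ℂ) * G (circleMap 0 x.1 x.2))
        (Icc 0 r ×ˢ Icc (-Real.pi) Real.pi) := by
      refine ContinuousOn.mul (by fun_prop) (hGc.comp ?_ ?_)
      · simp only [circleMap_zero]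
        fun_prop
      · intro x hx
        apply circleMap_zero_mem_ball
        rw [abs_of_nonneg hx.1.1]
        exact hx.1.2.trans_lt hrs
    exact (hc.integrableOn_compact (isCompact_Icc.prod isCompact_Icc)).mono_set
      (prod_mono Ioo_subset_Icc_self Ioo_subset_Icc_self)
  have hpow : ∀ n : ℕ, ∫ x in (0 : ℝ)..r, (x : ℂ) ^ n = (r : ℂ) ^ (n + 1) / (n + 1) := by
    intro n
    have := integral_pow (a := 0) (b := r) n
    have h2 := congrArg (fun x : ℝ => (x : ℂ)) this
    simp only [← intervalIntegral.integral_ofReal] at h2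
    push_cast at h2
    rw [h2]
    simp
  rw [hpolar, Measure.volume_eq_prod, setIntegral_prod _ (by rwa [← Measure.volume_eq_prod])]
  have h1 : ∀ x ∈ Ioo 0 r, ∫ θ in Ioo (-Real.pi) Real.pi, (x : ℂ) * G (circleMap 0 x θ) =
      ∑ i ∈ Finset.range m, (2 * Real.pi / (i.factorial : ℂ) ^ 2 *
        (fun v => dZ (dZbar v))^[i] G 0) * (x : ℂ) ^ (2 * i + 1) := by
    intro x hx
    rw [integral_const_mul, ← integral_Ioc_eq_integral_Ioo,
      ← intervalIntegral.integral_of_le (by linarith [Real.pi_pos])]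
    have := angularIntegral_eq_of_polyharmonic m hG h0 x hx.1.le (hx.2.trans hrs)
    rw [angularIntegral] at this
    rw [this, Finset.mul_sum, Finset.mul_sum]
    refine Finset.sum_congr rfl fun i _ => ?_
    ring
  rw [setIntegral_congr_fun measurableSet_Ioo h1, ← integral_Ioc_eq_integral_Ioo,
    ← intervalIntegral.integral_of_le hr, intervalIntegral.integral_finsetSum, Finset.mul_sum]
  · refine Finset.sum_congr rfl fun i _ => ?_
    rw [intervalIntegral.integral_const_mul, hpow]
    have : (i : ℂ) + 1 ≠ 0 := by exact_mod_cast Nat.succ_ne_zero i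
    have h2 : (i.factorial : ℂ) ≠ 0 := Nat.cast_ne_zero.2 (Nat.factorial_ne_zero i)
    push_cast
    have h3 : (2 * (i : ℂ) + 1 + 1) ≠ 0 := by
      rw [show (2 * (i : ℂ) + 1 + 1) = 2 * (i + 1) by ring]
      exact mul_ne_zero two_ne_zero this
    field_simp
    ring
  · intro i _
    exact Continuous.intervalIntegrable (by fun_prop) _ _

end Pizzetti

/-! ### Univalent polynomials -/

section Univalent

open Polynomial Set

/-- At a critical point `F` would be an `m`-th power, `m ≥ 2`, of a local coordinate, up to
constants, and rotating that coordinate by a root of unity gives two points with the same image. -/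
theorem derivative_eval_ne_zero_of_injOn {F : ℂ[X]} {U : Set ℂ} (hU : IsOpen U)
    (hF : InjOn (fun w => F.eval w) U) {w₀ : ℂ} (hw : w₀ ∈ U) : F.derivative.eval w₀ ≠ 0 := by
  intro hd
  have hFc : F - C (F.eval w₀) ≠ 0 := by
    intro h0
    have hc : ∀ w, F.eval w = F.eval w₀ := fun w => by
      have := congrArg (Polynomial.eval w) h0
      simpa [sub_eq_zero] using this
    have hne : U ∈ 𝓝 w₀ := hU.mem_nhds hw
    have hlim := (NormedField.nhdsNE_neBot w₀).nonempty_of_mem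
      (inter_mem (mem_nhdsWithin_of_mem_nhds hne) self_mem_nhdsWithin)
    obtain ⟨y, hy, hy2⟩ := hlim
    exact hy2 (hF hy hw (hc y))
  obtain ⟨g, hg, hgd⟩ := exists_eq_pow_rootMultiplicity_mul_and_not_dvd _ hFc w₀
  set m := rootMultiplicity w₀ (F - C (F.eval w₀)) with hm
  have hg0 : g.eval w₀ ≠ 0 := fun h => hgd (dvd_iff_isRoot.2 h)
  have hm2 : 2 ≤ m := by
    have : 1 < m := one_lt_rootMultiplicity_iff_isRoot hFc |>.2 ⟨by simp, by simpa using hd⟩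
    exact this
  have hFm : ∀ w, F.eval w - F.eval w₀ = (w - w₀) ^ m * g.eval w := fun w => by
    have := congrArg (Polynomial.eval w) hg
    simpa using this
  -- The principal root is smooth near `w₀` because its argument is `1` there.
  set h : ℂ → ℂ := fun w => (w - w₀) * (g.eval w / g.eval w₀) ^ ((m : ℂ)⁻¹) with hh
  have hpow : ∀ w, h w ^ m * g.eval w₀ = F.eval w - F.eval w₀ := fun w => by
    rw [hh, hFm]
    simp only
    rw [mul_pow, Complex.cpow_nat_inv_pow _ (by omega)]
    field_simp
  have hder : HasStrictDerivAt h 1 w₀ := by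
    have h1 : HasStrictDerivAt (fun w => g.eval w / g.eval w₀)
        (g.derivative.eval w₀ / g.eval w₀) w₀ := (g.hasStrictDerivAt w₀).div_const _
    have h2 := h1.cpow (hasStrictDerivAt_const w₀ ((m : ℂ)⁻¹)) (by simp [hg0])
    have h3 : HasStrictDerivAt (fun w => w - w₀) 1 w₀ := (hasStrictDerivAt_id w₀).sub_const w₀
    refine (h3.fun_mul h2).congr_deriv ?_
    simp [hg0]
  have hmap := hder.map_nhds_eq one_ne_zero
  have h00 : h w₀ = 0 := by simp [hh]
  rw [h00] at hmap
  have himg : h '' U ∈ 𝓝 (0 : ℂ) := hmap ▸ image_mem_map (hU.mem_nhds hw)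
  obtain ⟨ζ, hζ⟩ : ∃ ζ : ℂ, IsPrimitiveRoot ζ m := ⟨_, Complex.isPrimitiveRoot_exp m (by omega)⟩
  have himg2 : ∀ᶠ y in 𝓝 (0 : ℂ), ζ * y ∈ h '' U := by
    have : Tendsto (fun y : ℂ => ζ * y) (𝓝 0) (𝓝 (ζ * 0)) := (continuous_const_mul ζ).tendsto 0
    rw [mul_zero] at this
    exact this himg
  obtain ⟨y, ⟨⟨w1, hw1, e1⟩, ⟨w2, hw2, e2⟩⟩, hy0⟩ := (NormedField.nhdsNE_neBot (0 : ℂ)).nonempty_of_mem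
    (inter_mem (mem_nhdsWithin_of_mem_nhds (inter_mem himg himg2)) self_mem_nhdsWithin)
  have e : F.eval w1 = F.eval w2 := by
    have k1 := hpow w1
    have k2 := hpow w2
    rw [e1] at k1
    rw [e2, mul_pow, hζ.pow_eq_one, one_mul, k1] at k2
    exact sub_left_injective k2
  have e3 := hF hw1 hw2 e
  rw [← e3, e1] at e2
  have : ζ = 1 := by
    have : (ζ - 1) * y = 0 := by rw [sub_mul, ← e2]; ring
    rcases mul_eq_zero.1 this with h | h
    · exact sub_eq_zero.1 h
    · exact absurd h hy0
  exact hζ.ne_one (by omega) this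

theorem natDegree_pos_of_injOn {F : ℂ[X]} {U : Set ℂ} (hU : IsOpen U)
    (hF : InjOn (fun w => F.eval w) U) (hne : U.Nonempty) : 1 ≤ F.natDegree := by
  obtain ⟨w, hw⟩ := hne
  have h := derivative_eval_ne_zero_of_injOn hU hF hw
  by_contra h0
  rw [eq_C_of_natDegree_eq_zero (p := F) (by omega)] at h
  simp at h

theorem hasFDerivAt_eval (F : ℂ[X]) (w : ℂ) : HasFDerivAt (fun w => F.eval w)
    (((ContinuousLinearMap.mul ℂ ℂ) (F.derivative.eval w)).restrictScalars ℝ) w := by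
  refine ((F.hasDerivAt w).hasFDerivAt.restrictScalars ℝ).congr_fderiv ?_
  ext
  simp [mul_comm]

theorem det_mul_restrictScalars (a : ℂ) :
    (((ContinuousLinearMap.mul ℂ ℂ) a).restrictScalars ℝ).det = Complex.normSq a := by
  rw [← Algebra.norm_complex_apply, Algebra.norm_apply]
  rfl

open MeasureTheory in
/-- Change of variables under a univalent polynomial. -/
theorem setIntegral_image_eval {E : Type*} [NormedAddCommGroup E] [NormedSpace ℝ E] {F : ℂ[X]}
    {A : Set ℂ} (hA : MeasurableSet A) (hF : InjOn (fun w => F.eval w) A) (g : ℂ → E) :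
    ∫ z in (fun w => F.eval w) '' A, g z =
      ∫ w in A, Complex.normSq (F.derivative.eval w) • g (F.eval w) := by
  rw [integral_image_eq_integral_abs_det_fderiv_smul volume hA
    (fun w _ => (hasFDerivAt_eval F w).hasFDerivWithinAt) hF]
  simp only [det_mul_restrictScalars, abs_of_nonneg (Complex.normSq_nonneg _)]

end Univalent

/-! ### Regular solutions in the medium of an Adler–Moser chain -/

section Medium

open Polynomial Set

theorem divGrad_eq {σ : ℂ → ℝ} {φ : ℂ → ℂ} {z : ℂ} (hσ : DifferentiableAt ℝ (fun w => (σ w : ℂ)) z)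
    (hφ : ContDiffAt ℝ ∞ φ z) : divGrad σ φ z =
      2 * (dZbar (fun w => (σ w : ℂ)) z * dZ φ z + dZ (fun w => (σ w : ℂ)) z * dZbar φ z) +
        4 * (σ z * dZ (dZbar φ) z) := by
  have hX : ∀ f w, dX f w = dZ f w + dZbar f w := fun f w => by
    simp only [dZ, dZbar]
    ring
  have hY : ∀ f w, dY f w = Complex.I * dZ f w + -Complex.I * dZbar f w := fun f w => by
    simp only [dZ, dZbar]
    linear_combination (dY f w) * Complex.I_mul_I
  have hz := hφ.dZ.differentiableAt (by simp)
  have hb := hφ.dZbar.differentiableAt (by simp)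
  have hcomm : dZbar (dZ φ) z = dZ (dZbar φ) z := by
    rw [dZ_eq_wirtinger]
    exact (wirtinger_comm_eventually hφ _ _).self_of_nhds
  have key : ∀ a b c : ℂ, wirtinger c (fun w => (σ w : ℂ) * (a * dZ φ w + b * dZbar φ w)) z =
      wirtinger c (fun w => (σ w : ℂ)) z * (a * dZ φ z + b * dZbar φ z) +
        σ z * (a * wirtinger c (dZ φ) z + b * wirtinger c (dZbar φ) z) := by
    intro a b c
    have h := wirtinger_mul hσ ((hz.const_mul a).fun_add (hb.const_mul b)) c
    rwa [wirtinger_add (hz.const_mul a) (hb.const_mul b), wirtinger_const_mul hz,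
      wirtinger_const_mul hb] at h
  have k1 := key 1 1 (-Complex.I)
  have k2 := key 1 1 Complex.I
  have k3 := key Complex.I (-Complex.I) (-Complex.I)
  have k4 := key Complex.I (-Complex.I) Complex.I
  rw [← dZ_eq_wirtinger] at k1 k3
  rw [← dZbar_eq_wirtinger, hcomm] at k2 k4
  simp only [one_mul] at k1 k2
  simp only [divGrad, hX (fun w => _ * _), hY (fun w => _ * _)]
  simp only [hX φ, hY φ]
  rw [k1, k2, k3, k4]
  linear_combination ((dZ (fun w => (σ w : ℂ)) z * (dZ φ z - dZbar φ z)
    + σ z * (dZ (dZ φ) z - dZ (dZbar φ) z)) - (dZbar (fun w => (σ w : ℂ)) z * (dZ φ z - dZbar φ z)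
    + σ z * (dZ (dZbar φ) z - dZbar (dZbar φ) z))) * Complex.I_mul_I

variable {p : ℕ → ℝ[X]}

theorem eval_map_ofReal (P : ℝ[X]) (x : ℝ) :
    (P.map Complex.ofRealHom).eval (x : ℂ) = ((P.eval x : ℝ) : ℂ) := by
  rw [eval_map]
  exact eval₂_at_apply Complex.ofRealHom x

theorem conj_eval_map_ofReal (P : ℝ[X]) (x : ℝ) :
    conj ((P.map Complex.ofRealHom).eval (x : ℂ)) = (P.map Complex.ofRealHom).eval (x : ℂ) := by
  rw [eval_map_ofReal, Complex.conj_ofReal]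

theorem conj_logDerivHalf_map_ofReal (P Q : ℝ[X]) (z : ℂ) :
    conj (logDerivHalf (P.map Complex.ofRealHom) (Q.map Complex.ofRealHom) z) =
      logDerivHalf (P.map Complex.ofRealHom) (Q.map Complex.ofRealHom) z := by
  simp only [logDerivHalf, map_div₀, map_sub, derivative_map, conj_eval_map_ofReal, map_ofNat]

theorem IsAdlerMoser.isComplexChain (hp : IsAdlerMoser p) :
    IsComplexChain fun m => (p m).map Complex.ofRealHom := by
  refine ⟨by simp [hp.1], fun n => ?_, fun n => ?_⟩
  · rw [natDegree_map_eq_of_injective Complex.ofRealHom.injective]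
    exact hp.2.1 n
  · have := congrArg (Polynomial.map Complex.ofRealHom) (hp.2.2 n)
    simp only [Polynomial.map_add, Polynomial.map_sub, Polynomial.map_mul, Polynomial.map_ofNat,
      Polynomial.map_zero] at this
    simpa only [_root_.hirota, derivative_map] using this

theorem ofReal_porosity (n : ℕ) (S : ℝ[X]) (z : ℂ) : (porosity p n S z : ℂ) =
    (S.map Complex.ofRealHom * (p (n - 1)).map Complex.ofRealHom).eval (z.re : ℂ) := by
  rw [eval_mul, eval_map_ofReal, eval_map_ofReal, porosity]
  push_cast
  ring

/-- If any of the three factors vanished, the conventions for inverses and quotients at zero would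
make the permeability zero. -/
theorem eval_ne_zero_of_permeability_pos {n : ℕ} {S : ℝ[X]} {z : ℂ}
    (hκ : 0 < permeability p n S z) : (p n).eval z.re ≠ 0 ∧ (p (n - 1)).eval z.re ≠ 0 ∧
      S.eval z.re ≠ 0 := by
  refine ⟨?_, ?_, ?_⟩ <;> intro h <;> simp [permeability, xi, porosity, h] at hκ

/-- Where the factors do not vanish, `κη = (p_{n-1}/p_n)²`, and its logarithmic derivative in `x` is
`-4` times `ξ'/(2ξ)`. -/
theorem IsRegularSolution.isGermSolution {n : ℕ} {S : ℝ[X]} {U : Set ℂ} (hU : IsOpen U) {φ : ℂ → ℂ}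
    (hφ : IsRegularSolution (permeability p n S) (porosity p n S) U φ) {z : ℂ} (hz : z ∈ U)
    (hκ : 0 < permeability p n S z) :
    IsGermSolution
      (logDerivHalf ((p n).map Complex.ofRealHom) ((p (n - 1)).map Complex.ofRealHom))
      (logDerivHalf ((p n).map Complex.ofRealHom) ((p (n - 1)).map Complex.ofRealHom)) z φ := by
  have hsm : ∀ y ∈ U, ContDiffAt ℝ ∞ φ y := fun y hy => hφ.1.contDiffAt (hU.mem_nhds hy)
  refine ⟨hsm z hz, ?_⟩
  obtain ⟨h1, h2, h3⟩ := eval_ne_zero_of_permeability_pos hκ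
  have hne : ∀ P : ℝ[X], P.eval z.re ≠ 0 → ∀ᶠ y : ℂ in 𝓝 z, P.eval y.re ≠ 0 := fun P hP =>
    (P.continuous.comp Complex.continuous_re).continuousAt.eventually_ne hP
  set P := (p n).map Complex.ofRealHom with hP
  set R := (p (n - 1)).map Complex.ofRealHom with hR
  have hσ : ∀ y : ℂ, (p n).eval y.re ≠ 0 → (p (n - 1)).eval y.re ≠ 0 → S.eval y.re ≠ 0 →
      ((permeability p n S y * porosity p n S y : ℝ) : ℂ) =
        (R.eval (y.re : ℂ) / P.eval (y.re : ℂ)) ^ 2 := by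
    intro y h1 h2 h3
    rw [permeability_mul_porosity _ _ _ _ (mul_ne_zero h2 h3), xi, hP, hR, eval_map_ofReal,
      eval_map_ofReal, ← inv_pow, inv_div]
    push_cast
    rfl
  have hev : ∀ᶠ y in 𝓝 z, (p n).eval y.re ≠ 0 ∧ (p (n - 1)).eval y.re ≠ 0 ∧ S.eval y.re ≠ 0 :=
    (hne _ h1).and ((hne _ h2).and (hne _ h3))
  filter_upwards [hev.eventually_nhds, hU.mem_nhds hz] with y hy hyU
  obtain ⟨g1, g2, g3⟩ := hy.self_of_nhds
  have heq : (fun w => ((permeability p n S w * porosity p n S w : ℝ) : ℂ)) =ᶠ[𝓝 y]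
      fun w => (R.eval (w.re : ℂ) / P.eval (w.re : ℂ)) ^ 2 := by
    filter_upwards [hy] with w hw
    exact hσ w hw.1 hw.2.1 hw.2.2
  have c1 : P.eval (y.re : ℂ) ≠ 0 := by
    rw [hP, eval_map_ofReal]
    exact Complex.ofReal_ne_zero.2 g1
  have c2 : R.eval (y.re : ℂ) ≠ 0 := by
    rw [hR, eval_map_ofReal]
    exact Complex.ofReal_ne_zero.2 g2
  have hder : HasDerivAt (fun x : ℝ => (R.eval (x : ℂ) / P.eval (x : ℂ)) ^ 2)
      (-(4 * logDerivHalf P R y * (R.eval (y.re : ℂ) / P.eval (y.re : ℂ)) ^ 2)) y.re := by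
    have e1 := (R.hasDerivAt (y.re : ℂ)).comp_ofReal
    have e2 := (P.hasDerivAt (y.re : ℂ)).comp_ofReal
    refine ((e1.fun_div e2 c1).fun_pow 2).congr_deriv ?_
    simp only [logDerivHalf, show 2 - 1 = 1 from rfl, pow_one]
    generalize P.eval (y.re : ℂ) = a at c1 ⊢
    generalize R.eval (y.re : ℂ) = b at c2 ⊢
    field_simp
    push_cast
    ring
  have hdiff : DifferentiableAt ℝ (fun w =>
      ((permeability p n S w * porosity p n S w : ℝ) : ℂ)) y :=
    hder.hasFDerivAt_re.differentiableAt.congr_of_eventuallyEq heq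
  have h0 := hφ.2 y hyU
  rw [divGrad_eq hdiff (hsm y hyU), (dZ_congr heq).self_of_nhds, (dZbar_congr heq).self_of_nhds,
    hder.dZ_re, hder.dZbar_re, hσ y g1 g2 g3] at h0
  have c3 : (4 : ℂ) * (R.eval (y.re : ℂ) / P.eval (y.re : ℂ)) ^ 2 ≠ 0 :=
    mul_ne_zero (by norm_num) (pow_ne_zero _ (div_ne_zero c2 c1))
  apply mul_left_cancel₀ c3
  linear_combination h0

end Medium

/-! ### The fluxes -/

section Fluxes

open Polynomial Set MeasureTheory

theorem multipole_sum {ι : Type*} (t : Finset ι) (z₁ : ℂ) (k : ℕ) (c : ι → ℝ) (a : ι → ℝ)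
    (A : ι → ℕ → ℂ) (φ : ℂ → ℂ) :
    multipole z₁ k (∑ i ∈ t, c i * a i) (fun j => ∑ i ∈ t, (c i : ℂ) * A i j) φ =
      ∑ i ∈ t, (c i : ℂ) * multipole z₁ k (a i) (A i) φ := by
  simp only [multipole, mul_add, Finset.sum_add_distrib, Finset.mul_sum, map_sum, map_mul,
    Complex.conj_ofReal, Finset.sum_mul, Complex.ofReal_sum, Complex.ofReal_mul]
  rw [Finset.sum_comm (s := Finset.Icc 1 k), Finset.sum_comm (s := Finset.Icc 1 k)]
  simp only [mul_assoc]

theorem multipole_const_mul (z₁ : ℂ) (k : ℕ) (c : ℝ) (a : ℝ) (A : ℕ → ℂ) (φ : ℂ → ℂ) :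
    multipole z₁ k (c * a) (fun j => (c : ℂ) * A j) φ = (c : ℂ) * multipole z₁ k a A φ := by
  simpa using multipole_sum {()} z₁ k (fun _ => c) (fun _ => a) (fun _ => A) φ

/-- A multipole functional applied to a function whose derivatives of order less than `k`,
and anti-holomorphic derivatives of order `k`, vanish. -/
theorem multipole_eq_of_jetVanish {z₁ : ℂ} {m : ℕ} (Q : ℝ) (Qm : ℕ → ℂ) {φ : ℂ → ℂ}
    (h : JetVanish m (m + 1) φ z₁) :
    multipole z₁ (m + 1) Q Qm φ = Qm (m + 1) * mixedDeriv (m + 1) 0 φ z₁ := by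
  have h0 : ∀ j ≤ m + 1, dZbar^[j] φ z₁ = 0 := fun j hj => h 0 (by omega) j hj
  have h1 : ∀ j ≤ m, dZ^[j] φ z₁ = 0 := fun j hj => h j hj 0 (by omega)
  rw [multipole, show φ z₁ = 0 from h0 0 (by omega), mul_zero, zero_add,
    Finset.sum_eq_single (m + 1)]
  · rw [h0 _ le_rfl, mul_zero, add_zero]
    rfl
  · intro j hj hne
    have := Finset.mem_Icc.1 hj
    rw [h0 j this.2, h1 j (by omega), mul_zero, mul_zero, add_zero]
  · intro h
    exact absurd (Finset.mem_Icc.2 ⟨by omega, le_rfl⟩) h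

variable {p : ℕ → ℝ[X]}

/-- The weights of the iterated Laplacians in the mean value formula on discs. -/
noncomputable def pizzettiWeight (i : ℕ) : ℝ := 1 / (2 * (i + 1) * (i.factorial : ℝ) ^ 2)

theorem pizzettiWeight_ne_zero (i : ℕ) : pizzettiWeight i ≠ 0 := by
  unfold pizzettiWeight
  positivity

theorem setIntegral_image_porosity {n : ℕ} (S : ℝ[X]) {F : ℂ[X]} {r : ℝ}
    (hF : InjOn (fun w => F.eval w) (Metric.ball (0 : ℂ) r)) (φ : ℂ → ℂ) :
    ∫ z in (fun w => F.eval w) '' Metric.ball (0 : ℂ) r, (porosity p n S z : ℂ) * φ z =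
      ∫ w in Metric.ball (0 : ℂ) r, pullback
        (S.map Complex.ofRealHom * (p (n - 1)).map Complex.ofRealHom) F φ w := by
  rw [setIntegral_image_eval Metric.isOpen_ball.measurableSet hF]
  congr 1
  funext w
  rw [pullback, ofReal_porosity, Complex.mul_conj, Complex.real_smul]
  ring

/-- The fluxes: coefficients `aᵢ`, `Aᵢⱼ` such that the integrals over the images of discs are
multipole functionals. -/
theorem IsAdlerMoser.exists_fluxes (hp : IsAdlerMoser p) {n : ℕ} (hn : 1 ≤ n) {S : ℝ[X]} {F : ℂ[X]}
    (hF : InjOn (fun w => F.eval w) (Metric.ball (0 : ℂ) 1))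
    (hκ : ∀ w ∈ Metric.ball (0 : ℂ) 1, 0 < permeability p n S (F.eval w))
    {k : ℕ} (hk : k + 1 = (S.natDegree + n * (n + 1) / 2 + 1) * F.natDegree) :
    ∃ (a : ℕ → ℝ) (A : ℕ → ℕ → ℂ), ∑ i ∈ Finset.range (k + 1), A i k ≠ 0 ∧
      ∀ r s : ℝ, 0 ≤ r → r < s → s ≤ 1 → ∀ (U : Set ℂ) (φ : ℂ → ℂ), IsOpen U →
        (fun w => F.eval w) '' Metric.ball (0 : ℂ) s ⊆ U →
        IsRegularSolution (permeability p n S) (porosity p n S) U φ →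
        ∫ z in (fun w => F.eval w) '' Metric.ball (0 : ℂ) r, (porosity p n S z : ℂ) * φ z =
          2 * Real.pi * ∑ i ∈ Finset.range (k + 1),
            (r : ℂ) ^ (2 * i + 2) * multipole (F.eval 0) k (a i) (A i) φ := by
  have h0 : (0 : ℂ) ∈ Metric.ball (0 : ℂ) 1 := by simp
  have hFd := natDegree_pos_of_injOn Metric.isOpen_ball hF ⟨0, h0⟩
  have hF' := fun w hw => derivative_eval_ne_zero_of_injOn Metric.isOpen_ball hF (w₀ := w) hw
  have hchain := hp.isComplexChain
  obtain ⟨b, hb, hbn, hb0, hbd⟩ := hchain.exists_dressing n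
  have hdegP := hchain.natDegree n
  have hP0 := hchain.ne_zero n
  have hirota_eq : hirota ((p n).map Complex.ofRealHom) ((p (n - 1)).map Complex.ofRealHom) = 0 := by
    have := hchain.hirota (n - 1)
    rw [Nat.sub_add_cancel hn, hirota_comm] at this
    exact this
  have hne := fun w hw => eval_ne_zero_of_permeability_pos (hκ w hw)
  have hPw : ∀ w ∈ Metric.ball (0 : ℂ) 1,
      ((p n).map Complex.ofRealHom).eval ((F.eval w).re : ℂ) ≠ 0 := fun w hw => by
    rw [eval_map_ofReal]
    exact Complex.ofReal_ne_zero.2 (hne w hw).1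
  have hQw : ∀ w ∈ Metric.ball (0 : ℂ) 1,
      ((p (n - 1)).map Complex.ofRealHom).eval ((F.eval w).re : ℂ) ≠ 0 := fun w hw => by
    rw [eval_map_ofReal]
    exact Complex.ofReal_ne_zero.2 (hne w hw).2.1
  have hS0 : S.map Complex.ofRealHom ≠ 0 := by
    rw [Polynomial.map_ne_zero_iff Complex.ofRealHom.injective]
    rintro rfl
    exact (hne 0 h0).2.2 (by simp)
  have hSd : (S.map Complex.ofRealHom).natDegree = S.natDegree :=
    natDegree_map_eq_of_injective Complex.ofRealHom.injective S
  have hreal := conj_logDerivHalf_map_ofReal (p n) (p (n - 1))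
  have hcreal : ∀ x : ℝ, conj ((S.map Complex.ofRealHom * (p (n - 1)).map Complex.ofRealHom).eval
      (x : ℂ)) = (S.map Complex.ofRealHom * (p (n - 1)).map Complex.ofRealHom).eval (x : ℂ) := by
    intro x
    rw [eval_mul, map_mul, conj_eval_map_ofReal, conj_eval_map_ofReal]
  set P := (p n).map Complex.ofRealHom
  set R := (p (n - 1)).map Complex.ofRealHom
  set s := S.map Complex.ofRealHom
  have hsol : ∀ r ≤ 1, ∀ {U φ}, IsOpen U → (fun w => F.eval w) '' Metric.ball (0 : ℂ) r ⊆ U →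
      IsRegularSolution (permeability p n S) (porosity p n S) U φ →
      ∀ w ∈ Metric.ball (0 : ℂ) r,
        IsGermSolution (logDerivHalf P R) (logDerivHalf P R) (F.eval w) φ :=
    fun r hr U φ hU hrU hφ w hw => hφ.isGermSolution hU (hrU (mem_image_of_mem _ hw))
      (hκ w (Metric.ball_subset_ball hr hw))
  -- The bound for `b_j` is largest at `j = n`, where it equals `deg p_n`.
  have hK : ∀ j ≤ n, ((s * b j).natDegree + 1) * F.natDegree ≤ k + 1 := by
    intro j hj
    rw [hk]
    refine Nat.mul_le_mul_right _ ?_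
    have h1 := natDegree_mul_le (p := s) (q := b j)
    have h2 := hbd j
    omega
  have hex := fun i : Fin (k + 1) => exists_multipole
    (contDiffAt_logDerivHalf (hPw 0 h0) (hQw 0 h0)) hreal hcreal (F := F) (w := 0)
    (m := i) (k := k) (Nat.lt_succ_iff.1 i.2)
  choose a A haA using hex
  let a' : ℕ → ℝ := fun i => if h : i < k + 1 then pizzettiWeight i * a ⟨i, h⟩ else 0
  let A' : ℕ → ℕ → ℂ := fun i j => if h : i < k + 1 then (pizzettiWeight i : ℂ) * A ⟨i, h⟩ j else 0
  have hmult : ∀ i < k + 1, ∀ u, IsGermSolution (logDerivHalf P R) (logDerivHalf P R) (F.eval 0) u →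
      (pizzettiWeight i : ℂ) * mixedDeriv i i (pullback (s * R) F u) 0 =
        multipole (F.eval 0) k (a' i) (A' i) u := by
    intro i hi u hu
    have h1 : A' i = fun j => (pizzettiWeight i : ℂ) * A ⟨i, hi⟩ j := by
      funext j
      simp only [A', hi, dif_pos]
    rw [h1, show a' i = pizzettiWeight i * a ⟨i, hi⟩ by simp only [a', hi, dif_pos],
      multipole_const_mul, haA ⟨i, hi⟩ u hu]
  refine ⟨a', A', ?_, ?_⟩
  -- The hypothesis `n ≥ 1` makes `k` positive, so that the coefficient of `∂ᵏ` is separate from the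
  -- real flux.
  · obtain ⟨m, rfl⟩ : ∃ m, k = m + 1 := by
      refine ⟨k - 1, ?_⟩
      have h1 : 1 ≤ n * (n + 1) / 2 := by
        rw [Nat.one_le_div_iff two_pos]
        nlinarith
      have h2 : 2 * 1 ≤ (S.natDegree + n * (n + 1) / 2 + 1) * F.natDegree :=
        Nat.mul_le_mul (by omega) hFd
      omega
    set τ := testSolution R n b ((X - C (F.eval 0)) ^ (n + (m + 1)))
    have hτ : IsGermSolution (logDerivHalf P R) (logDerivHalf P R) (F.eval 0) τ :=
      hb.isGermSolution hirota_eq (hb0 _ (Nat.lt_succ_self n)) _ (hPw 0 h0) (hQw 0 h0)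
    have hv : JetVanish m (m + 1) τ (F.eval 0) := jetVanish_testSolution (hQw 0 h0) n b m (m + 1)
    have hval : ∀ i < m + 1 + 1, (pizzettiWeight i : ℂ) * mixedDeriv i i (pullback (s * R) F τ) 0 =
        A' i (m + 1) * mixedDeriv (m + 1) 0 τ (F.eval 0) := fun i hi => by
      rw [hmult i hi τ hτ, multipole_eq_of_jetVanish _ _ hv]
    -- On `τ` the multipoles read off the coefficients of `∂ᵏ`, and all iterated Laplacians of order
    -- below `k` vanish; the sum collapses to the one nonzero top term.
    have hsum : (∑ i ∈ Finset.range (m + 1 + 1), A' i (m + 1)) * mixedDeriv (m + 1) 0 τ (F.eval 0) =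
        (pizzettiWeight (m + 1) : ℂ) * mixedDeriv (m + 1) (m + 1) (pullback (s * R) F τ) 0 := by
      rw [Finset.sum_mul, Finset.sum_congr rfl fun i hi => (hval i (Finset.mem_range.1 hi)).symm,
        Finset.sum_range_succ, Finset.sum_eq_zero, zero_add]
      intro i hi
      rw [mixedDeriv_pullback_testSolution_of_lt s R n b F (hQw 0 h0) (Finset.mem_range.1 hi),
        mul_zero]
    intro hzero
    rw [hzero, zero_mul] at hsum
    refine mul_ne_zero (Complex.ofReal_ne_zero.2 (pizzettiWeight_ne_zero (m + 1)))
      (mixedDeriv_pullback_testSolution_ne_zero s R n b F (hQw 0 h0) ?_ ?_ (hF' 0 h0)) hsum.symm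
    · rw [hbn]
      exact mul_ne_zero hS0 hP0
    · rw [hbn, natDegree_mul hS0 hP0, hSd, hdegP, hk]
  · intro r t hr hrt ht U φ hU hrU hφ
    have hg := hsol t ht hU hrU hφ
    have hsm : ∀ w ∈ Metric.ball (0 : ℂ) t, ContDiffAt ℝ ∞ (pullback (s * R) F φ) w :=
      fun w hw => contDiffAt_pullback (hg w hw).1
    have hpoly : ∀ w ∈ Metric.ball (0 : ℂ) t,
        (fun v => dZ (dZbar v))^[k + 1] (pullback (s * R) F φ) w = 0 := by
      intro w hw
      have hw1 := Metric.ball_subset_ball ht hw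
      rw [(iterate_dZ_dZbar_eq (hsm w hw) (k + 1)).self_of_nhds]
      exact (hg w hw).mixedDeriv_pullback_eq_zero_of_natDegree hb hirota_eq
        (hb0 _ (Nat.lt_succ_self n)) hbn (hPw w hw1) (hQw w hw1) hreal hcreal hFd hK
    have h0t : (0 : ℂ) ∈ Metric.ball (0 : ℂ) t := by simpa using hr.trans_lt hrt
    rw [setIntegral_image_porosity S (hF.mono (Metric.ball_subset_ball (hrt.le.trans ht))),
      setIntegral_ball_of_polyharmonic (k + 1) hsm hpoly hr hrt]
    congr 1
    refine Finset.sum_congr rfl fun i hi => ?_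
    rw [(iterate_dZ_dZbar_eq (hsm 0 h0t) i).self_of_nhds,
      ← hmult i (Finset.mem_range.1 hi) φ (hg 0 h0t), pizzettiWeight]
    push_cast
    ring

end Fluxes

/-! ### Growth of the images of discs -/

section Growth

open Polynomial Set MeasureTheory

variable {F : ℂ[X]}

theorem isSimplyConnected_image_eval (hF : InjOn (fun w => F.eval w) (Metric.ball (0 : ℂ) 1))
    {t : ℝ} (ht : 0 < t) (ht1 : t ≤ 1) :
    IsSimplyConnected ((fun w => F.eval w) '' Metric.ball (0 : ℂ) t) := by
  have h0 : (0 : ℂ) ∈ Metric.ball (0 : ℂ) 1 := by simp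
  have hFd := natDegree_pos_of_injOn Metric.isOpen_ball hF ⟨0, h0⟩
  have hopen : IsOpenMap fun w => F.eval w :=
    (F.isOpenQuotientMap_eval (by omega)).isOpenMap
  have hemb : IsOpenEmbedding ((Metric.ball (0 : ℂ) t).domRestrict fun w => F.eval w) :=
    .of_continuous_injective_isOpenMap (F.continuous.comp continuous_subtype_val)
      (injOn_iff_injective.1 (hF.mono (Metric.ball_subset_ball ht1)))
      (hopen.comp Metric.isOpen_ball.isOpenMap_subtype_val)
  have hcontr : ContractibleSpace (Metric.ball (0 : ℂ) t) :=
    (convex_ball (0 : ℂ) t).contractibleSpace ⟨0, by simpa using ht⟩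
  rw [← Set.range_domRestrict]
  exact hemb.isEmbedding.toHomeomorph.toHomotopyEquiv.simplyConnectedSpace_iff.1 inferInstance

/-- The area is the integral of `|F'|²`, which is polyharmonic in the whole plane, so by Pizzetti it
is a polynomial in `t`. The radius `2` only leaves room to include `t = 1`. -/
theorem continuousOn_volume_image_eval
    (hF : InjOn (fun w => F.eval w) (Metric.ball (0 : ℂ) 1)) :
    ContinuousOn (fun t => (volume ((fun w => F.eval w) '' Metric.ball (0 : ℂ) t)).toReal)
      (Icc 0 1) := by
  set G : ℂ → ℂ := fun w => F.derivative.eval w * conj (F.derivative.eval w)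
  have hG : ∀ w ∈ Metric.ball (0 : ℂ) 2, ContDiffAt ℝ ∞ G w := fun w _ =>
    (contDiffAt_polynomial _ w).mul (contDiffAt_conj (contDiffAt_polynomial _ w))
  set K := F.derivative.natDegree + 1
  have hK : ∀ w ∈ Metric.ball (0 : ℂ) 2, (fun v => dZ (dZbar v))^[K] G w = 0 := by
    intro w hw
    rw [(iterate_dZ_dZbar_eq (hG w hw) K).self_of_nhds, mixedDeriv_polynomial_mul_conj,
      iterate_derivative_eq_zero (Nat.lt_succ_self _)]
    simp
  have key : ∀ t ∈ Icc (0 : ℝ) 1,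
      (volume ((fun w => F.eval w) '' Metric.ball (0 : ℂ) t)).toReal =
        ((2 * Real.pi : ℂ) * ∑ i ∈ Finset.range K,
          (t : ℂ) ^ (2 * i + 2) / (2 * (i + 1) * (i.factorial : ℂ) ^ 2) *
          (fun v => dZ (dZbar v))^[i] G 0).re := by
    intro t ht
    have h1 := setIntegral_image_eval Metric.isOpen_ball.measurableSet
      (hF.mono (Metric.ball_subset_ball ht.2)) (fun _ => (1 : ℂ))
    rw [setIntegral_const] at h1
    have h2 : ∀ w, Complex.normSq (F.derivative.eval w) • (1 : ℂ) = G w := fun w => by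
      simp only [G, Complex.mul_conj, Complex.real_smul, mul_one]
    simp only [h2] at h1
    rw [setIntegral_ball_of_polyharmonic K hG hK ht.1 (by linarith [ht.2])] at h1
    rw [← h1]
    simp [Measure.real]
  refine ContinuousOn.congr (Continuous.continuousOn ?_) key
  fun_prop

theorem exists_image_ball_subset {U : Set ℂ} (hU : IsOpen U) {t : ℝ} (ht : t ∈ Ioo (0 : ℝ) 1)
    (hcl : closure ((fun w => F.eval w) '' Metric.ball (0 : ℂ) t) ⊆ U) :
    ∃ s, t < s ∧ s ≤ 1 ∧ (fun w => F.eval w) '' Metric.ball (0 : ℂ) s ⊆ U := by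
  have h1 : Metric.closedBall (0 : ℂ) t ⊆ (fun w => F.eval w) ⁻¹' U := by
    rw [← closure_ball _ ht.1.ne']
    intro w hw
    exact hcl (image_closure_subset_closure_image F.continuous (mem_image_of_mem _ hw))
  obtain ⟨δ, hδ, hsub⟩ := (isCompact_closedBall (0 : ℂ) t).exists_thickening_subset_open
    (hU.preimage F.continuous) h1
  rw [thickening_closedBall hδ ht.1.le] at hsub
  refine ⟨min (δ + t) 1, lt_min (by linarith) ht.2, min_le_right _ _, ?_⟩
  rw [image_subset_iff]
  exact (Metric.ball_subset_ball (min_le_left _ _)).trans hsub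

/-- Needed because a solution in `Ω` may be singular at the boundary: the flux formula applies on
smaller discs, and integrability carries the integral to the limit. -/
theorem tendsto_setIntegral_image_eval {g : ℂ → ℂ}
    (hF : InjOn (fun w => F.eval w) (Metric.ball (0 : ℂ) 1))
    (hg : IntegrableOn g ((fun w => F.eval w) '' Metric.ball (0 : ℂ) 1)) :
    ∃ u : ℕ → ℝ, (∀ m, u m ∈ Ioo (0 : ℝ) 1) ∧ Tendsto u atTop (𝓝 1) ∧
      Tendsto (fun m => ∫ z in (fun w => F.eval w) '' Metric.ball (0 : ℂ) (u m), g z) atTop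
        (𝓝 (∫ z in (fun w => F.eval w) '' Metric.ball (0 : ℂ) 1, g z)) := by
  obtain ⟨u, hu, hu01, hlim⟩ := exists_seq_strictMono_tendsto' (zero_lt_one (α := ℝ))
  have h0 : (0 : ℂ) ∈ Metric.ball (0 : ℂ) 1 := by simp
  have hFd := natDegree_pos_of_injOn Metric.isOpen_ball hF ⟨0, h0⟩
  have hopen : IsOpenMap fun w => F.eval w :=
    (F.isOpenQuotientMap_eval (by omega)).isOpenMap
  have hunion : ⋃ m, (fun w => F.eval w) '' Metric.ball (0 : ℂ) (u m) =
      (fun w => F.eval w) '' Metric.ball (0 : ℂ) 1 := by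
    rw [← image_iUnion]
    congr 1
    refine Subset.antisymm (iUnion_subset fun m => Metric.ball_subset_ball (hu01 m).2.le) ?_
    intro w hw
    have hw' : ‖w‖ < 1 := by simpa using hw
    obtain ⟨m, hm⟩ := (hlim.eventually (lt_mem_nhds hw')).exists
    exact mem_iUnion.2 ⟨m, by simpa using hm⟩
  refine ⟨u, hu01, hlim, ?_⟩
  rw [← hunion] at hg ⊢
  exact tendsto_setIntegral_of_monotone
    (fun m => (hopen _ Metric.isOpen_ball).measurableSet)
    (fun i j hij => image_mono (Metric.ball_subset_ball (hu.monotone hij))) hg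

/-- The time integrals of the source strengths: the weights are the derivatives of `t^{2i+2}`, which
grow from `0` to `1`. -/
theorem integral_mul_pow_mul {E : Type*} [NormedAddCommGroup E] [NormedSpace ℝ E] [CompleteSpace E]
    (N : ℕ) (a : ℕ → E) :
    ∫ t in (0 : ℝ)..1, ∑ i ∈ Finset.range N, ((2 * i + 2) * t ^ (2 * i + 1)) • a i =
      ∑ i ∈ Finset.range N, a i := by
  have hder : ∀ t : ℝ, HasDerivAt (fun t : ℝ => ∑ i ∈ Finset.range N, t ^ (2 * i + 2) • a i)
      (∑ i ∈ Finset.range N, ((2 * i + 2) * t ^ (2 * i + 1)) • a i) t := by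
    intro t
    refine HasDerivAt.fun_sum fun i _ => ?_
    refine ((hasDerivAt_pow (2 * i + 2) t).smul_const (a i)).congr_deriv ?_
    push_cast
    rfl
  rw [intervalIntegral.integral_eq_sub_of_hasDerivAt (fun t _ => hder t)
    (Continuous.intervalIntegrable (by fun_prop) _ _)]
  simp

end Growth

theorem mainTheorem1 (p : ℕ → Polynomial ℝ) (hp : IsAdlerMoser p) (n : ℕ) (hn : 1 ≤ n)
    (S : Polynomial ℝ) (F : Polynomial ℂ)
    (hF : Set.InjOn (fun w => F.eval w) (Metric.ball (0 : ℂ) 1))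
    (Ω : Set ℂ) (hΩ : Ω = (fun w => F.eval w) '' Metric.ball (0 : ℂ) 1)
    (hη : ∀ z ∈ Ω, 0 < porosity p n S z) (hκ : ∀ z ∈ Ω, 0 < permeability p n S z)
    (z₁ : ℂ) (hz₁ : z₁ = F.eval 0)
    (k : ℕ) (hk : k + 1 = (S.natDegree + n * (n + 1) / 2 + 1) * F.natDegree) :
    ∃ (Q : ℝ) (Qm : ℕ → ℂ), Qm k ≠ 0 ∧
      FormedByInjection (permeability p n S) (porosity p n S) Ω z₁ k Q Qm ∧
      QuadratureIdentity (permeability p n S) (porosity p n S) Ω z₁ k Q Qm := by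
  subst hΩ hz₁
  have h0 : (0 : ℂ) ∈ Metric.ball (0 : ℂ) 1 := by simp
  have hFd := natDegree_pos_of_injOn Metric.isOpen_ball hF ⟨0, h0⟩
  have hopen : IsOpenMap fun w => F.eval w :=
    (F.isOpenQuotientMap_eval (by omega)).isOpenMap
  obtain ⟨a, A, hA, hflux⟩ := hp.exists_fluxes hn hF
    (fun w hw => hκ _ (Set.mem_image_of_mem _ hw)) hk
  refine ⟨∑ i ∈ Finset.range (k + 1), a i, fun j => ∑ i ∈ Finset.range (k + 1), A i j, hA, ?_, ?_⟩
  -- The flow is the family of images of concentric discs, with the radius as time; its source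
  -- strengths are the derivatives of the fluxes `∑ t^{2i+2} a_i` and `∑ t^{2i+2} A_{ij}`.
  · refine ⟨1, fun t => (fun w => F.eval w) '' Metric.ball (0 : ℂ) t,
      fun t => ∑ i ∈ Finset.range (k + 1), ((2 * i + 2) * t ^ (2 * i + 1)) • a i,
      fun j t => ∑ i ∈ Finset.range (k + 1), ((2 * i + 2) * t ^ (2 * i + 1)) • A i j,
      one_pos, by simp, rfl, ?_, ?_, continuousOn_volume_image_eval hF, ?_, ?_,
      integral_mul_pow_mul _ _, fun j _ => ⟨?_, integral_mul_pow_mul _ _⟩⟩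
    · exact fun s _ t _ hst => Set.image_mono (Metric.ball_subset_ball hst)
    · intro t ht
      refine ⟨⟨0, by simpa using ht.1, rfl⟩, hopen _ Metric.isOpen_ball, ?_,
        isSimplyConnected_image_eval hF ht.1 ht.2⟩
      exact ((isCompact_closedBall (0 : ℂ) t).image F.continuous).isBounded.subset
        (Set.image_mono Metric.ball_subset_closedBall)
    · intro t ht U φ hU hcl hφ
      -- Regularity near the closure gives a slightly larger disc, so the flux formula is valid for
      -- radii on both sides of `t` and can be differentiated there.
      obtain ⟨s, hts, hs1, hsU⟩ := exists_image_ball_subset hU ht hcl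
      have hev : (fun r => ∫ z in (fun w => F.eval w) '' Metric.ball (0 : ℂ) r,
          (porosity p n S z : ℂ) * φ z) =ᶠ[𝓝 t] fun r : ℝ => 2 * Real.pi *
            ∑ i ∈ Finset.range (k + 1),
              (r : ℂ) ^ (2 * i + 2) * multipole (F.eval 0) k (a i) (A i) φ := by
        filter_upwards [Ioo_mem_nhds ht.1 hts] with r hr
        exact hflux r s hr.1.le hr.2 hs1 U φ hU hsU hφ
      refine HasDerivAt.congr_of_eventuallyEq ?_ hev
      have hm := multipole_sum (Finset.range (k + 1)) (F.eval 0) k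
        (fun i => (2 * i + 2) * t ^ (2 * i + 1)) a A φ
      simp only [smul_eq_mul, Complex.real_smul]
      rw [hm]
      refine HasDerivAt.const_mul _ (HasDerivAt.fun_sum fun i _ => ?_)
      refine HasDerivAt.mul_const ?_ _
      have := (hasDerivAt_pow (2 * i + 2) (t : ℂ)).comp_ofReal
      refine this.congr_deriv ?_
      push_cast
      rfl
    · exact Continuous.intervalIntegrable (by fun_prop) _ _
    · exact Continuous.intervalIntegrable (by fun_prop) _ _
  · intro φ hφ hint
    obtain ⟨u, hu, hulim, hlim⟩ := tendsto_setIntegral_image_eval hF hint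
    refine tendsto_nhds_unique hlim ?_
    have hm := multipole_sum (Finset.range (k + 1)) (F.eval 0) k (fun _ => 1) a A φ
    simp only [one_mul, Complex.ofReal_one] at hm
    rw [hm]
    have h1 : ∀ m, ∫ z in (fun w => F.eval w) '' Metric.ball (0 : ℂ) (u m),
        (porosity p n S z : ℂ) * φ z = 2 * Real.pi * ∑ i ∈ Finset.range (k + 1),
          (u m : ℂ) ^ (2 * i + 2) * multipole (F.eval 0) k (a i) (A i) φ := fun m =>
      hflux (u m) 1 (hu m).1.le (hu m).2 le_rfl _ φ (hopen _ Metric.isOpen_ball) subset_rfl hφ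
    simp only [h1]
    have hc : Continuous fun r : ℝ => 2 * (Real.pi : ℂ) * ∑ i ∈ Finset.range (k + 1),
        (r : ℂ) ^ (2 * i + 2) * multipole (F.eval 0) k (a i) (A i) φ := by fun_prop
    have := (hc.tendsto 1).comp hulim
    simpa only [Complex.ofReal_one, one_pow, one_mul, Function.comp_def] using this
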